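/- Let $a>0$, $\lambda>0$, let $k\ge 1$, $k_b\ge 0$, $r\ge 0$, $p\ge 1$ be integers, and let $a_{-r},\dots,a_p$ be real numbers with $a_{-r}\,a_p\ne 0$ that satisfy $$\sum_{\ell=-r}^{p}\ell^m a_\ell=(-\lambda a)^m\quad(m=0,\dots,k)\qquad\text{and}\qquad \sup_{\theta\in[0,2\pi]}\Big|\sum_{\ell=-r}^{p}a_\ell\,e^{i\ell\theta}\Big|\le 1 .$$ (For $m=\ell=0$ one reads $0^0=1$.) Then there is a constant $C>0$ such that the following holds for all $T>0$, all integers $J\ge 1$, all real $L\ge 1$, and all $u_0\in H^{k+1}((0,L))$ with $u_0^{(m)}(0)=0$ for $m=0,\dots,k$. Put $\Delta x=L/J$, $\Delta t=\lambda\,\Delta x$, $x_j=j\,\Delta x$, $t^n=n\,\Delta t$, write $(D_-v)_j=v_j-v_{j-1}$, and let $(u_j^n)$ be the solution of $$u_j^{n+1}=\sum_{\ell=-r}^{p}a_\ell\,u_{j+\ell}^n\quad(n\ge 0,\ 1\le j\le J),\qquad u_j^0=\frac1{\Delta x}\int_{x_{j-1}}^{x_j}u_0(y)\,dy\quad(1\le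 j\le J),$$ with the ghost values given for all $n\ge 0$ by $$u_\ell^n=0\quad(\ell\le 0),\qquad (D_-^{k_b}u^n)_{J+\ell}=0\quad(\ell=1,\dots,p).$$ (Of the values $u_\ell^n$ with $\ell\le 0$ only those with $1-r\le \ell\le 0$ are used, unless $J<k_b-r$.) Then $$\sup_{0\le n\le T/\Delta t}\ \sup_{1\le j\le J}\ \Big|u_j^n-\frac1{\Delta x}\int_{x_{j-1}}^{x_j}u_0(y-a\,t^n)\,dy\Big|\le C\,(\sqrt T+T)\,e^{CT/L}\,\Delta x^{\min(k,k_b)-1/2}\,\|u_0\|_{H^{k+1}((0,L))},$$ where $u_0$ is extended by $0$ to $(-\infty,0]$. The constant $C$ depends only on $a$, $\lambda$, $k$, $k_b$, $r$, $p$ and the coefficients $a_\ell$, and $\|u_0\|_{H^{k+1}((0,L))}=\big(\sum_{m=0}^{k+1}\|u_0^{(m)}\|_{L^2((0,L))}^2\big)^{1/2}$. -/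

import Mathlib

open Set MeasureTheory
open scoped ContDiff

noncomputable section

/-! ### Sobolev functions on the interval `(0, L)` -/

/-- `g` is the weak derivative of order `m` of `u` on the open interval `(0, L)`:
`∫ u φ⁽ᵐ⁾ = (-1)ᵐ ∫ g φ` for every smooth `φ` with compact support in `(0, L)`. -/
def IsWeakDeriv (L : ℝ) (m : ℕ) (u g : ℝ → ℝ) : Prop :=
  ∀ φ : ℝ → ℝ, ContDiff ℝ ∞ φ → HasCompactSupport φ → tsupport φ ⊆ Ioo 0 L →
    ∫ x in Ioo 0 L, u x * iteratedDeriv m φ x = (-1) ^ m * ∫ x in Ioo 0 L, g x * φ x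

/-- `u` belongs to `H^s((0, L))`: `u` and its weak derivatives of order at most `s` are in
`L²((0, L))`. Only the restriction of `u` to `(0, L)` matters. -/
def MemH (s : ℕ) (L : ℝ) (u : ℝ → ℝ) : Prop :=
  MemLp u 2 (volume.restrict (Ioo 0 L)) ∧
    ∀ m ≤ s, ∃ g : ℝ → ℝ, MemLp g 2 (volume.restrict (Ioo 0 L)) ∧ IsWeakDeriv L m u g

open Classical in
/-- The square integrable weak derivative of order `m` of `u` on `(0, L)`. It is unique up to
equality almost everywhere on `(0, L)`; the value is `0` if there is none. -/
def weakDeriv (L : ℝ) (m : ℕ) (u : ℝ → ℝ) : ℝ → ℝ :=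
  if h : ∃ g : ℝ → ℝ, MemLp g 2 (volume.restrict (Ioo 0 L)) ∧ IsWeakDeriv L m u g
  then h.choose else 0

/-- The norm of `H^s((0, L))`: `(∑_{m ≤ s} ‖u⁽ᵐ⁾‖²_{L²((0, L))})^{1/2}`. -/
def normH (s : ℕ) (L : ℝ) (u : ℝ → ℝ) : ℝ :=
  Real.sqrt (∑ m ∈ Finset.range (s + 1), ∫ x in Ioo 0 L, (weakDeriv L m u x) ^ 2)

/-- The condition `u⁽ᵐ⁾(0) = 0`: the weak derivative of order `m` has a representative that is
continuous on `[0, L]` and vanishes at `0`. -/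
def DerivVanishesAtZero (L : ℝ) (m : ℕ) (u : ℝ → ℝ) : Prop :=
  ∃ v : ℝ → ℝ, ContinuousOn v (Icc 0 L) ∧
    v =ᵐ[volume.restrict (Ioo 0 L)] weakDeriv L m u ∧ v 0 = 0

/-- The extension of `u` by `0` to the negative half-line. -/
def extendZero (u : ℝ → ℝ) : ℝ → ℝ := fun x => if x ≤ 0 then 0 else u x

/-! ### The numerical scheme -/

/-- The coefficients `c (-r), …, c p` are normalized, consistent of order `k` with the transport
equation of velocity `a` for the ratio `lam = Δt / Δx`, and `ℓ²`-stable. -/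
structure SchemeAssumption (a lam : ℝ) (r p : ℕ) (k : ℕ) (c : ℤ → ℝ) : Prop where
  normalized : c (-(r : ℤ)) * c (p : ℤ) ≠ 0
  consistent : ∀ m : ℕ, m ≤ k →
    ∑ l ∈ Finset.Icc (-(r : ℤ)) (p : ℤ), (l : ℝ) ^ m * c l = (-(lam * a)) ^ m
  stable : ∀ θ ∈ Icc (0 : ℝ) (2 * Real.pi),
    ‖∑ l ∈ Finset.Icc (-(r : ℤ)) (p : ℤ), (c l : ℂ) * Complex.exp (Complex.I * l * θ)‖ ≤ 1

/-- The backward difference operator `(D₋ v)_j = v_j - v_{j-1}`. -/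
def backDiff (v : ℤ → ℝ) : ℤ → ℝ := fun j => v j - v (j - 1)

/-- The average of `f` over the cell `((j-1) dx, j dx)`. -/
def cellAverage (dx : ℝ) (f : ℝ → ℝ) (j : ℤ) : ℝ :=
  (1 / dx) * ∫ y in (((j : ℝ) - 1) * dx)..((j : ℝ) * dx), f y

/-- `u n j` solves the scheme with coefficients `c (-r), …, c p` on the cells `1, …, J` of width
`dx`, with homogeneous Dirichlet ghost values on the left, the extrapolation condition of order
`kb` on the right, and initial datum the cell averages of `u₀`. -/
structure IsSchemeSolution (r p kb : ℕ) (c : ℤ → ℝ) (J : ℕ) (dx : ℝ) (u₀ : ℝ → ℝ)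
    (u : ℕ → ℤ → ℝ) : Prop where
  initial : ∀ j : ℤ, 1 ≤ j → j ≤ J → u 0 j = cellAverage dx u₀ j
  /-- Of these values, the scheme uses those with `1 - r ≤ l ≤ 0`; values further to the left
  enter only on very coarse grids, `J < kb - r`, where the condition `neumann` reaches beyond the
  cell `1 - r`. -/
  dirichlet : ∀ (n : ℕ) (l : ℤ), l ≤ 0 → u n l = 0
  neumann : ∀ (n : ℕ) (l : ℤ), 1 ≤ l → l ≤ p → (backDiff^[kb] (u n)) (J + l) = 0
  interior : ∀ (n : ℕ) (j : ℤ), 1 ≤ j → j ≤ J →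
    u (n + 1) j = ∑ l ∈ Finset.Icc (-(r : ℤ)) (p : ℤ), c l * u n (j + l)

end

/-! Let `W` be the cell averages of the exact solution. The error `e = u - W` solves the scheme with
a source of `ℓ²` size `ε` at each step and an error `γ` in the outflow condition. `exists_stability`
bounds its energy (a plain sum of squares over the cells) after `N` steps by `C * exp (C N / J) *
((N ε)² + N γ²)`, as `e 0 = 0` on the cells, and a single value is at most the square root of the
energy. Here `ε = O(Δx^(k+1/2))`, `γ = O(Δx^min(k,kb))` and `N ≤ T / (λ Δx)`, which gives the
exponent `min(k,kb) - 1/2` and the factor `√T + T`.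

Stability. On the whole line, Parseval and the von Neumann bound make the operator a contraction of
`ℓ²` (`sum_stencil_sq_le`). On `1, …, J` the contraction is applied to extensions of the grid
function past the ghost cells. With the extension by zero, the energy that leaves on the right and
`c (-r) ≠ 0` control all values near the right end by the ghost values (`exists_dirichlet_trace`).
With the extension by a slowly decreasing ramp of height `v J`, the tail moves outwards because `a >
0`, so its energy grows by a fixed amount (`exists_tail`) at the expense of the interior; hence the
boundary values are controlled by their first differences (`exists_outflow_trace`). Starting from
`D₋^kb e`, which is `O(γ)` at the ghost cells, one descends through the orders of the difference to
`D₋ e` (`exists_potential`) and then to `e` (`exists_energy_functional`). Since `D₋^m e` obeys the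
scheme only away from the left end, a cutoff of slope `O(1/J)` is inserted; its commutators cost
`energy / J` per step, whence the factor `exp (C T / L)`.

Consistency. The conditions at `0` make `u₀` the `(k+1)`-fold primitive of a square integrable `g`
(`exists_iterInt_representation`). This primitive vanishes on the left and continues past `L`, which
defines `W` on the ghost cells. Taylor's formula and the moment conditions give `ε`
(`exists_consistency`); differences of averages of primitives give `γ`
(`abs_backDiff_iterate_cellAverage_le`). For `Δx ≥ 1` stability alone is enough
(`exists_coarse_bound`). -/

noncomputable section

/-! ### Parseval's identity and contraction on the whole line -/

/-- The convolution operator `v ↦ ∑ l, c l * v (j + l)` of the scheme. -/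
def stencil (r p : ℕ) (c : ℤ → ℝ) (v : ℤ → ℝ) (j : ℤ) : ℝ :=
  ∑ l ∈ Finset.Icc (-(r : ℤ)) (p : ℤ), c l * v (j + l)

lemma integral_exp_I_int (n : ℤ) :
    ∫ θ in (0 : ℝ)..(2 * Real.pi), Complex.exp (Complex.I * n * θ) =
      if n = 0 then ((2 * Real.pi : ℝ) : ℂ) else 0 := by
  split_ifs with h
  · subst h; simp
  · have hc : Complex.I * (n : ℂ) ≠ 0 := mul_ne_zero Complex.I_ne_zero (by exact_mod_cast h)
    rw [integral_exp_mul_complex hc]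
    have : Complex.exp (Complex.I * n * ((2 * Real.pi : ℝ) : ℂ)) = 1 := by
      rw [Complex.exp_eq_one_iff]
      exact ⟨n, by push_cast; ring⟩
    rw [this]; simp

/-- Parseval's identity for real trigonometric polynomials. -/
lemma integral_norm_sq_trigPoly (T : Finset ℤ) (v : ℤ → ℝ) :
    ∫ θ in (0 : ℝ)..(2 * Real.pi), ‖∑ j ∈ T, (v j : ℂ) * Complex.exp (Complex.I * j * θ)‖ ^ 2 =
      2 * Real.pi * ∑ j ∈ T, v j ^ 2 := by
  have key : ∀ θ : ℝ, ((‖∑ j ∈ T, (v j : ℂ) * Complex.exp (Complex.I * j * θ)‖ ^ 2 : ℝ) : ℂ) =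
      ∑ j ∈ T, ∑ i ∈ T, ((v j : ℂ) * v i) * Complex.exp (Complex.I * ((j - i : ℤ) : ℂ) * θ) := by
    intro θ
    rw [Complex.ofReal_pow, ← Complex.mul_conj', map_sum, Finset.sum_mul_sum]
    refine Finset.sum_congr rfl fun j _ => Finset.sum_congr rfl fun i _ => ?_
    rw [map_mul, Complex.conj_ofReal, ← Complex.exp_conj, mul_mul_mul_comm, ← Complex.exp_add]
    congr 2
    simp
    ring
  have h : ((∫ θ in (0 : ℝ)..(2 * Real.pi),
      ‖∑ j ∈ T, (v j : ℂ) * Complex.exp (Complex.I * j * θ)‖ ^ 2 : ℝ) : ℂ) =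
      ((2 * Real.pi * ∑ j ∈ T, v j ^ 2 : ℝ) : ℂ) := by
    rw [← intervalIntegral.integral_ofReal]
    simp_rw [key]
    rw [intervalIntegral.integral_finsetSum]
    · have : ∀ j ∈ T, (∫ θ in (0 : ℝ)..(2 * Real.pi), ∑ i ∈ T,
          ((v j : ℂ) * v i) * Complex.exp (Complex.I * ((j - i : ℤ) : ℂ) * θ)) =
          2 * Real.pi * (v j : ℂ) ^ 2 := by
        intro j hj
        rw [intervalIntegral.integral_finsetSum]
        · simp_rw [intervalIntegral.integral_const_mul, integral_exp_I_int, sub_eq_zero]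
          simp [hj]
          ring
        · intro i _
          exact Continuous.intervalIntegrable (by fun_prop) _ _
      rw [Finset.sum_congr rfl this, ← Finset.mul_sum]
      push_cast
      rfl
    · intro j _
      exact Continuous.intervalIntegrable (by fun_prop) _ _
  exact_mod_cast h

lemma sum_shift_of_support {M : Type*} [AddCommMonoid M] (F : ℤ → M) (T T' : Finset ℤ) (l : ℤ)
    (hF : ∀ j, j ∉ T → F j = 0) (hT : ∀ j ∈ T, j - l ∈ T') :
    ∑ j ∈ T', F (j + l) = ∑ j ∈ T, F j := by
  have : ∑ j ∈ T', F (j + l) = ∑ j ∈ T'.map (addRightEmbedding l), F j := by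
    rw [Finset.sum_map]; rfl
  rw [this]
  symm
  apply Finset.sum_subset
  · intro j hj
    rw [Finset.mem_map]
    exact ⟨j - l, hT j hj, by simp⟩
  · intro j _ hj
    exact hF j hj

/-- Under the von Neumann condition the operator is a contraction of `ℓ²`. -/
lemma sum_stencil_sq_le {a lam : ℝ} {r p k : ℕ} {c : ℤ → ℝ} (hc : SchemeAssumption a lam r p k c)
    (S T : Finset ℤ) (v : ℤ → ℝ) (hv : ∀ j, j ∉ T → v j = 0) :
    ∑ j ∈ S, stencil r p c v j ^ 2 ≤ ∑ j ∈ T, v j ^ 2 := by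
  classical
  set K := Finset.Icc (-(r : ℤ)) (p : ℤ)
  -- `T'` contains every index at which the operator applied to `v` can be nonzero, so the symbol
  -- identity below holds exactly.
  set T' : Finset ℤ := S ∪ (T ×ˢ K).image (fun x => x.1 - x.2)
  have hST : ∑ j ∈ S, stencil r p c v j ^ 2 ≤ ∑ j ∈ T', stencil r p c v j ^ 2 :=
    Finset.sum_le_sum_of_subset_of_nonneg Finset.subset_union_left fun _ _ _ => sq_nonneg _
  refine hST.trans ?_
  have hsymb : ∀ θ : ℝ, ∑ j ∈ T', (stencil r p c v j : ℂ) * Complex.exp (Complex.I * j * θ) =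
      (∑ l ∈ K, (c l : ℂ) * Complex.exp (-(Complex.I * l * θ))) *
        ∑ j ∈ T, (v j : ℂ) * Complex.exp (Complex.I * j * θ) := by
    intro θ
    rw [Finset.sum_mul]
    simp only [stencil, Complex.ofReal_sum, Finset.sum_mul]
    rw [Finset.sum_comm]
    refine Finset.sum_congr rfl fun l hl => ?_
    rw [← sum_shift_of_support (fun j => (v j : ℂ) * Complex.exp (Complex.I * j * θ)) T T' l
      (fun j hj => by simp [hv j hj])
      (fun j hj => Finset.mem_union_right _ (Finset.mem_image.2
        ⟨(j, l), Finset.mem_product.2 ⟨hj, hl⟩, rfl⟩)), Finset.mul_sum]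
    refine Finset.sum_congr rfl fun j _ => ?_
    have : Complex.exp (Complex.I * j * θ) =
        Complex.exp (-(Complex.I * l * θ)) * Complex.exp (Complex.I * ((j + l : ℤ) : ℂ) * θ) := by
      rw [← Complex.exp_add]; congr 1; push_cast; ring
    rw [this]; push_cast; ring
  -- The symbol occurs at `-θ`; since `c` is real, conjugation brings it back to `θ`.
  have hle : ∀ θ ∈ Icc (0 : ℝ) (2 * Real.pi),
      ‖∑ l ∈ K, (c l : ℂ) * Complex.exp (-(Complex.I * l * θ))‖ ≤ 1 := by
    intro θ hθ
    have h := hc.stable θ hθ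
    rw [← Complex.norm_conj, map_sum] at h
    convert h using 4 with l hl
    rw [map_mul, Complex.conj_ofReal, ← Complex.exp_conj]
    simp
  have hint : ∫ θ in (0 : ℝ)..(2 * Real.pi),
      ‖∑ j ∈ T', (stencil r p c v j : ℂ) * Complex.exp (Complex.I * j * θ)‖ ^ 2 ≤
      ∫ θ in (0 : ℝ)..(2 * Real.pi), ‖∑ j ∈ T, (v j : ℂ) * Complex.exp (Complex.I * j * θ)‖ ^ 2 := by
    apply intervalIntegral.integral_mono_on (by positivity)
    · exact Continuous.intervalIntegrable (by fun_prop) _ _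
    · exact Continuous.intervalIntegrable (by fun_prop) _ _
    · intro θ hθ
      rw [hsymb, norm_mul]
      gcongr
      exact mul_le_of_le_one_left (norm_nonneg _) (hle θ hθ)
  rw [integral_norm_sq_trigPoly, integral_norm_sq_trigPoly] at hint
  exact le_of_mul_le_mul_left hint (by positivity)

lemma sum_Icc_one {M : Type*} [AddCommMonoid M] (f : ℤ → M) (n : ℕ) :
    ∑ j ∈ Finset.Icc (1 : ℤ) n, f j = ∑ i ∈ Finset.range n, f (i + 1) := by
  refine Finset.sum_nbij' (fun j => (j - 1).toNat) (fun i => (i : ℤ) + 1) ?_ ?_ ?_ ?_ ?_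
  · intro j hj; simp only [Finset.mem_Icc, Finset.mem_range] at *; omega
  · intro j hj; simp only [Finset.mem_Icc, Finset.mem_range] at *; omega
  · intro j hj; simp only [Finset.mem_Icc] at *; omega
  · intro j hj; simp
  · intro j hj; simp only [Finset.mem_Icc] at hj; congr 1; omega

lemma sum_Icc_one_add {M : Type*} [AddCommMonoid M] (f : ℤ → M) (J n : ℕ) :
    ∑ j ∈ Finset.Icc (1 : ℤ) ((J : ℤ) + n), f j =
      ∑ j ∈ Finset.Icc (1 : ℤ) J, f j + ∑ i ∈ Finset.Icc (1 : ℤ) n, f (J + i) := by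
  have := sum_Icc_one f (J + n)
  rw [Nat.cast_add] at this
  rw [this, sum_Icc_one, sum_Icc_one, Finset.sum_range_add]
  simp only [Nat.cast_add, add_assoc]

lemma abs_sum_mul_le_of_abs_le {S : Finset ℤ} {c w : ℤ → ℝ} {B : ℝ} (h : ∀ l ∈ S, |w l| ≤ B) :
    |∑ l ∈ S, c l * w l| ≤ (∑ l ∈ S, |c l|) * B := by
  refine (Finset.abs_sum_le_sum_abs _ _).trans ?_
  rw [Finset.sum_mul]
  refine Finset.sum_le_sum fun l hl => ?_
  rw [abs_mul]
  exact mul_le_mul_of_nonneg_left (h l hl) (abs_nonneg _)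

lemma abs_stencil_le {r p : ℕ} {c v : ℤ → ℝ} {j : ℤ} {B : ℝ}
    (h : ∀ l ∈ Finset.Icc (-(r : ℤ)) (p : ℤ), |v (j + l)| ≤ B) :
    |stencil r p c v j| ≤ (∑ l ∈ Finset.Icc (-(r : ℤ)) (p : ℤ), |c l|) * B :=
  abs_sum_mul_le_of_abs_le h

lemma stencil_congr {r p : ℕ} {c v w : ℤ → ℝ} {i j : ℤ}
    (h : ∀ l, -(r : ℤ) ≤ l → l ≤ p → v (i + l) = w (j + l)) :
    stencil r p c v i = stencil r p c w j := by
  refine Finset.sum_congr rfl fun l hl => ?_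
  rw [Finset.mem_Icc] at hl
  rw [h l hl.1 hl.2]

lemma abs_le_sqrt_sum {S : Finset ℤ} (f : ℤ → ℝ) {i : ℤ} (hi : i ∈ S) :
    |f i| ≤ Real.sqrt (∑ j ∈ S, f j ^ 2) := by
  rw [← Real.sqrt_sq_eq_abs]
  exact Real.sqrt_le_sqrt (Finset.single_le_sum (f := fun j => f j ^ 2)
    (fun _ _ => sq_nonneg _) hi)

/-! ### Ramps gain energy: the role of a positive velocity -/

section Scheme

variable {a lam : ℝ} {r p k : ℕ} {c : ℤ → ℝ}

lemma SchemeAssumption.sum_eq_one (hc : SchemeAssumption a lam r p k c) :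
    ∑ l ∈ Finset.Icc (-(r : ℤ)) (p : ℤ), c l = 1 := by
  simpa using hc.consistent 0 (Nat.zero_le _)

lemma SchemeAssumption.sum_mul_eq (hc : SchemeAssumption a lam r p k c) (hk : 1 ≤ k) :
    ∑ l ∈ Finset.Icc (-(r : ℤ)) (p : ℤ), c l * l = -(lam * a) := by
  simpa [mul_comm] using hc.consistent 1 hk

/-- The sequence equal to `1` up to `p` that decreases linearly to `0` over `M` steps. -/
def ramp (p M : ℕ) (i : ℤ) : ℝ := max 0 (min 1 (((M : ℝ) + p - i) / M))

lemma ramp_nonneg (p M : ℕ) (i : ℤ) : 0 ≤ ramp p M i := le_max_left _ _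

lemma ramp_le_one (p M : ℕ) (i : ℤ) : ramp p M i ≤ 1 :=
  max_le zero_le_one (min_le_left _ _)

lemma ramp_eq_one {p M : ℕ} (hM : 0 < M) {i : ℤ} (hi : i ≤ p) : ramp p M i = 1 := by
  have hM' : (0 : ℝ) < M := by exact_mod_cast hM
  have hi' : (i : ℝ) ≤ p := by exact_mod_cast hi
  have : 1 ≤ ((M : ℝ) + p - i) / M := by rw [le_div_iff₀ hM']; linarith
  rw [ramp, min_eq_left this]; simp

lemma ramp_eq_zero {p M : ℕ} {i : ℤ} (hi : (M : ℤ) + p ≤ i) : ramp p M i = 0 := by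
  have hi' : (M : ℝ) + p ≤ i := by exact_mod_cast hi
  have : ((M : ℝ) + p - i) / M ≤ 0 := div_nonpos_of_nonpos_of_nonneg (by linarith) (by positivity)
  rw [ramp, max_eq_left ((min_le_right _ _).trans this)]

lemma ramp_eq_div {p M : ℕ} (hM : 0 < M) {i : ℤ} (hi : (p : ℤ) ≤ i) (hi2 : i ≤ (M : ℤ) + p) :
    ramp p M i = ((M : ℝ) + p - i) / M := by
  have hM' : (0 : ℝ) < M := by exact_mod_cast hM
  have hi' : (p : ℝ) ≤ i := by exact_mod_cast hi
  have hi2' : (i : ℝ) ≤ M + p := by exact_mod_cast hi2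
  rw [ramp, min_eq_right, max_eq_right]
  · exact div_nonneg (by linarith) hM'.le
  · rw [div_le_one hM']; linarith

lemma abs_clamp_sub_le (x y : ℝ) : |max 0 (min 1 x) - max 0 (min 1 y)| ≤ |x - y| := by
  refine (abs_max_sub_max_le_max _ _ _ _).trans ?_
  rw [sub_self, abs_zero, max_eq_right (abs_nonneg _)]
  refine (abs_min_sub_min_le_max _ _ _ _).trans ?_
  rw [sub_self, abs_zero, max_eq_right (abs_nonneg _)]

lemma abs_ramp_sub_le (p M : ℕ) (i l : ℤ) :
    |ramp p M (i + l) - ramp p M i| ≤ |(l : ℝ)| / M := by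
  refine (abs_clamp_sub_le _ _).trans (le_of_eq ?_)
  rw [← sub_div, abs_div, Nat.abs_cast]
  congr 1
  rw [← abs_neg]; congr 1; push_cast; ring

/-- A slowly decreasing tail loses a definite amount of energy: this encodes `a > 0`. -/
lemma exists_tail (ha : 0 < a) (hlam : 0 < lam) (hk : 1 ≤ k) (hc : SchemeAssumption a lam r p k c) :
    ∃ (φ : ℤ → ℝ) (M : ℕ), p ≤ M ∧ (∀ i : ℤ, i ≤ p → φ i = 1) ∧ (∀ i : ℤ, (M : ℤ) < i → φ i = 0) ∧
      (∀ i, |φ i| ≤ 1) ∧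
      ∑ i ∈ Finset.Icc (1 : ℤ) ((M : ℤ) + r), (φ i ^ 2 - stencil r p c φ i ^ 2) ≤
        -(lam * a / 2) := by
  set μ := lam * a with hμdef
  have hμ : 0 < μ := mul_pos hlam ha
  set K := Finset.Icc (-(r : ℤ)) (p : ℤ) with hK
  set K1 : ℝ := ∑ l ∈ K, |c l| * |(l : ℝ)| with hK1
  have hK1' : 0 ≤ K1 := Finset.sum_nonneg fun _ _ => by positivity
  set E : ℝ := K1 * (2 + K1) + 2 * μ with hE
  have hE0 : 0 ≤ E := by positivity
  -- With this `M` the total error `(μ + 2 (p + r) E) / M` is at most half of the main term `μ`.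
  obtain ⟨M, hM⟩ := exists_nat_gt (2 * (μ + 2 * (p + r) * E) / μ)
  have hMpos : (0 : ℝ) < M := lt_of_le_of_lt (by positivity) hM
  have hM0 : 0 < M := by exact_mod_cast hMpos
  have hM1 : (1 : ℝ) ≤ M := by exact_mod_cast hM0
  set φ := ramp p M with hφ
  refine ⟨φ, M + p, by omega, fun i hi => ramp_eq_one hM0 hi,
    fun i hi => ramp_eq_zero (by push_cast at hi; omega),
    fun i => abs_le.2 ⟨by linarith [ramp_nonneg p M i], ramp_le_one p M i⟩, ?_⟩
  have hdiff : ∀ i, stencil r p c φ i - φ i = ∑ l ∈ K, c l * (φ (i + l) - φ i) := by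
    intro i
    simp only [mul_sub, Finset.sum_sub_distrib, ← Finset.sum_mul]
    rw [hc.sum_eq_one, one_mul]; rfl
  have hgen : ∀ i, |stencil r p c φ i - φ i| ≤ K1 / M := by
    intro i
    rw [hdiff]
    refine (Finset.abs_sum_le_sum_abs _ _).trans ?_
    rw [hK1, Finset.sum_div]
    refine Finset.sum_le_sum fun l _ => ?_
    rw [abs_mul, mul_div_assoc]
    exact mul_le_mul_of_nonneg_left (abs_ramp_sub_le p M i l) (abs_nonneg _)
  -- Here the whole stencil lies on the linear part, of slope `-1 / M`, and the first moment
  -- condition gives the increment exactly.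
  have hbulk : ∀ i : ℤ, (p : ℤ) + r ≤ i → i ≤ M → stencil r p c φ i - φ i = μ / M := by
    intro i h1 h2
    rw [hdiff]
    have : ∀ l ∈ K, c l * (φ (i + l) - φ i) = (c l * l) * (-1 / M) := by
      intro l hl
      rw [hK, Finset.mem_Icc] at hl
      rw [hφ, ramp_eq_div hM0 (by omega) (by omega), ramp_eq_div hM0 (by omega) (by omega)]
      push_cast; field_simp; ring
    rw [Finset.sum_congr rfl this, ← Finset.sum_mul, hc.sum_mul_eq hk]
    ring
  set bulk : ℤ → Prop := fun i => (p : ℤ) + r ≤ i ∧ i ≤ M with hbulkdef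
  classical
  -- Summed over about `M` sites of mean height `1 / 2`, the first term yields about `-μ`. At the
  -- two corners, at most `2 (p + r)` sites, the increment is still `O(1 / M)`, and `E / M` pays for
  -- it and for the first term.
  have hterm : ∀ i, φ i ^ 2 - stencil r p c φ i ^ 2 ≤
      -(2 * (μ / M)) * φ i + (if bulk i then 0 else E / M) := by
    intro i
    have e : φ i ^ 2 - stencil r p c φ i ^ 2 =
      -(stencil r p c φ i - φ i) * (2 * φ i + (stencil r p c φ i - φ i)) := by ring
    split_ifs with hb
    · rw [e, hbulk i hb.1 hb.2]
      have : 0 ≤ (μ / M) * (μ / M) := mul_self_nonneg _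
      nlinarith
    · rw [e]
      set x := stencil r p c φ i - φ i with hx
      have hx' : |x| ≤ K1 / M := hgen i
      have h0 : 0 ≤ φ i := ramp_nonneg p M i
      have h1 : φ i ≤ 1 := ramp_le_one p M i
      have h2 : -x * (2 * φ i + x) ≤ (K1 / M) * (2 + K1) := by
        calc -x * (2 * φ i + x) ≤ |-x * (2 * φ i + x)| := le_abs_self _
          _ = |x| * |2 * φ i + x| := by rw [abs_mul, abs_neg]
          _ ≤ (K1 / M) * (2 + K1) := by
            refine mul_le_mul hx' ?_ (abs_nonneg _) (by positivity)
            refine (abs_add_le _ _).trans ?_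
            have : K1 / M ≤ K1 := div_le_self hK1' hM1
            rw [abs_of_nonneg (by positivity)]
            linarith
      have h3 : (2 * (μ / M)) * φ i ≤ 2 * (μ / M) :=
        mul_le_of_le_one_right (by positivity) h1
      have h4 : E / M = (K1 / M) * (2 + K1) + 2 * (μ / M) := by rw [hE]; ring
      linarith
  have hcast : (((M + p : ℕ) : ℤ) + r) = (((M + (p + r) : ℕ)) : ℤ) := by push_cast; ring
  rw [hcast]
  set N := M + (p + r)
  refine (Finset.sum_le_sum fun i _ => hterm i).trans ?_
  rw [Finset.sum_add_distrib, ← Finset.mul_sum]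
  have hs1 : ((M : ℝ) - 1) / 2 ≤ ∑ i ∈ Finset.Icc (1 : ℤ) (N : ℤ), φ i := by
    have h1 : ∑ i ∈ Finset.Icc (1 : ℤ) (M : ℤ), φ i ≤ ∑ i ∈ Finset.Icc (1 : ℤ) (N : ℤ), φ i :=
      Finset.sum_le_sum_of_subset_of_nonneg
        (Finset.Icc_subset_Icc le_rfl (by push_cast [N]; omega)) fun i _ _ => ramp_nonneg p M i
    refine le_trans ?_ h1
    have h2 : ∑ i ∈ Finset.Icc (1 : ℤ) (M : ℤ), ((M : ℝ) - i) / M = ((M : ℝ) - 1) / 2 := by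
      rw [sum_Icc_one, ← Finset.sum_div, div_eq_iff hMpos.ne']
      have : ∀ n : ℕ, ∀ x : ℝ, ∑ i ∈ Finset.range n, (x - ((i + 1 : ℤ) : ℝ)) =
          n * x - n * (n + 1) / 2 := by
        intro n x
        induction n with
        | zero => simp
        | succ n ih => rw [Finset.sum_range_succ, ih]; push_cast; ring
      rw [this]; ring
    rw [← h2]
    refine Finset.sum_le_sum fun i hi => ?_
    rw [Finset.mem_Icc] at hi
    rw [hφ, ramp]
    refine le_trans ?_ (le_max_right _ _)
    refine le_min ?_ ?_
    · rw [div_le_one hMpos]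
      have : (1 : ℝ) ≤ i := by exact_mod_cast hi.1
      linarith
    · gcongr
      linarith [(Nat.cast_nonneg p : (0 : ℝ) ≤ p)]
  have hs2 : ∑ i ∈ Finset.Icc (1 : ℤ) (N : ℤ), (if bulk i then 0 else E / M) ≤
      2 * (p + r) * (E / M) := by
    rw [Finset.sum_ite, Finset.sum_const_zero, zero_add, Finset.sum_const, nsmul_eq_mul]
    refine mul_le_mul_of_nonneg_right ?_ (by positivity)
    have hsub : (Finset.Icc (1 : ℤ) (N : ℤ)).filter (fun i => ¬ bulk i) ⊆
        Finset.Icc (1 : ℤ) ((p : ℤ) + r) ∪ Finset.Icc ((M : ℤ) + 1) N := by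
      intro i hi
      simp only [hbulkdef, Finset.mem_filter, Finset.mem_Icc, Finset.mem_union, not_and_or,
        not_le] at hi ⊢
      omega
    have h1 := (Finset.card_le_card hsub).trans (Finset.card_union_le _ _)
    rw [Int.card_Icc, Int.card_Icc] at h1
    have h2 : ((Finset.Icc (1 : ℤ) (N : ℤ)).filter (fun i => ¬ bulk i)).card ≤ 2 * (p + r) := by
      omega
    exact_mod_cast h2
  have h5 : -(2 * (μ / M)) * ∑ i ∈ Finset.Icc (1 : ℤ) (N : ℤ), φ i ≤
      -(2 * (μ / M)) * (((M : ℝ) - 1) / 2) :=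
    mul_le_mul_of_nonpos_left hs1 (by rw [neg_nonpos]; positivity)
  have h6 : -(2 * (μ / M)) * (((M : ℝ) - 1) / 2) + 2 * (p + r) * (E / M) =
      -μ + (μ + 2 * (p + r) * E) / M := by field_simp; ring
  have h7 : (μ + 2 * (p + r) * E) / M ≤ μ / 2 := by
    rw [div_lt_iff₀ hμ] at hM
    rw [div_le_iff₀ hMpos]; linarith
  linarith

/-- A von Neumann stable consistent scheme for a positive velocity looks upwind. -/
lemma one_le_left_width (ha : 0 < a) (hlam : 0 < lam) (hk : 1 ≤ k)
    (hc : SchemeAssumption a lam r p k c) : 1 ≤ r := by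
  by_contra h
  obtain rfl : r = 0 := by omega
  obtain ⟨φ, M, _, _, hφ0, _, hφ⟩ := exists_tail ha hlam hk hc
  -- If `r = 0`, the operator at `i ≥ 1` reads only indices `≥ 1`, so `φ` cut off below `1` would
  -- gain energy under a contraction.
  have h1 := sum_stencil_sq_le hc (Finset.Icc (1 : ℤ) M) (Finset.Icc (1 : ℤ) M)
    (fun i => if 1 ≤ i then φ i else 0) (by
      intro j hj
      split_ifs with h1
      · exact hφ0 j (by simp only [Finset.mem_Icc] at hj; omega)
      · rfl)
  have h2 : ∀ i ∈ Finset.Icc (1 : ℤ) M,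
      stencil 0 p c (fun i => if 1 ≤ i then φ i else 0) i = stencil 0 p c φ i := by
    intro i hi
    rw [Finset.mem_Icc] at hi
    refine stencil_congr fun l hl _ => if_pos ?_
    push_cast at hl; omega
  rw [Finset.sum_congr rfl fun i hi => by rw [h2 i hi]] at h1
  have h3 : ∑ j ∈ Finset.Icc (1 : ℤ) M, (if 1 ≤ j then φ j else 0) ^ 2 =
      ∑ j ∈ Finset.Icc (1 : ℤ) M, φ j ^ 2 := by
    refine Finset.sum_congr rfl fun i hi => ?_
    rw [Finset.mem_Icc] at hi
    rw [if_pos hi.1]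
  rw [h3] at h1
  simp only [Nat.cast_zero, add_zero, Finset.sum_sub_distrib] at hφ
  have : 0 < lam * a := mul_pos hlam ha
  linarith

end Scheme

/-! ### Trace estimates at the right end -/

section Traces

variable {a lam : ℝ} {r p k : ℕ} {c : ℤ → ℝ}

/-- Values of the operator just outside the domain control the values just inside. -/
lemma exists_abs_le_of_stencil (hc : c (-(r : ℤ)) ≠ 0) (s : ℕ) (hs : s ≤ r) :
    ∃ K : ℝ, 0 ≤ K ∧ ∀ (J : ℤ) (w : ℤ → ℝ) (q : ℝ), 0 ≤ q → (∀ j, J + p < j → w j = 0) →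
      (∀ i : ℤ, 1 ≤ i → i ≤ p → |w (J + i)| ≤ q) →
      (∀ i : ℤ, 1 ≤ i → i ≤ r → |stencil r p c w (J + i)| ≤ q) →
      ∀ j, J - s < j → |w j| ≤ K * q := by
  induction s with
  | zero =>
    refine ⟨1, zero_le_one, fun J w q hq h0 h1 _ j hj => ?_⟩
    by_cases hjp : J + p < j
    · rw [h0 j hjp]; simpa using hq
    · have := h1 (j - J) (by push_cast at hj; omega) (by omega)
      rw [add_sub_cancel] at this
      linarith
  | succ s ih =>
    obtain ⟨K, hK, ih⟩ := ih (by omega)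
    set A := ∑ l ∈ Finset.Icc (-(r : ℤ)) (p : ℤ), |c l| with hA
    have hA0 : 0 ≤ A := Finset.sum_nonneg fun _ _ => abs_nonneg _
    have hcpos : 0 < |c (-(r : ℤ))| := abs_pos.2 hc
    refine ⟨K + (1 + A * K) / |c (-(r : ℤ))|, by positivity, fun J w q hq h0 h1 h2 j hj => ?_⟩
    have hprev := ih J w q hq h0 h1 h2
    have hextra : 0 ≤ (1 + A * K) / |c (-(r : ℤ))| * q := by positivity
    by_cases hj' : J - s < j
    · have := hprev j hj'
      rw [add_mul]; linarith
    -- The new index is the leftmost one read from `J + (r - s)`; the equation there is solved for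
    -- it, dividing by `c (-r)`.
    · obtain rfl : j = J - s := by push_cast at hj; omega
      have h3 := h2 (r - s) (by omega) (by omega)
      have hmem : -(r : ℤ) ∈ Finset.Icc (-(r : ℤ)) (p : ℤ) := by
        rw [Finset.mem_Icc]; omega
      rw [stencil, ← Finset.add_sum_erase _ _ hmem] at h3
      have h4 : |∑ l ∈ (Finset.Icc (-(r : ℤ)) (p : ℤ)).erase (-(r : ℤ)),
          c l * w (J + (r - s) + l)| ≤ A * (K * q) := by
        refine (abs_sum_mul_le_of_abs_le (B := K * q) ?_).trans ?_
        · intro l hl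
          rw [Finset.mem_erase, Finset.mem_Icc] at hl
          exact hprev _ (by omega)
        · exact mul_le_mul_of_nonneg_right (Finset.sum_le_sum_of_subset_of_nonneg
            (Finset.erase_subset _ _) fun _ _ _ => abs_nonneg _) (by positivity)
      have h5 : J + ((r : ℤ) - s) + -(r : ℤ) = J - s := by ring
      rw [h5] at h3
      have h6 : |c (-(r : ℤ)) * w (J - s)| ≤ q + A * (K * q) := by
        have := abs_sub_abs_le_abs_sub (c (-(r : ℤ)) * w (J - s))
          (-∑ l ∈ (Finset.Icc (-(r : ℤ)) (p : ℤ)).erase (-(r : ℤ)), c l * w (J + (r - s) + l))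
        rw [sub_neg_eq_add, abs_neg] at this
        linarith
      rw [abs_mul] at h6
      have h7 : |w (J - s)| ≤ (1 + A * K) / |c (-(r : ℤ))| * q := by
        rw [div_mul_eq_mul_div, le_div_iff₀ hcpos]; linarith
      have : 0 ≤ K * q := by positivity
      rw [add_mul]; linarith

lemma sum_sq_le_card_mul {S : Finset ℤ} {f : ℤ → ℝ} {B : ℝ} (h : ∀ i ∈ S, |f i| ≤ B) :
    ∑ i ∈ S, f i ^ 2 ≤ S.card * B ^ 2 := by
  rw [← nsmul_eq_mul]
  exact Finset.sum_le_card_nsmul _ _ _ fun i hi => sq_le_sq' (by linarith [abs_le.1 (h i hi)])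
    (abs_le.1 (h i hi)).2

/-- Trace estimate for the Dirichlet condition at the right end. -/
lemma exists_dirichlet_trace (hc : SchemeAssumption a lam r p k c) :
    ∃ b : ℝ, 0 < b ∧ ∀ (J : ℕ) (v : ℤ → ℝ), (∀ j ≤ 0, v j = 0) →
      ∑ j ∈ Finset.Icc (1 : ℤ) J, stencil r p c v j ^ 2 +
        b * ∑ i ∈ Finset.Icc (1 - (r : ℤ)) p, v (J + i) ^ 2 ≤
      ∑ j ∈ Finset.Icc (1 : ℤ) J, v j ^ 2 + 2 * ∑ i ∈ Finset.Icc (1 : ℤ) p, v (J + i) ^ 2 := by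
  have hcr : c (-(r : ℤ)) ≠ 0 := left_ne_zero_of_mul hc.normalized
  obtain ⟨K, hK, hmain⟩ := exists_abs_le_of_stencil (p := p) hcr r le_rfl
  set n : ℝ := ((Finset.Icc (1 - (r : ℤ)) (p : ℤ)).card : ℝ) with hndef
  have hn : 0 ≤ n := Nat.cast_nonneg _
  refine ⟨1 / (n * K ^ 2 + 1), by positivity, fun J v hv => ?_⟩
  set w : ℤ → ℝ := fun j => if j ≤ (J : ℤ) + p then v j else 0 with hw
  -- `X` is the energy sent past `J` plus that of the ghost values. The contraction pays for the
  -- first part with one copy of the ghost sum, and the second part is another copy: hence the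
  -- factor `2`.
  set X := ∑ i ∈ Finset.Icc (1 : ℤ) r, stencil r p c w (J + i) ^ 2 +
    ∑ i ∈ Finset.Icc (1 : ℤ) p, v (J + i) ^ 2 with hX
  have hX1 : 0 ≤ ∑ i ∈ Finset.Icc (1 : ℤ) r, stencil r p c w (J + i) ^ 2 :=
    Finset.sum_nonneg fun _ _ => sq_nonneg _
  have hX2 : 0 ≤ ∑ i ∈ Finset.Icc (1 : ℤ) p, v (J + i) ^ 2 :=
    Finset.sum_nonneg fun _ _ => sq_nonneg _
  have hX0 : 0 ≤ X := add_nonneg hX1 hX2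
  have hwv : ∀ i : ℤ, i ≤ p → w (J + i) = v (J + i) := fun i hi => if_pos (by omega)
  have hcontr := sum_stencil_sq_le hc (Finset.Icc (1 : ℤ) ((J : ℤ) + r))
    (Finset.Icc (1 : ℤ) ((J : ℤ) + p)) w (by
      intro j hj
      simp only [Finset.mem_Icc, not_and_or, not_le] at hj
      simp only [hw]
      split_ifs with h
      · exact hv j (by omega)
      · rfl)
  rw [sum_Icc_one_add, sum_Icc_one_add] at hcontr
  have e1 : ∑ j ∈ Finset.Icc (1 : ℤ) J, stencil r p c w j ^ 2 =
      ∑ j ∈ Finset.Icc (1 : ℤ) J, stencil r p c v j ^ 2 := by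
    refine Finset.sum_congr rfl fun j hj => ?_
    rw [Finset.mem_Icc] at hj
    rw [stencil_congr fun l _ hl => if_pos (by omega)]
  have e2 : ∑ j ∈ Finset.Icc (1 : ℤ) J, w j ^ 2 = ∑ j ∈ Finset.Icc (1 : ℤ) J, v j ^ 2 := by
    refine Finset.sum_congr rfl fun j hj => ?_
    rw [Finset.mem_Icc] at hj
    simp only [hw]; rw [if_pos (by omega)]
  have e3 : ∑ i ∈ Finset.Icc (1 : ℤ) p, w (J + i) ^ 2 =
      ∑ i ∈ Finset.Icc (1 : ℤ) p, v (J + i) ^ 2 := by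
    refine Finset.sum_congr rfl fun j hj => ?_
    rw [hwv j (Finset.mem_Icc.1 hj).2]
  rw [e1, e2, e3] at hcontr
  have hTr : ∑ i ∈ Finset.Icc (1 - (r : ℤ)) p, v (J + i) ^ 2 ≤ n * K ^ 2 * X := by
    have hb : ∀ i ∈ Finset.Icc (1 - (r : ℤ)) p, |v (J + i)| ≤ K * Real.sqrt X := by
      intro i hi
      rw [Finset.mem_Icc] at hi
      rw [← hwv i hi.2]
      refine hmain J w _ (Real.sqrt_nonneg _) (fun j hj => if_neg (by omega)) ?_ ?_ _ (by omega)
      · intro i h1 h2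
        rw [hwv i h2]
        refine (abs_le_sqrt_sum (fun i => v (J + i)) (Finset.mem_Icc.2 ⟨h1, h2⟩)).trans
          (Real.sqrt_le_sqrt (by linarith))
      · intro i h1 h2
        refine (abs_le_sqrt_sum (fun i => stencil r p c w (J + i))
          (Finset.mem_Icc.2 ⟨h1, h2⟩)).trans (Real.sqrt_le_sqrt (by linarith))
    refine (sum_sq_le_card_mul hb).trans (le_of_eq ?_)
    rw [mul_pow, Real.sq_sqrt hX0]; ring
  have hbX : 1 / (n * K ^ 2 + 1) * ∑ i ∈ Finset.Icc (1 - (r : ℤ)) p, v (J + i) ^ 2 ≤ X := by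
    rw [one_div, inv_mul_le_iff₀ (by positivity)]
    linarith
  linarith

lemma abs_sub_le_of_backDiff {v : ℤ → ℝ} {r p : ℕ} {J : ℤ} {G : ℝ}
    (h : ∀ i : ℤ, 2 - (r : ℤ) ≤ i → i ≤ p → |backDiff v (J + i)| ≤ G) (hG : 0 ≤ G) (hr : 1 ≤ r)
    {i : ℤ} (hi : 1 - (r : ℤ) ≤ i) (hip : i ≤ p) : |v (J + i) - v J| ≤ (r + p) * G := by
  have hup : ∀ s : ℕ, s ≤ p → |v (J + s) - v J| ≤ s * G := by
    intro s
    induction s with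
    | zero => simp
    | succ s ih =>
      intro hs
      have h1 := h (s + 1) (by omega) (by omega)
      have h2 := ih (by omega)
      have e : v (J + (s + 1 : ℕ)) - v J = backDiff v (J + (s + 1)) + (v (J + s) - v J) := by
        rw [backDiff, show J + ((s : ℤ) + 1) - 1 = J + s by ring]; push_cast; ring
      rw [e]
      refine (abs_add_le _ _).trans ?_
      push_cast; linarith
  have hdown : ∀ s : ℕ, s + 1 ≤ r → |v (J - s) - v J| ≤ s * G := by
    intro s
    induction s with
    | zero => simp
    | succ s ih =>
      intro hs
      have h1 := h (-s) (by omega) (by omega)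
      have h2 := ih (by omega)
      have e : v (J - (s + 1 : ℕ)) - v J = -backDiff v (J + -s) + (v (J - s) - v J) := by
        rw [backDiff, show J + -(s : ℤ) - 1 = J - (s + 1 : ℕ) by push_cast; ring,
          ← sub_eq_add_neg]; ring
      rw [e]
      refine (abs_add_le _ _).trans ?_
      rw [abs_neg]
      push_cast; linarith
  have hrG : 0 ≤ (r : ℝ) * G := by positivity
  have hpG : 0 ≤ (p : ℝ) * G := by positivity
  rcases le_total 0 i with h0 | h0
  · lift i to ℕ using h0
    have hip' : (i : ℝ) ≤ p := by exact_mod_cast hip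
    have := hup i (by omega)
    have := mul_le_mul_of_nonneg_right hip' hG
    linarith
  · obtain ⟨s, rfl⟩ : ∃ s : ℕ, i = -s := ⟨i.natAbs, by omega⟩
    have hs : s + 1 ≤ r := by omega
    have hs' : (s : ℝ) ≤ r := by exact_mod_cast (by omega : s ≤ r)
    have := hdown s hs
    have := mul_le_mul_of_nonneg_right hs' hG
    rw [← sub_eq_add_neg]
    linarith

/-- Trace estimate for an outgoing wave: the boundary values are controlled by their differences. -/
lemma exists_outflow_trace (ha : 0 < a) (hlam : 0 < lam) (hk : 1 ≤ k)
    (hc : SchemeAssumption a lam r p k c) :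
    ∃ b C : ℝ, 0 < b ∧ 0 ≤ C ∧ ∀ (J : ℕ) (v : ℤ → ℝ), (∀ j ≤ 0, v j = 0) →
      ∑ j ∈ Finset.Icc (1 : ℤ) J, stencil r p c v j ^ 2 +
        b * ∑ i ∈ Finset.Icc (1 - (r : ℤ)) p, v (J + i) ^ 2 ≤
      ∑ j ∈ Finset.Icc (1 : ℤ) J, v j ^ 2 +
        C * ∑ i ∈ Finset.Icc (2 - (r : ℤ)) p, backDiff v (J + i) ^ 2 := by
  have hr := one_le_left_width ha hlam hk hc
  obtain ⟨φ, M, hpM, hφ1, hφ0, hφa, hφ⟩ := exists_tail ha hlam hk hc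
  set μ := lam * a with hμdef
  have hμ : 0 < μ := mul_pos hlam ha
  set A := ∑ l ∈ Finset.Icc (-(r : ℤ)) (p : ℤ), |c l| with hA
  have hA0 : 0 ≤ A := Finset.sum_nonneg fun _ _ => abs_nonneg _
  set R : ℝ := r + p with hR
  have hR1 : 1 ≤ R := by
    have : (1 : ℝ) ≤ r := by exact_mod_cast hr
    have : (0 : ℝ) ≤ p := Nat.cast_nonneg _
    linarith
  set N : ℝ := ((M + r : ℕ) : ℝ) with hN
  have hN0 : 0 ≤ N := Nat.cast_nonneg _
  set Q : ℝ := N * (1 + A ^ 2) with hQ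
  have hQ0 : 0 ≤ Q := by positivity
  -- The tail gains `μ / 2 * v J ^ 2`; Young's inequality uses half of it, and this `b` lets the
  -- window sum use the other half.
  set b : ℝ := μ / (8 * R) with hb
  have hb0 : 0 < b := by positivity
  -- the constants come from Young's inequality `2 Q |v_J| G ≤ (μ / 4) v_J ^ 2 + (4 Q ^ 2 / μ) G ^ 2`
  refine ⟨b, (4 * Q ^ 2 / μ + N + 2 * b * R) * R ^ 2, hb0, by positivity, fun J v hv => ?_⟩
  set D := ∑ i ∈ Finset.Icc (2 - (r : ℤ)) p, backDiff v (J + i) ^ 2 with hD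
  have hD0 : 0 ≤ D := Finset.sum_nonneg fun _ _ => sq_nonneg _
  set G := R * Real.sqrt D with hG
  have hG0 : 0 ≤ G := by positivity
  have hGsq : G ^ 2 = R ^ 2 * D := by rw [hG, mul_pow, Real.sq_sqrt hD0]
  have hwin : ∀ i : ℤ, 1 - (r : ℤ) ≤ i → i ≤ p → |v (J + i) - v J| ≤ G := fun i h1 h2 =>
    abs_sub_le_of_backDiff (fun i h1 h2 => abs_le_sqrt_sum (fun i => backDiff v (J + i))
      (Finset.mem_Icc.2 ⟨h1, h2⟩)) (Real.sqrt_nonneg _) hr h1 h2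
  -- `w` continues `v` by the ramp of height `v J`, and `d` is its deviation from the pure ramp:
  -- zero past the ghost cells and of the size of the differences on the window.
  set w : ℤ → ℝ := fun j => if j ≤ (J : ℤ) + p then v j else v J * φ (j - J) with hw
  set d : ℤ → ℝ := fun i => w (J + i) - v J * φ i with hd
  have hdG : ∀ i : ℤ, 1 - (r : ℤ) ≤ i → |d i| ≤ G := by
    intro i hi
    simp only [hd, hw]
    split_ifs with h
    · rw [hφ1 i (by omega), mul_one]
      exact hwin i hi (by omega)
    · rw [add_sub_cancel_left, sub_self, abs_zero]; exact hG0
  have hcontr := sum_stencil_sq_le hc (Finset.Icc (1 : ℤ) ((J : ℤ) + (M + r : ℕ)))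
    (Finset.Icc (1 : ℤ) ((J : ℤ) + (M + r : ℕ))) w (by
      intro j hj
      simp only [Finset.mem_Icc, not_and_or, not_le] at hj
      simp only [hw]
      split_ifs with h
      · exact hv j (by omega)
      · rw [hφ0 _ (by omega), mul_zero])
  rw [sum_Icc_one_add, sum_Icc_one_add] at hcontr
  have e1 : ∑ j ∈ Finset.Icc (1 : ℤ) J, stencil r p c w j ^ 2 =
      ∑ j ∈ Finset.Icc (1 : ℤ) J, stencil r p c v j ^ 2 := by
    refine Finset.sum_congr rfl fun j hj => ?_
    rw [Finset.mem_Icc] at hj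
    rw [stencil_congr fun l _ hl => if_pos (by omega)]
  have e2 : ∑ j ∈ Finset.Icc (1 : ℤ) J, w j ^ 2 = ∑ j ∈ Finset.Icc (1 : ℤ) J, v j ^ 2 := by
    refine Finset.sum_congr rfl fun j hj => ?_
    rw [Finset.mem_Icc] at hj
    simp only [hw]; rw [if_pos (by omega)]
  rw [e1, e2] at hcontr
  have hst : ∀ i, stencil r p c w (J + i) = v J * stencil r p c φ i + stencil r p c d i := by
    intro i
    simp only [stencil, Finset.mul_sum, ← Finset.sum_add_distrib, hd, ← add_assoc]
    exact Finset.sum_congr rfl fun l _ => by ring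
  have htail : ∑ i ∈ Finset.Icc (1 : ℤ) (M + r : ℕ), w (J + i) ^ 2 -
      ∑ i ∈ Finset.Icc (1 : ℤ) (M + r : ℕ), stencil r p c w (J + i) ^ 2 ≤
      -(μ / 2) * v J ^ 2 + N * (2 * |v J| * (1 + A ^ 2) * G + G ^ 2) := by
    rw [← Finset.sum_sub_distrib]
    have hterm : ∀ i ∈ Finset.Icc (1 : ℤ) (M + r : ℕ),
        w (J + i) ^ 2 - stencil r p c w (J + i) ^ 2 ≤
        v J ^ 2 * (φ i ^ 2 - stencil r p c φ i ^ 2) +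
          (2 * |v J| * (1 + A ^ 2) * G + G ^ 2) := by
      intro i hi
      rw [Finset.mem_Icc] at hi
      have hwi : w (J + i) = v J * φ i + d i := by simp only [hd]; ring
      rw [hst, hwi]
      set x := stencil r p c φ i
      set y := stencil r p c d i
      have hx : |x| ≤ A := by
        have := abs_stencil_le (c := c) (r := r) (p := p) (v := φ) (j := i) (B := 1)
          (fun l _ => hφa _)
        simpa using this
      have hy : |y| ≤ A * G := abs_stencil_le fun l hl => hdG _ (by
        rw [Finset.mem_Icc] at hl; omega)
      have hdi := hdG i (by omega)
      have h1 : v J * (φ i * d i) ≤ |v J| * G := by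
        refine (le_abs_self _).trans ?_
        rw [abs_mul, abs_mul]
        refine mul_le_mul_of_nonneg_left ?_ (abs_nonneg _)
        calc |φ i| * |d i| ≤ 1 * G := mul_le_mul (hφa i) hdi (abs_nonneg _) zero_le_one
          _ = G := one_mul G
      have h2 : -(v J * (x * y)) ≤ |v J| * (A ^ 2 * G) := by
        refine (neg_le_abs _).trans ?_
        rw [abs_mul, abs_mul]
        refine mul_le_mul_of_nonneg_left ?_ (abs_nonneg _)
        calc |x| * |y| ≤ A * (A * G) := mul_le_mul hx hy (abs_nonneg _) hA0
          _ = A ^ 2 * G := by ring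
      have h3 : d i ^ 2 ≤ G ^ 2 := sq_le_sq' (by linarith [abs_le.1 hdi]) (abs_le.1 hdi).2
      have h4 : 0 ≤ y ^ 2 := sq_nonneg y
      have e : (v J * φ i + d i) ^ 2 - (v J * x + y) ^ 2 = v J ^ 2 * (φ i ^ 2 - x ^ 2) +
          2 * (v J * (φ i * d i)) + 2 * -(v J * (x * y)) + d i ^ 2 - y ^ 2 := by ring
      rw [e]
      linarith
    refine (Finset.sum_le_sum hterm).trans ?_
    rw [Finset.sum_add_distrib, ← Finset.mul_sum, Finset.sum_const, nsmul_eq_mul, Int.card_Icc]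
    have hcard : ((((M + r : ℕ) : ℤ) + 1 - 1).toNat : ℝ) = N := by
      rw [add_sub_cancel_right, Int.toNat_natCast]
    rw [hcard]
    have hφ' := mul_le_mul_of_nonneg_left hφ (sq_nonneg (v J))
    push_cast
    linarith
  have hyoung : N * (2 * |v J| * (1 + A ^ 2) * G) ≤ μ / 4 * v J ^ 2 + 4 * Q ^ 2 / μ * G ^ 2 := by
    have h := sq_nonneg (μ * |v J| / 2 - 2 * Q * G)
    have e : μ / 4 * v J ^ 2 + 4 * Q ^ 2 / μ * G ^ 2 - N * (2 * |v J| * (1 + A ^ 2) * G) =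
        (μ * |v J| / 2 - 2 * Q * G) ^ 2 / μ := by
      rw [← sq_abs (v J), hQ]; field_simp; ring
    have := div_nonneg h hμ.le
    linarith
  have hwindow : ∑ i ∈ Finset.Icc (1 - (r : ℤ)) p, v (J + i) ^ 2 ≤
      R * (2 * v J ^ 2 + 2 * G ^ 2) := by
    have hterm : ∀ i ∈ Finset.Icc (1 - (r : ℤ)) p, v (J + i) ^ 2 ≤ 2 * v J ^ 2 + 2 * G ^ 2 := by
      intro i hi
      rw [Finset.mem_Icc] at hi
      have h1 := abs_le.1 (hwin i hi.1 hi.2)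
      have h2 : (v (J + i) - v J) ^ 2 ≤ G ^ 2 := sq_le_sq' h1.1 h1.2
      have h3 := add_sq_le (a := v J) (b := v (J + i) - v J)
      rw [add_sub_cancel] at h3
      linarith
    refine (Finset.sum_le_card_nsmul _ _ _ hterm).trans (le_of_eq ?_)
    rw [nsmul_eq_mul, Int.card_Icc]
    congr 1
    have : ((p : ℤ) + 1 - (1 - (r : ℤ))).toNat = r + p := by omega
    rw [this, hR]; push_cast; rfl
  have hbw : b * ∑ i ∈ Finset.Icc (1 - (r : ℤ)) p, v (J + i) ^ 2 ≤
      μ / 4 * v J ^ 2 + 2 * b * R * G ^ 2 := by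
    refine (mul_le_mul_of_nonneg_left hwindow hb0.le).trans (le_of_eq ?_)
    rw [hb]; field_simp; ring
  have hfin : (4 * Q ^ 2 / μ + N + 2 * b * R) * R ^ 2 * D =
      4 * Q ^ 2 / μ * G ^ 2 + N * G ^ 2 + 2 * b * R * G ^ 2 := by rw [hGsq]; ring
  rw [hfin]
  linarith

end Traces

/-! ### Iterated differences and extrapolated ghost values -/

section BackDiff

lemma backDiff_iterate_eq_zero {v : ℤ → ℝ} (m : ℕ) (hv : ∀ j ≤ 0, v j = 0) :
    ∀ j ≤ 0, backDiff^[m] v j = 0 := by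
  induction m generalizing v with
  | zero => exact hv
  | succ m ih =>
    refine ih fun j hj => ?_
    rw [backDiff, hv j hj, hv (j - 1) (by omega), sub_zero]

lemma backDiff_iterate_congr {v w : ℤ → ℝ} (m : ℕ) {j : ℤ}
    (h : ∀ i, j - m ≤ i → i ≤ j → v i = w i) : backDiff^[m] v j = backDiff^[m] w j := by
  induction m generalizing v w with
  | zero => exact h j (by simp) le_rfl
  | succ m ih =>
    refine ih fun i hi hij => ?_
    rw [backDiff, backDiff, h i (by push_cast; omega) hij,
      h (i - 1) (by push_cast; omega) (by omega)]

lemma backDiff_iterate_add (v w : ℤ → ℝ) (m : ℕ) :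
    backDiff^[m] (fun j => v j + w j) = fun j => backDiff^[m] v j + backDiff^[m] w j := by
  induction m generalizing v w with
  | zero => rfl
  | succ m ih =>
    rw [Function.iterate_succ_apply, Function.iterate_succ_apply, Function.iterate_succ_apply,
      ← ih]
    congr 1; funext j; simp only [backDiff]; ring

lemma backDiff_iterate_sub (v w : ℤ → ℝ) (m : ℕ) :
    backDiff^[m] (fun j => v j - w j) = fun j => backDiff^[m] v j - backDiff^[m] w j := by
  induction m generalizing v w with
  | zero => rfl
  | succ m ih =>
    rw [Function.iterate_succ_apply, Function.iterate_succ_apply, Function.iterate_succ_apply,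
      ← ih]
    congr 1; funext j; simp only [backDiff]; ring

lemma stencil_backDiff_iterate (r p : ℕ) (c v : ℤ → ℝ) (m : ℕ) :
    stencil r p c (backDiff^[m] v) = backDiff^[m] (stencil r p c v) := by
  induction m generalizing v with
  | zero => rfl
  | succ m ih =>
    rw [Function.iterate_succ_apply, Function.iterate_succ_apply, ih]
    congr 1
    funext j
    simp only [stencil, backDiff, ← Finset.sum_sub_distrib]
    refine Finset.sum_congr rfl fun l _ => ?_
    rw [show j - 1 + l = j + l - 1 by ring]; ring

lemma sum_shift_sq_le {w : ℤ → ℝ} (hw : ∀ j ≤ 0, w j = 0) (J p : ℕ) {l : ℤ} (hl : l ≤ p) :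
    ∑ j ∈ Finset.Icc (1 : ℤ) J, w (j + l) ^ 2 ≤
      ∑ j ∈ Finset.Icc (1 : ℤ) ((J : ℤ) + p), w j ^ 2 := by
  have h1 : ∑ j ∈ Finset.Icc (1 : ℤ) J, w (j + l) ^ 2 =
      ∑ j ∈ (Finset.Icc (1 : ℤ) J).map (addRightEmbedding l), w j ^ 2 := by
    rw [Finset.sum_map]; rfl
  classical
  rw [h1, ← Finset.sum_filter_ne_zero]
  refine Finset.sum_le_sum_of_subset_of_nonneg (fun j hj => ?_) fun _ _ _ => sq_nonneg _
  obtain ⟨hj, hne⟩ := Finset.mem_filter.1 hj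
  obtain ⟨i, hi, rfl⟩ := Finset.mem_map.1 hj
  rw [Finset.mem_Icc] at hi ⊢
  simp only [addRightEmbedding_apply] at hne ⊢
  refine ⟨?_, by omega⟩
  by_contra h
  exact hne (by rw [hw _ (by omega)]; simp)

lemma sum_backDiff_iterate_sq_le {v : ℤ → ℝ} (hv : ∀ j ≤ 0, v j = 0) (N m : ℕ) :
    ∑ j ∈ Finset.Icc (1 : ℤ) N, backDiff^[m] v j ^ 2 ≤
      4 ^ m * ∑ j ∈ Finset.Icc (1 : ℤ) N, v j ^ 2 := by
  induction m generalizing v with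
  | zero => simp
  | succ m ih =>
    refine (ih (v := backDiff v) (backDiff_iterate_eq_zero 1 hv)).trans ?_
    rw [pow_succ, mul_assoc]
    refine mul_le_mul_of_nonneg_left ?_ (by positivity)
    have h1 := sum_shift_sq_le hv N 0 (l := -1) (by simp)
    have h2 : ∀ j ∈ Finset.Icc (1 : ℤ) N, backDiff v j ^ 2 ≤ 2 * v j ^ 2 + 2 * v (j + -1) ^ 2 := by
      intro j _
      have := add_sq_le (a := v j) (b := -v (j - 1))
      rw [neg_sq, ← sub_eq_add_neg] at this
      rw [backDiff, ← sub_eq_add_neg]; linarith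
    refine (Finset.sum_le_sum h2).trans ?_
    rw [Finset.sum_add_distrib, ← Finset.mul_sum, ← Finset.mul_sum]
    simp only [Nat.cast_zero, add_zero] at h1
    linarith

/-- `v j` enters `D₋^m v` at `j` with coefficient `1`, so it is recovered from that difference and
from values further left. -/
lemma exists_abs_le_of_backDiff_iterate (m : ℕ) :
    ∃ K : ℝ, 0 ≤ K ∧ ∀ (v : ℤ → ℝ) (j : ℤ) (B : ℝ), (∀ i < j, |v i| ≤ B) →
      |v j| ≤ |backDiff^[m] v j| + K * B := by
  induction m with
  | zero => exact ⟨0, le_rfl, fun v j B _ => by simp⟩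
  | succ m ih =>
    obtain ⟨K, hK, ih⟩ := ih
    refine ⟨2 * K + 1, by positivity, fun v j B hB => ?_⟩
    have h1 := ih (backDiff v) j (2 * B) fun i hi => by
      have := abs_sub (v i) (v (i - 1))
      rw [backDiff]
      linarith [hB i hi, hB (i - 1) (by omega)]
    have h2 : |v j| ≤ |backDiff v j| + |v (j - 1)| := by
      have := abs_add_le (backDiff v j) (v (j - 1))
      rwa [show backDiff v j + v (j - 1) = v j by rw [backDiff]; ring] at this
    rw [Function.iterate_succ_apply]
    linarith [hB (j - 1) (by omega)]

/-- The extrapolated ghost values are controlled by the interior values. -/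
lemma exists_ghost_bound (kb p : ℕ) :
    ∃ C : ℝ, 0 ≤ C ∧ ∀ (J : ℕ) (v : ℤ → ℝ) (γ : ℝ), (∀ j ≤ 0, v j = 0) →
      (∀ l : ℤ, 1 ≤ l → l ≤ p → |backDiff^[kb] v (J + l)| ≤ γ) → 0 ≤ γ →
      ∑ j ∈ Finset.Icc (1 : ℤ) ((J : ℤ) + p), v j ^ 2 ≤
        C * (∑ j ∈ Finset.Icc (1 : ℤ) J, v j ^ 2 + γ ^ 2) := by
  obtain ⟨K, hK, hrec⟩ := exists_abs_le_of_backDiff_iterate kb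
  -- Each induction step adds one ghost cell, estimated from the cells to its left.
  have hind : ∀ s : ℕ, s ≤ p → ∃ M : ℝ, 0 ≤ M ∧ ∀ (J : ℕ) (v : ℤ → ℝ) (γ : ℝ),
      (∀ j ≤ 0, v j = 0) → (∀ l : ℤ, 1 ≤ l → l ≤ p → |backDiff^[kb] v (J + l)| ≤ γ) → 0 ≤ γ →
      ∀ j ≤ (J : ℤ) + s, |v j| ≤ M * (Real.sqrt (∑ j ∈ Finset.Icc (1 : ℤ) J, v j ^ 2) + γ) := by
    intro s
    induction s with
    | zero =>
      refine fun _ => ⟨1, zero_le_one, fun J v γ hv _ hγ j hj => ?_⟩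
      by_cases h : j ≤ 0
      · rw [hv j h, abs_zero]; positivity
      · have := abs_le_sqrt_sum v (S := Finset.Icc (1 : ℤ) J) (i := j)
          (Finset.mem_Icc.2 ⟨by omega, by simpa using hj⟩)
        linarith
    | succ s ih =>
      intro hs
      obtain ⟨M, hM, ih⟩ := ih (by omega)
      refine ⟨M + (1 + K * M), by positivity, fun J v γ hv hg hγ j hj => ?_⟩
      set B := Real.sqrt (∑ j ∈ Finset.Icc (1 : ℤ) J, v j ^ 2) + γ with hB
      have hsq := Real.sqrt_nonneg (∑ j ∈ Finset.Icc (1 : ℤ) J, v j ^ 2)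
      have hB0 : 0 ≤ B := by positivity
      have hprev := ih J v γ hv hg hγ
      by_cases h : j ≤ (J : ℤ) + s
      · have := hprev j h
        have : 0 ≤ (1 + K * M) * B := by positivity
        rw [add_mul]; linarith
      · obtain rfl : j = (J : ℤ) + (s + 1 : ℕ) := by push_cast at *; omega
        have h1 := hrec v ((J : ℤ) + (s + 1 : ℕ)) (M * B)
          fun i hi => hprev i (by push_cast at hi; omega)
        have h2 := hg (s + 1 : ℕ) (by omega) (by omega)
        have h3 : 0 ≤ M * B := by positivity
        rw [add_mul, add_mul]; linarith
  obtain ⟨M, hM, hmain⟩ := hind p le_rfl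
  refine ⟨1 + 2 * p * M ^ 2, by positivity, fun J v γ hv hg hγ => ?_⟩
  set V := ∑ j ∈ Finset.Icc (1 : ℤ) J, v j ^ 2 with hV
  have hV0 : 0 ≤ V := Finset.sum_nonneg fun _ _ => sq_nonneg _
  rw [sum_Icc_one_add]
  have h1 : ∑ i ∈ Finset.Icc (1 : ℤ) p, v (J + i) ^ 2 ≤ p * (M * (Real.sqrt V + γ)) ^ 2 := by
    refine (sum_sq_le_card_mul (B := M * (Real.sqrt V + γ)) fun i hi =>
      hmain J v γ hv hg hγ _ ?_).trans (le_of_eq ?_)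
    · rw [Finset.mem_Icc] at hi; omega
    · rw [Int.card_Icc, add_sub_cancel_right, Int.toNat_natCast]
  have h2 : (Real.sqrt V + γ) ^ 2 ≤ 2 * (V + γ ^ 2) := by
    refine add_sq_le.trans (le_of_eq ?_)
    rw [Real.sq_sqrt hV0]
  have h3 : p * (M * (Real.sqrt V + γ)) ^ 2 ≤ 2 * p * M ^ 2 * (V + γ ^ 2) := by
    calc p * (M * (Real.sqrt V + γ)) ^ 2 = p * M ^ 2 * (Real.sqrt V + γ) ^ 2 := by ring
      _ ≤ p * M ^ 2 * (2 * (V + γ ^ 2)) := by gcongr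
      _ = _ := by ring
  have : 0 ≤ γ ^ 2 := sq_nonneg γ
  linarith

end BackDiff

/-! ### Commutators with slowly varying weights -/

section Weights

variable (r p : ℕ) (c : ℤ → ℝ)

/-- The weight `1 + |l|` dominates both `1` and `|l|`, so that one estimate serves the operator and
its commutator with a Lipschitz weight. -/
lemma exists_sum_sq_stencil_le :
    ∃ C : ℝ, 0 ≤ C ∧ ∀ (J : ℕ) (w : ℤ → ℝ), (∀ j ≤ 0, w j = 0) →
      ∑ j ∈ Finset.Icc (1 : ℤ) J,
        (∑ l ∈ Finset.Icc (-(r : ℤ)) (p : ℤ), (|c l| * (1 + |(l : ℝ)|)) * |w (j + l)|) ^ 2 ≤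
      C * ∑ j ∈ Finset.Icc (1 : ℤ) ((J : ℤ) + p), w j ^ 2 := by
  set K := Finset.Icc (-(r : ℤ)) (p : ℤ) with hK
  set B := ∑ l ∈ K, (|c l| * (1 + |(l : ℝ)|)) ^ 2 with hB
  have hB0 : 0 ≤ B := Finset.sum_nonneg fun _ _ => sq_nonneg _
  refine ⟨B * K.card, by positivity, fun J w hw => ?_⟩
  have h1 : ∀ j ∈ Finset.Icc (1 : ℤ) J,
      (∑ l ∈ K, (|c l| * (1 + |(l : ℝ)|)) * |w (j + l)|) ^ 2 ≤ B * ∑ l ∈ K, w (j + l) ^ 2 := by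
    intro j _
    refine (Finset.sum_mul_sq_le_sq_mul_sq _ _ _).trans (le_of_eq ?_)
    simp only [sq_abs]; rfl
  refine (Finset.sum_le_sum h1).trans ?_
  rw [← Finset.mul_sum, Finset.sum_comm, mul_assoc]
  refine mul_le_mul_of_nonneg_left ?_ hB0
  rw [← nsmul_eq_mul]
  refine Finset.sum_le_card_nsmul _ _ _ fun l hl => sum_shift_sq_le hw J p ?_
  rw [hK, Finset.mem_Icc] at hl; exact hl.2

lemma exists_stencil_sq_le :
    ∃ C : ℝ, 0 ≤ C ∧ ∀ (J : ℕ) (w : ℤ → ℝ), (∀ j ≤ 0, w j = 0) →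
      ∑ j ∈ Finset.Icc (1 : ℤ) J, stencil r p c w j ^ 2 ≤
      C * ∑ j ∈ Finset.Icc (1 : ℤ) ((J : ℤ) + p), w j ^ 2 := by
  obtain ⟨C, hC, h⟩ := exists_sum_sq_stencil_le r p c
  refine ⟨C, hC, fun J w hw => le_trans (Finset.sum_le_sum fun j _ => ?_) (h J w hw)⟩
  rw [← sq_abs]
  refine pow_le_pow_left₀ (abs_nonneg _) ?_ 2
  refine (Finset.abs_sum_le_sum_abs _ _).trans (Finset.sum_le_sum fun l _ => ?_)
  rw [abs_mul]
  refine mul_le_mul_of_nonneg_right ?_ (abs_nonneg _)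
  exact le_mul_of_one_le_right (abs_nonneg _) (by linarith [abs_nonneg (l : ℝ)])

/-- Commutator of the operator with a Lipschitz weight. -/
lemma exists_weighted_stencil_sq_le :
    ∃ C : ℝ, 0 ≤ C ∧ ∀ (J : ℕ) (w η : ℤ → ℝ) (Λ : ℝ), (∀ j ≤ 0, w j = 0) → 0 ≤ Λ →
      (∀ j, |η j| ≤ 1) → (∀ j l, |η (j + l) - η j| ≤ Λ * |(l : ℝ)|) →
      ∑ j ∈ Finset.Icc (1 : ℤ) J, (η j * stencil r p c w j) ^ 2 ≤
      ∑ j ∈ Finset.Icc (1 : ℤ) J, stencil r p c (fun i => η i * w i) j ^ 2 +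
      C * Λ * ∑ j ∈ Finset.Icc (1 : ℤ) ((J : ℤ) + p), w j ^ 2 := by
  obtain ⟨C, hC, h⟩ := exists_sum_sq_stencil_le r p c
  refine ⟨2 * C, by positivity, fun J w η Λ hw hΛ hη hlip => ?_⟩
  set K := Finset.Icc (-(r : ℤ)) (p : ℤ) with hK
  have hterm : ∀ j ∈ Finset.Icc (1 : ℤ) J, (η j * stencil r p c w j) ^ 2 ≤
      stencil r p c (fun i => η i * w i) j ^ 2 +
      2 * Λ * (∑ l ∈ K, (|c l| * (1 + |(l : ℝ)|)) * |w (j + l)|) ^ 2 := by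
    intro j _
    set Z := ∑ l ∈ K, (|c l| * (1 + |(l : ℝ)|)) * |w (j + l)| with hZ
    have hZ0 : 0 ≤ Z := Finset.sum_nonneg fun _ _ => by positivity
    set x := η j * stencil r p c w j with hx
    set y := stencil r p c (fun i => η i * w i) j with hy
    have hfac : ∀ l : ℤ, |c l| * |w (j + l)| ≤ |c l| * (1 + |(l : ℝ)|) * |w (j + l)| := fun l =>
      mul_le_mul_of_nonneg_right (le_mul_of_one_le_right (abs_nonneg _)
        (by linarith [abs_nonneg (l : ℝ)])) (abs_nonneg _)
    have hxy : |x - y| ≤ Λ * Z := by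
      have e : x - y = ∑ l ∈ K, c l * ((η j - η (j + l)) * w (j + l)) := by
        rw [hx, hy, stencil, stencil, Finset.mul_sum, ← Finset.sum_sub_distrib]
        exact Finset.sum_congr rfl fun l _ => by ring
      rw [e, hZ, Finset.mul_sum]
      refine (Finset.abs_sum_le_sum_abs _ _).trans (Finset.sum_le_sum fun l _ => ?_)
      rw [abs_mul, abs_mul, abs_sub_comm]
      calc |c l| * (|η (j + l) - η j| * |w (j + l)|)
          ≤ |c l| * ((Λ * |(l : ℝ)|) * |w (j + l)|) := by gcongr; exact hlip j l
        _ ≤ |c l| * ((Λ * (1 + |(l : ℝ)|)) * |w (j + l)|) := by gcongr; linarith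
        _ = _ := by ring
    have hxZ : |x| ≤ Z := by
      rw [hx, abs_mul]
      refine (mul_le_of_le_one_left (abs_nonneg _) (hη j)).trans ?_
      refine (Finset.abs_sum_le_sum_abs _ _).trans (Finset.sum_le_sum fun l _ => ?_)
      rw [abs_mul]
      exact hfac l
    have hyZ : |y| ≤ Z := by
      refine (Finset.abs_sum_le_sum_abs _ _).trans (Finset.sum_le_sum fun l _ => ?_)
      rw [abs_mul, abs_mul]
      refine le_trans ?_ (hfac l)
      exact mul_le_mul_of_nonneg_left (mul_le_of_le_one_left (abs_nonneg _) (hη _)) (abs_nonneg _)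
    -- Factoring `x ^ 2 - y ^ 2` makes the commutator cost linear in `Λ` and leaves the factor `1`
    -- in front of `y ^ 2`.
    have h1 : (x - y) * (x + y) ≤ (Λ * Z) * (2 * Z) := by
      refine (le_abs_self _).trans ?_
      rw [abs_mul]
      exact mul_le_mul hxy ((abs_add_le x y).trans (by linarith)) (abs_nonneg _) (by positivity)
    nlinarith
  refine (Finset.sum_le_sum hterm).trans ?_
  rw [Finset.sum_add_distrib, ← Finset.mul_sum]
  have := mul_le_mul_of_nonneg_left (h J w hw) (by positivity : 0 ≤ 2 * Λ)
  linarith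

end Weights

/-! ### Perturbed solutions, energies and the cutoff -/

/-- A solution of the scheme with homogeneous left boundary values up to a source of `ℓ²` size `ε`
at each time step and a right boundary error of size `γ`. -/
structure IsPerturbedSolution (r p kb : ℕ) (c : ℤ → ℝ) (J : ℕ) (ε γ : ℝ) (e : ℕ → ℤ → ℝ) :
    Prop where
  dirichlet : ∀ n, ∀ j ≤ 0, e n j = 0
  outflow : ∀ n, ∀ l : ℤ, 1 ≤ l → l ≤ p → |backDiff^[kb] (e n) (J + l)| ≤ γ
  interior : ∀ n, ∑ j ∈ Finset.Icc (1 : ℤ) J, (e (n + 1) j - stencil r p c (e n) j) ^ 2 ≤ ε ^ 2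

/-- The squared `ℓ²` norm over the cells `1, …, J`. -/
def energy (J : ℕ) (v : ℤ → ℝ) : ℝ := ∑ j ∈ Finset.Icc (1 : ℤ) J, v j ^ 2

lemma energy_nonneg (J : ℕ) (v : ℤ → ℝ) : 0 ≤ energy J v :=
  Finset.sum_nonneg fun _ _ => sq_nonneg _

/-- The sum of the squares of the values that the scheme uses around the right end. -/
def boundaryTrace (r p J : ℕ) (v : ℤ → ℝ) : ℝ :=
  ∑ i ∈ Finset.Icc (1 - (r : ℤ)) p, v (J + i) ^ 2

lemma boundaryTrace_nonneg (r p J : ℕ) (v : ℤ → ℝ) : 0 ≤ boundaryTrace r p J v :=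
  Finset.sum_nonneg fun _ _ => sq_nonneg _

/-- A cutoff that vanishes near the left end and equals `1` near the right end. -/
def cutoff (kb J : ℕ) (j : ℤ) : ℝ := max 0 (min 1 (2 * ((j : ℝ) - kb) / J))

lemma abs_cutoff_le_one (kb J : ℕ) (j : ℤ) : |cutoff kb J j| ≤ 1 := by
  rw [abs_of_nonneg (le_max_left _ _)]
  exact max_le zero_le_one (min_le_left _ _)

lemma cutoff_eq_zero {kb J : ℕ} {j : ℤ} (hj : j ≤ kb) : cutoff kb J j = 0 := by
  have hj' : (j : ℝ) ≤ kb := by exact_mod_cast hj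
  have : 2 * ((j : ℝ) - kb) / J ≤ 0 := div_nonpos_of_nonpos_of_nonneg (by linarith) (by positivity)
  rw [cutoff, max_eq_left ((min_le_right _ _).trans this)]

lemma cutoff_eq_one {kb J : ℕ} {j : ℤ} (hJ : 0 < J) (hj : (J : ℤ) ≤ 2 * (j - kb)) :
    cutoff kb J j = 1 := by
  have hJ' : (0 : ℝ) < J := by exact_mod_cast hJ
  have hj' : (J : ℝ) ≤ 2 * ((j : ℝ) - kb) := by exact_mod_cast hj
  have : 1 ≤ 2 * ((j : ℝ) - kb) / J := by rwa [le_div_iff₀ hJ', one_mul]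
  rw [cutoff, min_eq_left this]; simp

lemma abs_cutoff_sub_le (kb J : ℕ) (j l : ℤ) :
    |cutoff kb J (j + l) - cutoff kb J j| ≤ 2 / J * |(l : ℝ)| := by
  refine (abs_clamp_sub_le _ _).trans (le_of_eq ?_)
  rw [← sub_div, abs_div, Nat.abs_cast, div_mul_eq_mul_div]
  congr 1
  rw [show (2 : ℝ) * (((j + l : ℤ) : ℝ) - kb) - 2 * ((j : ℝ) - kb) = 2 * l by push_cast; ring,
    abs_mul, abs_two]

/-- Young's inequality, with `1 + 1 / τ` enlarged to `2 / τ` by `τ ≤ 1`. -/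
lemma add_sq_le_of_pos {τ : ℝ} (hτ : 0 < τ) (hτ1 : τ ≤ 1) (x y : ℝ) :
    (x + y) ^ 2 ≤ (1 + τ) * x ^ 2 + 2 / τ * y ^ 2 := by
  have h1 : 0 ≤ (τ * x - y) ^ 2 / τ := by positivity
  have h2 : (τ * x - y) ^ 2 / τ = τ * x ^ 2 - 2 * x * y + 1 / τ * y ^ 2 := by
    field_simp; ring
  have h3 : y ^ 2 ≤ 1 / τ * y ^ 2 := le_mul_of_one_le_left (sq_nonneg _) ((one_le_div hτ).2 hτ1)
  have h4 : 2 / τ * y ^ 2 = 1 / τ * y ^ 2 + 1 / τ * y ^ 2 := by ring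
  nlinarith

/-! ### Stability in `ℓ²` by descent on the order of the difference -/

section Stability

variable {a lam : ℝ} {r p k kb : ℕ} {c : ℤ → ℝ}

lemma IsPerturbedSolution.energy_succ_le {J : ℕ} {ε γ τ : ℝ} {e : ℕ → ℤ → ℝ}
    (h : IsPerturbedSolution r p kb c J ε γ e) (hτ : 0 < τ) (hτ1 : τ ≤ 1) (n : ℕ) :
    energy J (e (n + 1)) ≤ (1 + τ) * energy J (stencil r p c (e n)) + 2 * (ε ^ 2 / τ) := by
  have h1 : ∀ j ∈ Finset.Icc (1 : ℤ) J, e (n + 1) j ^ 2 ≤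
      (1 + τ) * stencil r p c (e n) j ^ 2 +
        2 / τ * (e (n + 1) j - stencil r p c (e n) j) ^ 2 := by
    intro j _
    have := add_sq_le_of_pos hτ hτ1 (stencil r p c (e n) j) (e (n + 1) j - stencil r p c (e n) j)
    rwa [add_sub_cancel] at this
  refine (Finset.sum_le_sum h1).trans ?_
  rw [Finset.sum_add_distrib, ← Finset.mul_sum, ← Finset.mul_sum, energy]
  have := mul_le_mul_of_nonneg_left (h.interior n) (by positivity : 0 ≤ 2 / τ)
  have e2 : 2 / τ * ε ^ 2 = 2 * (ε ^ 2 / τ) := by ring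
  linarith

/-- `D₋^m` commutes with the operator, but the equation is available on cells `≥ 1` only, hence for
`D₋^m e` only at `j > m`. The cutoff removes `j ≤ kb`, and its slope `2 / J` is the price of moving
it through the operator. -/
lemma exists_weighted_energy_succ_le (r p kb : ℕ) (c : ℤ → ℝ) :
    ∃ C : ℝ, 0 ≤ C ∧ ∀ (J : ℕ) (ε γ τ : ℝ) (e : ℕ → ℤ → ℝ) (m : ℕ),
      1 ≤ J → 0 ≤ γ → 0 < τ → τ ≤ 1 → IsPerturbedSolution r p kb c J ε γ e → m ≤ kb → ∀ n,
      energy J (fun j => cutoff kb J j * backDiff^[m] (e (n + 1)) j) ≤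
        (1 + τ) * energy J (stencil r p c (fun j => cutoff kb J j * backDiff^[m] (e n) j)) +
        C * ((energy J (e n) + γ ^ 2) / J + ε ^ 2 / τ) := by
  obtain ⟨Cg, hCg, hghost⟩ := exists_ghost_bound kb p
  obtain ⟨Cw, hCw, hweight⟩ := exists_weighted_stencil_sq_le r p c
  refine ⟨4 * Cw * (4 ^ kb * Cg) + 2 * 4 ^ kb, by positivity,
    fun J ε γ τ e m hJ hγ hτ hτ1 h hm n => ?_⟩
  have hJ' : (0 : ℝ) < J := by exact_mod_cast hJ
  -- The residual is set to zero outside the domain, so that its differences are bounded by its own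
  -- `ℓ²` norm.
  set f : ℤ → ℝ := fun j =>
    if 1 ≤ j ∧ j ≤ J then e (n + 1) j - stencil r p c (e n) j else 0 with hf
  have hf0 : ∀ j ≤ 0, f j = 0 := fun j hj => if_neg (by omega)
  have hfε : energy J f ≤ ε ^ 2 := by
    refine (le_of_eq (Finset.sum_congr rfl fun j hj => ?_)).trans (h.interior n)
    rw [Finset.mem_Icc] at hj
    simp only [hf]; rw [if_pos hj]
  have h4 : (4 : ℝ) ^ m ≤ 4 ^ kb := pow_le_pow_right₀ (by norm_num) hm
  have hfm : energy J (backDiff^[m] f) ≤ 4 ^ kb * ε ^ 2 :=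
    (sum_backDiff_iterate_sq_le hf0 J m).trans (mul_le_mul h4 hfε (energy_nonneg _ _)
      (by positivity))
  have hw0 : ∀ j ≤ 0, backDiff^[m] (e n) j = 0 := backDiff_iterate_eq_zero m (h.dirichlet n)
  have hterm : ∀ j ∈ Finset.Icc (1 : ℤ) J,
      (cutoff kb J j * backDiff^[m] (e (n + 1)) j) ^ 2 ≤
      (1 + τ) * (cutoff kb J j * stencil r p c (backDiff^[m] (e n)) j) ^ 2 +
        2 / τ * backDiff^[m] f j ^ 2 := by
    intro j hj
    rw [Finset.mem_Icc] at hj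
    by_cases hjk : j ≤ kb
    · rw [cutoff_eq_zero hjk]
      have : 0 ≤ 2 / τ * backDiff^[m] f j ^ 2 := by positivity
      simpa using this
    · have e1 : backDiff^[m] (e (n + 1)) j =
          stencil r p c (backDiff^[m] (e n)) j + backDiff^[m] f j := by
        rw [stencil_backDiff_iterate]
        have := congrFun (backDiff_iterate_add (stencil r p c (e n)) f m) j
        rw [← this]
        refine backDiff_iterate_congr m fun i h1 h2 => ?_
        have : 1 ≤ i ∧ i ≤ (J : ℤ) := by omega
        simp only [hf]; rw [if_pos this]; ring
      rw [e1, mul_add]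
      refine (add_sq_le_of_pos hτ hτ1 _ _).trans (add_le_add le_rfl ?_)
      refine mul_le_mul_of_nonneg_left ?_ (by positivity)
      rw [mul_pow]
      refine mul_le_of_le_one_left (sq_nonneg _) ?_
      rw [← sq_abs]
      exact pow_le_one₀ (abs_nonneg _) (abs_cutoff_le_one _ _ _)
  refine (Finset.sum_le_sum hterm).trans ?_
  rw [Finset.sum_add_distrib, ← Finset.mul_sum, ← Finset.mul_sum]
  have hA := hweight J (backDiff^[m] (e n)) (cutoff kb J) (2 / J) hw0 (by positivity)
    (abs_cutoff_le_one _ _) (abs_cutoff_sub_le _ _)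
  have hB : ∑ j ∈ Finset.Icc (1 : ℤ) ((J : ℤ) + p), backDiff^[m] (e n) j ^ 2 ≤
      4 ^ kb * Cg * (energy J (e n) + γ ^ 2) := by
    have h1 := sum_backDiff_iterate_sq_le (h.dirichlet n) (J + p) m
    have h2 := hghost J (e n) γ (h.dirichlet n) (h.outflow n) hγ
    rw [Nat.cast_add] at h1
    rw [mul_assoc]
    exact h1.trans (mul_le_mul h4 h2 (Finset.sum_nonneg fun _ _ => sq_nonneg _) (by positivity))
  set X := (energy J (e n) + γ ^ 2) / J with hX
  have hX0 : 0 ≤ X := div_nonneg (add_nonneg (energy_nonneg _ _) (sq_nonneg _)) hJ'.le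
  have hC : Cw * (2 / J) * ∑ j ∈ Finset.Icc (1 : ℤ) ((J : ℤ) + p), backDiff^[m] (e n) j ^ 2 ≤
      2 * Cw * (4 ^ kb * Cg) * X := by
    refine (mul_le_mul_of_nonneg_left hB (by positivity)).trans (le_of_eq ?_)
    rw [hX]; ring
  have hD : (1 + τ) * ∑ j ∈ Finset.Icc (1 : ℤ) J,
      (cutoff kb J j * stencil r p c (backDiff^[m] (e n)) j) ^ 2 ≤
      (1 + τ) * energy J (stencil r p c (fun j => cutoff kb J j * backDiff^[m] (e n) j)) +
        2 * (2 * Cw * (4 ^ kb * Cg) * X) := by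
    have h1 := mul_le_mul_of_nonneg_left (hA.trans (add_le_add le_rfl hC))
      (by positivity : 0 ≤ 1 + τ)
    have h2 : 0 ≤ 2 * Cw * (4 ^ kb * Cg) * X := by positivity
    have h3 := mul_le_mul_of_nonneg_right (by linarith : 1 + τ ≤ 2) h2
    rw [mul_add] at h1
    exact h1.trans (add_le_add le_rfl h3)
  have hE : 2 / τ * ∑ j ∈ Finset.Icc (1 : ℤ) J, backDiff^[m] f j ^ 2 ≤
      2 * 4 ^ kb * (ε ^ 2 / τ) := by
    refine (mul_le_mul_of_nonneg_left hfm (by positivity)).trans (le_of_eq ?_)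
    ring
  have hY0 : 0 ≤ ε ^ 2 / τ := by positivity
  have hF : 0 ≤ 4 * Cw * (4 ^ kb * Cg) * (ε ^ 2 / τ) := by positivity
  have hG : 0 ≤ 2 * 4 ^ kb * X := by positivity
  have e3 : (4 * Cw * (4 ^ kb * Cg) + 2 * 4 ^ kb) * (X + ε ^ 2 / τ) =
      2 * (2 * Cw * (4 ^ kb * Cg) * X) + 2 * 4 ^ kb * (ε ^ 2 / τ) +
        4 * Cw * (4 ^ kb * Cg) * (ε ^ 2 / τ) + 2 * 4 ^ kb * X := by ring
  rw [e3]
  linarith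

lemma energy_cutoff_le {J kb m : ℕ} {v : ℤ → ℝ} (hv : ∀ j ≤ 0, v j = 0) (hm : m ≤ kb) :
    energy J (fun j => cutoff kb J j * backDiff^[m] v j) ≤ 4 ^ kb * energy J v := by
  have h1 := sum_backDiff_iterate_sq_le hv J m
  have h4 : (4 : ℝ) ^ m ≤ 4 ^ kb := pow_le_pow_right₀ (by norm_num) hm
  refine (Finset.sum_le_sum fun j _ => ?_).trans
    (h1.trans (mul_le_mul_of_nonneg_right h4 (energy_nonneg J v)))
  rw [mul_pow]
  refine mul_le_of_le_one_left (sq_nonneg _) ?_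
  rw [← sq_abs]
  exact pow_le_one₀ (abs_nonneg _) (abs_cutoff_le_one _ _ _)

lemma boundaryTrace_cutoff {J : ℕ} (hJ : 1 ≤ J) (hJ2 : 2 * (kb + r) ≤ J) (w : ℤ → ℝ) :
    boundaryTrace r p J (fun j => cutoff kb J j * w j) = boundaryTrace r p J w := by
  refine Finset.sum_congr rfl fun i hi => ?_
  rw [Finset.mem_Icc] at hi
  simp only
  rw [cutoff_eq_one hJ (by omega), one_mul]

/-- Control of the traces of `D₋^m e` by a localized energy. -/
lemma exists_potential (ha : 0 < a) (hlam : 0 < lam) (hk : 1 ≤ k)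
    (hc : SchemeAssumption a lam r p k c) (kb d : ℕ) (hd : d ≤ kb) :
    ∃ C : ℝ, 0 ≤ C ∧ ∀ (J : ℕ) (ε γ τ : ℝ) (e : ℕ → ℤ → ℝ), 1 ≤ J → 2 * (kb + r) ≤ J →
      0 ≤ γ → 0 < τ → τ ≤ 1 → IsPerturbedSolution r p kb c J ε γ e →
      ∃ Ψ : ℕ → ℝ, ∀ n, 0 ≤ Ψ n ∧ Ψ n ≤ C * (energy J (e n) + γ ^ 2) ∧
        Ψ (n + 1) + boundaryTrace r p J (backDiff^[kb - d] (e n)) ≤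
          (1 + τ) * Ψ n + C * (energy J (e n) / J + γ ^ 2 + ε ^ 2 / τ) := by
  obtain ⟨Cs, hCs, hstep⟩ := exists_weighted_energy_succ_le r p kb c
  have hstep' : ∀ (J : ℕ) (ε γ τ : ℝ) (e : ℕ → ℤ → ℝ) (m : ℕ),
      1 ≤ J → 0 ≤ γ → 0 < τ → τ ≤ 1 → IsPerturbedSolution r p kb c J ε γ e → m ≤ kb → ∀ n,
      energy J (fun j => cutoff kb J j * backDiff^[m] (e (n + 1)) j) ≤
        (1 + τ) * energy J (stencil r p c (fun j => cutoff kb J j * backDiff^[m] (e n) j)) +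
        Cs * (energy J (e n) / J + γ ^ 2 + ε ^ 2 / τ) := by
    intro J ε γ τ e m hJ hγ hτ hτ1 he hm n
    refine (hstep J ε γ τ e m hJ hγ hτ hτ1 he hm n).trans (add_le_add le_rfl ?_)
    refine mul_le_mul_of_nonneg_left ?_ hCs
    rw [add_div]
    have : γ ^ 2 / J ≤ γ ^ 2 := div_le_self (sq_nonneg _) (by exact_mod_cast hJ)
    linarith
  -- The order of the difference is `kb - d`. The base case uses the smallness of `D₋^kb e` at the
  -- ghost cells; each step trades a trace for the trace of one order less.
  induction d with
  | zero =>
    obtain ⟨b, hb, htr⟩ := exists_dirichlet_trace hc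
    refine ⟨(4 ^ kb + Cs + 4 * p) / b, by positivity,
      fun J ε γ τ e hJ hJ2 hγ hτ hτ1 he => ?_⟩
    have hJ' : (0 : ℝ) < J := by exact_mod_cast hJ
    refine ⟨fun n => energy J (fun j => cutoff kb J j * backDiff^[kb] (e n) j) / b, fun n => ?_⟩
    have hV := energy_nonneg J (e n)
    have hγ2 := sq_nonneg γ
    have hγ' : 0 ≤ (p : ℝ) * γ ^ 2 := by positivity
    set Y := energy J (e n) / J + γ ^ 2 + ε ^ 2 / τ with hY
    have hYγ : γ ^ 2 ≤ Y := by
      have : 0 ≤ energy J (e n) / J := by positivity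
      have : 0 ≤ ε ^ 2 / τ := by positivity
      linarith
    have hY0 : 0 ≤ Y := hγ2.trans hYγ
    refine ⟨div_nonneg (energy_nonneg _ _) hb.le, ?_, ?_⟩
    · rw [div_mul_eq_mul_div]
      refine div_le_div_of_nonneg_right ?_ hb.le
      refine (energy_cutoff_le (he.dirichlet n) le_rfl).trans ?_
      have h1 : (4 : ℝ) ^ kb * energy J (e n) ≤ 4 ^ kb * (energy J (e n) + γ ^ 2) := by
        gcongr; linarith
      have h2 : 0 ≤ (Cs + 4 * p) * (energy J (e n) + γ ^ 2) := by positivity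
      linarith
    · set w := backDiff^[kb] (e n) with hw
      have hw0 : ∀ j ≤ 0, cutoff kb J j * w j = 0 := fun j hj => by
        rw [hw, backDiff_iterate_eq_zero kb (he.dirichlet n) j hj, mul_zero]
      have h1 := htr J (fun j => cutoff kb J j * w j) hw0
      have h2 := hstep' J ε γ τ e kb hJ hγ hτ hτ1 he le_rfl n
      have h3 := boundaryTrace_cutoff (r := r) (p := p) hJ hJ2 w
      have h4 : ∑ i ∈ Finset.Icc (1 : ℤ) p, (cutoff kb J (J + i) * w (J + i)) ^ 2 ≤ p * γ ^ 2 := by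
        refine (sum_sq_le_card_mul (B := γ) fun i hi => ?_).trans (le_of_eq ?_)
        · rw [Finset.mem_Icc] at hi
          rw [abs_mul]
          refine (mul_le_of_le_one_left (abs_nonneg _) (abs_cutoff_le_one _ _ _)).trans ?_
          exact he.outflow n i hi.1 hi.2
        · rw [Int.card_Icc, add_sub_cancel_right, Int.toNat_natCast]
      have hT := boundaryTrace_nonneg r p J w
      change energy J (stencil r p c fun j => cutoff kb J j * w j) +
        b * boundaryTrace r p J (fun j => cutoff kb J j * w j) ≤
        energy J (fun j => cutoff kb J j * w j) + _ at h1
      rw [h3] at h1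
      have h5 : energy J (fun j => cutoff kb J j * backDiff^[kb] (e (n + 1)) j) +
          b * boundaryTrace r p J w ≤
          (1 + τ) * energy J (fun j => cutoff kb J j * w j) + (Cs + 4 * p) * Y := by
        have h6 := mul_le_mul_of_nonneg_left (h1.trans (add_le_add le_rfl
          (mul_le_mul_of_nonneg_left h4 zero_le_two))) (by positivity : 0 ≤ 1 + τ)
        have h7 : 0 ≤ τ * (b * boundaryTrace r p J w) := by positivity
        have h8 : (1 + τ) * (2 * (p * γ ^ 2)) ≤ 4 * p * Y := by
          calc (1 + τ) * (2 * (p * γ ^ 2)) ≤ 2 * (2 * (p * γ ^ 2)) := by gcongr; linarith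
            _ = 4 * p * γ ^ 2 := by ring
            _ ≤ 4 * p * Y := by gcongr
        nlinarith
      have h9 : 0 ≤ (4 : ℝ) ^ kb * Y := by positivity
      rw [Nat.sub_zero]
      refine le_of_mul_le_mul_left ?_ hb
      have e1 : b * (energy J (fun j => cutoff kb J j * backDiff^[kb] (e (n + 1)) j) / b +
          boundaryTrace r p J w) = energy J (fun j => cutoff kb J j * backDiff^[kb] (e (n + 1)) j) +
          b * boundaryTrace r p J w := by field_simp
      have e2 : b * ((1 + τ) * (energy J (fun j => cutoff kb J j * w j) / b) +
          (4 ^ kb + Cs + 4 * p) / b * Y) = (1 + τ) * energy J (fun j => cutoff kb J j * w j) +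
          (Cs + 4 * p) * Y + 4 ^ kb * Y := by field_simp; ring
      rw [e1, e2]
      linarith
  | succ d ih =>
    obtain ⟨C1, hC1, ih⟩ := ih (by omega)
    obtain ⟨b, Co, hb, hCo, htr⟩ := exists_outflow_trace ha hlam hk hc
    refine ⟨(4 ^ kb + Cs + 2 * Co * C1) / b, by positivity,
      fun J ε γ τ e hJ hJ2 hγ hτ hτ1 he => ?_⟩
    have hJ' : (0 : ℝ) < J := by exact_mod_cast hJ
    obtain ⟨Ψ, hΨ⟩ := ih J ε γ τ e hJ hJ2 hγ hτ hτ1 he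
    set m := kb - (d + 1) with hm
    have hmd : kb - d = m + 1 := by omega
    rw [hmd] at hΨ
    -- The trace of order `m + 1` enters with weight `(1 + τ) * Co ≤ 2 * Co`, so the decrease of `2
    -- * Co * Ψ` absorbs it.
    refine ⟨fun n => (energy J (fun j => cutoff kb J j * backDiff^[m] (e n) j) +
      2 * Co * Ψ n) / b, fun n => ?_⟩
    obtain ⟨hΨ0, hΨ1, hΨ2⟩ := hΨ n
    have hV := energy_nonneg J (e n)
    have hγ2 := sq_nonneg γ
    set Y := energy J (e n) / J + γ ^ 2 + ε ^ 2 / τ with hY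
    have hY0 : 0 ≤ Y := by positivity
    refine ⟨div_nonneg (add_nonneg (energy_nonneg _ _) (by positivity)) hb.le, ?_, ?_⟩
    · rw [div_mul_eq_mul_div]
      refine div_le_div_of_nonneg_right ?_ hb.le
      have h0 := energy_cutoff_le (J := J) (he.dirichlet n) (by omega : m ≤ kb)
      have h1 : (4 : ℝ) ^ kb * energy J (e n) ≤ 4 ^ kb * (energy J (e n) + γ ^ 2) := by
        gcongr; linarith
      have h2 : 0 ≤ Cs * (energy J (e n) + γ ^ 2) := by positivity
      have h3 := mul_le_mul_of_nonneg_left hΨ1 (by positivity : 0 ≤ 2 * Co)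
      linarith
    · set w := backDiff^[m] (e n) with hw
      have hw0 : ∀ j ≤ 0, cutoff kb J j * w j = 0 := fun j hj => by
        rw [hw, backDiff_iterate_eq_zero m (he.dirichlet n) j hj, mul_zero]
      have h1 := htr J (fun j => cutoff kb J j * w j) hw0
      have h2 := hstep' J ε γ τ e m hJ hγ hτ hτ1 he (by omega) n
      have h3 := boundaryTrace_cutoff (r := r) (p := p) hJ hJ2 w
      have h4 : ∑ i ∈ Finset.Icc (2 - (r : ℤ)) p,
          backDiff (fun j => cutoff kb J j * w j) (J + i) ^ 2 ≤
          boundaryTrace r p J (backDiff^[m + 1] (e n)) := by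
        rw [boundaryTrace, Function.iterate_succ_apply', ← hw]
        refine le_trans (le_of_eq (Finset.sum_congr rfl fun i hi => ?_))
          (Finset.sum_le_sum_of_subset_of_nonneg
            (Finset.Icc_subset_Icc (by omega : 1 - (r : ℤ) ≤ 2 - r) le_rfl)
            fun _ _ _ => sq_nonneg _)
        rw [Finset.mem_Icc] at hi
        simp only [backDiff]
        rw [cutoff_eq_one hJ (by omega), cutoff_eq_one hJ (by omega), one_mul, one_mul]
      have hT := boundaryTrace_nonneg r p J w
      have hT1 := boundaryTrace_nonneg r p J (backDiff^[m + 1] (e n))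
      set T1 := boundaryTrace r p J (backDiff^[m + 1] (e n)) with hT1def
      change energy J (stencil r p c fun j => cutoff kb J j * w j) +
        b * boundaryTrace r p J (fun j => cutoff kb J j * w j) ≤
        energy J (fun j => cutoff kb J j * w j) + _ at h1
      rw [h3] at h1
      have h5 : energy J (fun j => cutoff kb J j * backDiff^[m] (e (n + 1)) j) +
          2 * Co * Ψ (n + 1) + b * boundaryTrace r p J w ≤
          (1 + τ) * (energy J (fun j => cutoff kb J j * w j) + 2 * Co * Ψ n) +
            (Cs + 2 * Co * C1) * Y := by
        have h6 := mul_le_mul_of_nonneg_left (h1.trans (add_le_add le_rfl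
          (mul_le_mul_of_nonneg_left h4 hCo))) (by positivity : 0 ≤ 1 + τ)
        have h7 : 0 ≤ τ * (b * boundaryTrace r p J w) := by positivity
        have h8 : (1 + τ) * (Co * T1) ≤ 2 * (Co * T1) := by gcongr; linarith
        have h10 := mul_le_mul_of_nonneg_left hΨ2 (by positivity : 0 ≤ 2 * Co)
        nlinarith
      have h9 : 0 ≤ (4 : ℝ) ^ kb * Y := by positivity
      refine le_of_mul_le_mul_left ?_ hb
      have e1 : b * ((energy J (fun j => cutoff kb J j * backDiff^[m] (e (n + 1)) j) +
          2 * Co * Ψ (n + 1)) / b + boundaryTrace r p J w) =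
          energy J (fun j => cutoff kb J j * backDiff^[m] (e (n + 1)) j) +
          2 * Co * Ψ (n + 1) + b * boundaryTrace r p J w := by field_simp
      have e2 : b * ((1 + τ) * ((energy J (fun j => cutoff kb J j * w j) + 2 * Co * Ψ n) / b) +
          (4 ^ kb + Cs + 2 * Co * C1) / b * Y) =
          (1 + τ) * (energy J (fun j => cutoff kb J j * w j) + 2 * Co * Ψ n) +
          (Cs + 2 * Co * C1) * Y + 4 ^ kb * Y := by field_simp; ring
      rw [e1, e2]
      linarith

/-- A Lyapunov functional: one step of the energy produces a multiple of the trace of `D₋ e`, and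
adding a multiple of the potential `Ψ` cancels it. -/
lemma exists_energy_functional (ha : 0 < a) (hlam : 0 < lam) (hk : 1 ≤ k)
    (hc : SchemeAssumption a lam r p k c) (kb : ℕ) :
    ∃ C : ℝ, 1 ≤ C ∧ ∀ (J : ℕ) (ε γ τ : ℝ) (e : ℕ → ℤ → ℝ), 1 ≤ J →
      0 ≤ γ → 0 < τ → τ ≤ 1 → IsPerturbedSolution r p kb c J ε γ e →
      ∃ Φ : ℕ → ℝ, ∀ n, energy J (e n) ≤ Φ n ∧ Φ n ≤ C * (energy J (e n) + γ ^ 2) ∧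
        Φ (n + 1) ≤ (1 + τ) * Φ n + C * (energy J (e n) / J + γ ^ 2 + ε ^ 2 / τ) := by
  obtain ⟨Cg, hCg, hghost⟩ := exists_ghost_bound kb p
  obtain ⟨Ca, hCa, hsten⟩ := exists_stencil_sq_le r p c
  obtain ⟨bo, Co, hbo, hCo, htro⟩ := exists_outflow_trace ha hlam hk hc
  obtain ⟨bd, hbd, htrd⟩ := exists_dirichlet_trace hc
  obtain ⟨Cp, hCp, hpot⟩ := exists_potential ha hlam hk hc kb (kb - 1) (by omega)
  set C : ℝ := 3 + 2 * Ca * Cg + 2 * Ca * Cg * (2 * (kb + r)) + 4 * p + 2 * Co * Cp with hC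
  have c1 : 0 ≤ Ca * Cg := by positivity
  have c2 : 0 ≤ Ca * Cg * (kb + r) := by positivity
  have c3 : 0 ≤ Co * Cp := by positivity
  have c4 : (0 : ℝ) ≤ p := Nat.cast_nonneg _
  refine ⟨C, by linarith, fun J ε γ τ e hJ hγ hτ hτ1 he => ?_⟩
  have hJ' : (0 : ℝ) < J := by exact_mod_cast hJ
  have hγ2 := sq_nonneg γ
  have hετ : 0 ≤ ε ^ 2 / τ := by positivity
  -- With fewer cells the cutoff need not be `1` on the right window, but then `energy ≤ 2 (kb + r)
  -- * (energy / J)` and any bounded amplification per step is admissible.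
  by_cases hJ2 : 2 * (kb + r) ≤ J
  swap
  · refine ⟨fun n => energy J (e n), fun n => ⟨le_rfl, ?_, ?_⟩⟩
    · have hV := energy_nonneg J (e n)
      have : 1 * (energy J (e n) + γ ^ 2) ≤ C * (energy J (e n) + γ ^ 2) := by gcongr; linarith
      linarith
    · have hV := energy_nonneg J (e n)
      set V := energy J (e n) with hVdef
      have h1 := he.energy_succ_le hτ hτ1 n
      have h2 : energy J (stencil r p c (e n)) ≤ Ca * (Cg * (V + γ ^ 2)) :=
        (hsten J (e n) (he.dirichlet n)).trans (mul_le_mul_of_nonneg_left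
          (hghost J (e n) γ (he.dirichlet n) (he.outflow n) hγ) hCa)
      have h3 : (1 + τ) * energy J (stencil r p c (e n)) ≤ 2 * (Ca * (Cg * (V + γ ^ 2))) :=
        mul_le_mul (by linarith) h2 (energy_nonneg _ _) zero_le_two
      have h4 : V ≤ 2 * (kb + r) * (V / J) := by
        have : (J : ℝ) ≤ 2 * (kb + r) := by exact_mod_cast (not_le.1 hJ2).le
        calc V = J * (V / J) := by field_simp
          _ ≤ 2 * (kb + r) * (V / J) := by gcongr
      have h5 := mul_le_mul_of_nonneg_left h4 (by positivity : 0 ≤ 2 * Ca * Cg)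
      have h6 : (2 * Ca * Cg * (2 * (kb + r)) * (V / J) + 2 * Ca * Cg * γ ^ 2 + 2 * (ε ^ 2 / τ)) ≤
          C * (V / J) + C * γ ^ 2 + C * (ε ^ 2 / τ) := by
        gcongr
        · linarith
        · linarith
        · linarith
      have h7 : 0 ≤ (1 + τ) * V := by positivity
      simp only [mul_add]
      linarith
  -- For `kb = 0` the ghost values themselves are at most `γ`, and the Dirichlet estimate suffices.
  rcases Nat.eq_zero_or_pos kb with hkb | hkb
  · subst hkb
    refine ⟨fun n => energy J (e n), fun n => ⟨le_rfl, ?_, ?_⟩⟩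
    · have hV := energy_nonneg J (e n)
      have : 1 * (energy J (e n) + γ ^ 2) ≤ C * (energy J (e n) + γ ^ 2) := by gcongr; linarith
      linarith
    · have hV := energy_nonneg J (e n)
      set V := energy J (e n) with hVdef
      have h1 := he.energy_succ_le hτ hτ1 n
      have h2 := htrd J (e n) (he.dirichlet n)
      have h4 : ∑ i ∈ Finset.Icc (1 : ℤ) p, e n (J + i) ^ 2 ≤ p * γ ^ 2 := by
        refine (sum_sq_le_card_mul (B := γ) fun i hi => ?_).trans (le_of_eq ?_)
        · rw [Finset.mem_Icc] at hi
          exact he.outflow n i hi.1 hi.2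
        · rw [Int.card_Icc, add_sub_cancel_right, Int.toNat_natCast]
      have h5 : 0 ≤ bd * ∑ i ∈ Finset.Icc (1 - (r : ℤ)) p, e n (J + i) ^ 2 :=
        mul_nonneg hbd.le (Finset.sum_nonneg fun _ _ => sq_nonneg _)
      have h6 : energy J (stencil r p c (e n)) ≤ V + 2 * (p * γ ^ 2) := by
        rw [hVdef, energy, energy]; linarith
      have h7 : (1 + τ) * energy J (stencil r p c (e n)) ≤ (1 + τ) * (V + 2 * (p * γ ^ 2)) := by
        gcongr
      have h8 : (1 + τ) * (2 * (p * γ ^ 2)) ≤ 2 * (2 * (p * γ ^ 2)) := by gcongr; linarith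
      have h9 : (4 * p * γ ^ 2 + 2 * (ε ^ 2 / τ)) ≤ C * γ ^ 2 + C * (ε ^ 2 / τ) := by
        gcongr
        · linarith
        · linarith
      have h10 : 0 ≤ C * (V / J) := mul_nonneg (by linarith) (by positivity)
      simp only [mul_add]
      linarith
  · obtain ⟨Ψ, hΨ⟩ := hpot J ε γ τ e hJ hJ2 hγ hτ hτ1 he
    have hkb1 : kb - (kb - 1) = 1 := by omega
    rw [hkb1] at hΨ
    refine ⟨fun n => energy J (e n) + 2 * Co * Ψ n, fun n => ?_⟩
    obtain ⟨hΨ0, hΨ1, hΨ2⟩ := hΨ n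
    have hV := energy_nonneg J (e n)
    set V := energy J (e n) with hVdef
    refine ⟨le_add_of_nonneg_right (by positivity), ?_, ?_⟩
    · have h1 := mul_le_mul_of_nonneg_left hΨ1 (by positivity : 0 ≤ 2 * Co)
      have h2 : (1 + 2 * Co * Cp) * (V + γ ^ 2) ≤ C * (V + γ ^ 2) := by gcongr; linarith
      linarith
    · have h1 := he.energy_succ_le hτ hτ1 n
      have h2 := htro J (e n) (he.dirichlet n)
      have h4 : ∑ i ∈ Finset.Icc (2 - (r : ℤ)) p, backDiff (e n) (J + i) ^ 2 ≤
          boundaryTrace r p J (backDiff^[1] (e n)) :=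
        Finset.sum_le_sum_of_subset_of_nonneg
          (Finset.Icc_subset_Icc (by omega : 1 - (r : ℤ) ≤ 2 - r) le_rfl)
          fun _ _ _ => sq_nonneg _
      have h5 : 0 ≤ bo * ∑ i ∈ Finset.Icc (1 - (r : ℤ)) p, e n (J + i) ^ 2 :=
        mul_nonneg hbo.le (Finset.sum_nonneg fun _ _ => sq_nonneg _)
      have hT1 := boundaryTrace_nonneg r p J (backDiff^[1] (e n))
      set T1 := boundaryTrace r p J (backDiff^[1] (e n)) with hT1def
      have h4' := mul_le_mul_of_nonneg_left h4 hCo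
      have h6 : energy J (stencil r p c (e n)) ≤ V + Co * T1 := by
        rw [hVdef, energy, energy]; linarith
      have h7 : (1 + τ) * energy J (stencil r p c (e n)) ≤ (1 + τ) * (V + Co * T1) := by
        gcongr
      have h8 : (1 + τ) * (Co * T1) ≤ 2 * (Co * T1) := by gcongr; linarith
      have h10 := mul_le_mul_of_nonneg_left hΨ2 (by positivity : 0 ≤ 2 * Co)
      have h11 : (2 * Co * Cp) * (V / J + γ ^ 2 + ε ^ 2 / τ) + 2 * (ε ^ 2 / τ) ≤
          C * (V / J + γ ^ 2 + ε ^ 2 / τ) := by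
        have : (C - 2 * Co * Cp - 2) * (V / J + γ ^ 2 + ε ^ 2 / τ) ≥ 0 :=
          mul_nonneg (by linarith) (by positivity)
        have : 0 ≤ V / J := by positivity
        linarith
      linarith

/-- Discrete Grönwall inequality. -/
lemma le_pow_mul_of_succ_le {Φ : ℕ → ℝ} {β D : ℝ} (hβ : 0 ≤ β) (hD : 0 ≤ D)
    (h : ∀ n, Φ (n + 1) ≤ (1 + β) * Φ n + D) (N : ℕ) :
    Φ N ≤ (1 + β) ^ N * (Φ 0 + N * D) := by
  induction N with
  | zero => simp
  | succ N ih =>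
    have h1 := mul_le_mul_of_nonneg_left ih (by positivity : 0 ≤ 1 + β)
    have h2 : D ≤ (1 + β) ^ (N + 1) * D :=
      le_mul_of_one_le_left hD (one_le_pow₀ (by linarith))
    have := h N
    push_cast
    rw [pow_succ] at *
    nlinarith

/-- Stability of the scheme in `ℓ²`. -/
theorem exists_stability (ha : 0 < a) (hlam : 0 < lam) (hk : 1 ≤ k)
    (hc : SchemeAssumption a lam r p k c) (kb : ℕ) :
    ∃ C : ℝ, 0 < C ∧ ∀ (J : ℕ) (ε γ : ℝ) (e : ℕ → ℤ → ℝ), 1 ≤ J → 0 ≤ γ →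
      IsPerturbedSolution r p kb c J ε γ e → ∀ N : ℕ, 1 ≤ N →
      energy J (e N) ≤ C * Real.exp (C * (N / J)) *
        (energy J (e 0) + (N * ε) ^ 2 + N * γ ^ 2) := by
  obtain ⟨C, hC, hmain⟩ := exists_energy_functional ha hlam hk hc kb
  refine ⟨2 * Real.exp 1 * C, by positivity, fun J ε γ e hJ hγ he N hN => ?_⟩
  have hJ' : (0 : ℝ) < J := by exact_mod_cast hJ
  have hN1 : (1 : ℝ) ≤ N := by exact_mod_cast hN
  have hN' : (0 : ℝ) < N := by linarith
  have hC0 : 0 ≤ C := by linarith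
  -- `τ = 1 / N` keeps `(1 + τ) ^ N` below the constant `exp 1`, and `N` sources `ε ^ 2 / τ` add up
  -- to `(N ε) ^ 2`.
  obtain ⟨Φ, hΦ⟩ := hmain J ε γ (1 / N) e hJ hγ (by positivity) (by rw [div_le_one hN']; exact hN1)
    he
  have hV := energy_nonneg J (e 0)
  have hγ2 := sq_nonneg γ
  set D := C * (γ ^ 2 + N * ε ^ 2) with hD
  have hD0 : 0 ≤ D := by positivity
  have hrec : ∀ n, Φ (n + 1) ≤ (1 + (1 / N + C / J)) * Φ n + D := by
    intro n
    obtain ⟨h1, -, h2⟩ := hΦ n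
    have h3 : energy J (e n) / J ≤ Φ n / J := div_le_div_of_nonneg_right h1 hJ'.le
    have h4 := mul_le_mul_of_nonneg_left h3 hC0
    have e1 : ε ^ 2 / (1 / (N : ℝ)) = N * ε ^ 2 := by field_simp
    have e2 : C * (Φ n / J) = C / J * Φ n := by ring
    rw [e1] at h2
    rw [hD]
    linarith
  have h1 := le_pow_mul_of_succ_le (by positivity) hD0 hrec N
  have hpow : (1 + (1 / N + C / J)) ^ N ≤ Real.exp 1 * Real.exp (C * (N / J)) := by
    have h2 : 1 + (1 / N + C / J) ≤ Real.exp (1 / N + C / J) := by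
      rw [add_comm]; exact Real.add_one_le_exp _
    refine (pow_le_pow_left₀ (by positivity) h2 N).trans (le_of_eq ?_)
    rw [← Real.exp_nat_mul, ← Real.exp_add]
    congr 1; field_simp
  have hS : Φ 0 + N * D ≤ 2 * C * (energy J (e 0) + (N * ε) ^ 2 + N * γ ^ 2) := by
    have h3 := (hΦ 0).2.1
    have h4 : C * γ ^ 2 ≤ C * (N * γ ^ 2) := by
      gcongr; exact le_mul_of_one_le_left hγ2 hN1
    have h5 : 0 ≤ C * energy J (e 0) := by positivity
    have h6 : 0 ≤ C * (N * ε) ^ 2 := by positivity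
    rw [hD]
    linarith
  have hS0 : 0 ≤ energy J (e 0) + (N * ε) ^ 2 + N * γ ^ 2 := by positivity
  have hexp : Real.exp (C * (N / J)) ≤ Real.exp (2 * Real.exp 1 * C * (N / J)) := by
    apply Real.exp_le_exp.2
    gcongr
    have : 1 ≤ Real.exp 1 := Real.one_le_exp zero_le_one
    exact le_mul_of_one_le_left hC0 (by linarith)
  calc energy J (e N) ≤ Φ N := (hΦ N).1
    _ ≤ _ := h1
    _ ≤ (1 + (1 / N + C / J)) ^ N * (2 * C * (energy J (e 0) + (N * ε) ^ 2 + N * γ ^ 2)) := by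
        gcongr
    _ ≤ (Real.exp 1 * Real.exp (C * (N / J))) *
        (2 * C * (energy J (e 0) + (N * ε) ^ 2 + N * γ ^ 2)) := by gcongr
    _ ≤ (Real.exp 1 * Real.exp (2 * Real.exp 1 * C * (N / J))) *
        (2 * C * (energy J (e 0) + (N * ε) ^ 2 + N * γ ^ 2)) := by gcongr
    _ = _ := by ring

end Stability

/-! ### Iterated primitives and Taylor's formula -/

section IteratedIntegrals

/-- The iterated primitives of `g` that vanish at `0`. -/
def iterInt (g : ℝ → ℝ) : ℕ → ℝ → ℝ
  | 0 => fun x => ∫ y in (0 : ℝ)..x, g y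
  | j + 1 => fun x => ∫ y in (0 : ℝ)..x, iterInt g j y

variable {g : ℝ → ℝ}

lemma continuous_iterInt (hg : Integrable g) (j : ℕ) : Continuous (iterInt g j) := by
  induction j with
  | zero => exact intervalIntegral.continuous_primitive (fun a b => hg.intervalIntegrable) 0
  | succ j ih => exact intervalIntegral.continuous_primitive (fun a b => ih.intervalIntegrable a b) 0

lemma iterInt_zero_sub (hg : Integrable g) (x y : ℝ) :
    iterInt g 0 y - iterInt g 0 x = ∫ t in x..y, g t :=
  intervalIntegral.integral_interval_sub_left hg.intervalIntegrable hg.intervalIntegrable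

lemma iterInt_succ_sub (hg : Integrable g) (j : ℕ) (x y : ℝ) :
    iterInt g (j + 1) y - iterInt g (j + 1) x = ∫ t in x..y, iterInt g j t :=
  intervalIntegral.integral_interval_sub_left
    ((continuous_iterInt hg j).intervalIntegrable _ _)
    ((continuous_iterInt hg j).intervalIntegrable _ _)

lemma iterInt_eq_zero (hg : ∀ x ≤ 0, g x = 0) (j : ℕ) : ∀ x ≤ 0, iterInt g j x = 0 := by
  induction j with
  | zero =>
    intro x hx
    refine (intervalIntegral.integral_congr (g := fun _ => 0) fun y hy => ?_).trans (by simp)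
    rw [uIcc_of_ge hx] at hy
    exact hg y hy.2
  | succ j ih =>
    intro x hx
    refine (intervalIntegral.integral_congr (g := fun _ => 0) fun y hy => ?_).trans (by simp)
    rw [uIcc_of_ge hx] at hy
    exact ih y hy.2

/-- Taylor's formula for the iterated primitives. -/
lemma abs_iterInt_sub_taylor_le (hg : Integrable g) (j : ℕ) (z s : ℝ) (hs : 0 ≤ s) :
    |iterInt g j (z + s) -
      ∑ m ∈ Finset.range (j + 1), iterInt g (j - m) z * (s ^ m / m.factorial)| ≤
      s ^ j * ∫ y in z..(z + s), |g y| := by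
  induction j generalizing s with
  | zero =>
    simp only [zero_add, Finset.range_one, Finset.sum_singleton, pow_zero, Nat.factorial_zero,
      Nat.cast_one, div_one, mul_one, one_mul, Nat.sub_zero]
    rw [iterInt_zero_sub hg]
    exact intervalIntegral.abs_integral_le_integral_abs (by linarith)
  | succ j ih =>
    have hP : Continuous fun σ : ℝ =>
        ∑ m ∈ Finset.range (j + 1), iterInt g (j - m) z * (σ ^ m / m.factorial) := by fun_prop
    have hI : Continuous fun σ : ℝ => iterInt g j (z + σ) :=
      (continuous_iterInt hg j).comp (by fun_prop)
    -- The remainder of order `j + 1` is the integral of the one of order `j`; the resulting gain of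
    -- factorials is not kept.
    have e1 : iterInt g (j + 1) (z + s) -
        ∑ m ∈ Finset.range (j + 1 + 1), iterInt g (j + 1 - m) z * (s ^ m / m.factorial) =
        ∫ σ in (0 : ℝ)..s, (iterInt g j (z + σ) -
          ∑ m ∈ Finset.range (j + 1), iterInt g (j - m) z * (σ ^ m / m.factorial)) := by
      rw [intervalIntegral.integral_sub (hI.intervalIntegrable _ _) (hP.intervalIntegrable _ _),
        intervalIntegral.integral_comp_add_left (fun y => iterInt g j y), add_zero,
        ← iterInt_succ_sub hg, Finset.sum_range_succ', intervalIntegral.integral_finsetSum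
        (fun m _ => Continuous.intervalIntegrable (by fun_prop) _ _)]
      have : ∀ m ∈ Finset.range (j + 1),
          ∫ σ in (0 : ℝ)..s, iterInt g (j - m) z * (σ ^ m / m.factorial) =
          iterInt g (j + 1 - (m + 1)) z * (s ^ (m + 1) / (m + 1).factorial) := by
        intro m _
        rw [intervalIntegral.integral_const_mul, intervalIntegral.integral_div, integral_pow,
          Nat.add_sub_add_right, Nat.factorial_succ]
        push_cast
        field_simp
        simp
      rw [Finset.sum_congr rfl this]
      simp
      ring
    rw [e1, ← Real.norm_eq_abs]
    have hb : ∀ σ ∈ uIoc (0 : ℝ) s, ‖iterInt g j (z + σ) -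
        ∑ m ∈ Finset.range (j + 1), iterInt g (j - m) z * (σ ^ m / m.factorial)‖ ≤
        s ^ j * ∫ y in z..(z + s), |g y| := by
      intro σ hσ
      rw [uIoc_of_le hs] at hσ
      refine (ih σ hσ.1.le).trans ?_
      refine mul_le_mul (pow_le_pow_left₀ hσ.1.le hσ.2 j) ?_
        (intervalIntegral.integral_nonneg (by linarith [hσ.1]) fun _ _ => abs_nonneg _)
        (pow_nonneg hs j)
      refine intervalIntegral.integral_mono_interval le_rfl (by linarith [hσ.1])
        (by linarith [hσ.2]) (ae_of_all _ fun _ => abs_nonneg _) ?_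
      exact (hg.intervalIntegrable).abs
    refine (intervalIntegral.norm_integral_le_of_norm_le_const hb).trans (le_of_eq ?_)
    rw [sub_zero, abs_of_nonneg hs]; ring

end IteratedIntegrals

/-! ### Pointwise consistency -/

section Consistency

variable {a lam : ℝ} {r p k : ℕ} {c : ℤ → ℝ} {g : ℝ → ℝ}

/-- The binomial formula moves the moment conditions to another base point, as needed for Taylor
expansion at the left of the stencil. -/
lemma SchemeAssumption.sum_mul_pow (hc : SchemeAssumption a lam r p k c) (R : ℝ) {m : ℕ}
    (hm : m ≤ k) :
    ∑ l ∈ Finset.Icc (-(r : ℤ)) (p : ℤ), c l * (R + l) ^ m = (R - lam * a) ^ m := by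
  have h1 : ∀ l ∈ Finset.Icc (-(r : ℤ)) (p : ℤ), c l * (R + l) ^ m =
      ∑ i ∈ Finset.range (m + 1), ((l : ℝ) ^ i * c l) * (R ^ (m - i) * (m.choose i : ℝ)) := by
    intro l _
    rw [add_comm R, add_pow, Finset.mul_sum]
    exact Finset.sum_congr rfl fun i _ => by ring
  rw [Finset.sum_congr rfl h1, Finset.sum_comm]
  have h2 : ∀ i ∈ Finset.range (m + 1), ∑ l ∈ Finset.Icc (-(r : ℤ)) (p : ℤ),
      ((l : ℝ) ^ i * c l) * (R ^ (m - i) * (m.choose i : ℝ)) =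
      (-(lam * a)) ^ i * R ^ (m - i) * (m.choose i : ℝ) := by
    intro i hi
    rw [Finset.mem_range] at hi
    rw [← Finset.sum_mul, hc.consistent i (by omega)]; ring
  rw [Finset.sum_congr rfl h2, ← add_pow]
  congr 1; ring

/-- Pointwise consistency error of the scheme. -/
lemma exists_pointwise_consistency (hc : SchemeAssumption a lam r p k c) (ha : 0 < a)
    (hlam : 0 < lam) :
    ∃ (R : ℕ) (K : ℝ), 0 ≤ K ∧ ∀ g : ℝ → ℝ, Integrable g → ∀ dx : ℝ, 0 < dx → ∀ x : ℝ,
      |iterInt g k (x - lam * a * dx) -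
        ∑ l ∈ Finset.Icc (-(r : ℤ)) (p : ℤ), c l * iterInt g k (x + l * dx)| ≤
      K * dx ^ k * ∫ y in (x - R * dx)..(x + p * dx), |g y| := by
  -- All points in play lie to the right of `x - R * dx`, so every Taylor expansion from there has
  -- `s ≥ 0`.
  obtain ⟨R, hR⟩ := exists_nat_ge (max (r : ℝ) (lam * a))
  have hRr : (r : ℝ) ≤ R := (le_max_left _ _).trans hR
  have hRa : lam * a ≤ R := (le_max_right _ _).trans hR
  have hla : 0 < lam * a := mul_pos hlam ha
  set A := ∑ l ∈ Finset.Icc (-(r : ℤ)) (p : ℤ), |c l| with hA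
  have hA0 : 0 ≤ A := Finset.sum_nonneg fun _ _ => abs_nonneg _
  refine ⟨R, (1 + A) * (R + p) ^ k, by positivity, fun g hg dx hdx x => ?_⟩
  set z := x - R * dx with hz
  set I := ∫ y in z..(x + p * dx), |g y| with hI
  set P : ℝ → ℝ := fun s =>
    ∑ m ∈ Finset.range (k + 1), iterInt g (k - m) z * (s ^ m / m.factorial) with hP
  have hp0 : (0 : ℝ) ≤ p := Nat.cast_nonneg _
  have hI0 : 0 ≤ I := intervalIntegral.integral_nonneg (by rw [hz]; nlinarith)
    fun _ _ => abs_nonneg _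
  have hrem : ∀ s, 0 ≤ s → s ≤ (R + p) * dx →
      |iterInt g k (z + s) - P s| ≤ ((R + p) * dx) ^ k * I := by
    intro s hs hs2
    refine (abs_iterInt_sub_taylor_le hg k z s hs).trans ?_
    refine mul_le_mul (pow_le_pow_left₀ hs hs2 k) ?_
      (intervalIntegral.integral_nonneg (by linarith) fun _ _ => abs_nonneg _) (by positivity)
    exact intervalIntegral.integral_mono_interval le_rfl (by linarith) (by rw [hz]; linarith)
      (ae_of_all _ fun _ => abs_nonneg _) hg.intervalIntegrable.abs
  -- The scheme transports polynomials of degree at most `k` exactly; only the remainders survive.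
  have hpoly : P ((R - lam * a) * dx) =
      ∑ l ∈ Finset.Icc (-(r : ℤ)) (p : ℤ), c l * P ((R + l) * dx) := by
    simp only [hP, Finset.mul_sum]
    rw [Finset.sum_comm]
    refine Finset.sum_congr rfl fun m hm => ?_
    rw [Finset.mem_range] at hm
    have : ∀ l ∈ Finset.Icc (-(r : ℤ)) (p : ℤ),
        c l * (iterInt g (k - m) z * (((R + l) * dx) ^ m / m.factorial)) =
        (c l * (R + l) ^ m) * (iterInt g (k - m) z * (dx ^ m / m.factorial)) := by
      intro l _
      rw [mul_pow]; ring
    rw [Finset.sum_congr rfl this, ← Finset.sum_mul, hc.sum_mul_pow _ (by omega), mul_pow]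
    ring
  have hx1 : x - lam * a * dx = z + (R - lam * a) * dx := by rw [hz]; ring
  have hx2 : ∀ l : ℤ, x + l * dx = z + (R + l) * dx := fun l => by rw [hz]; ring
  simp only [hx1, hx2]
  have e : iterInt g k (z + (R - lam * a) * dx) -
      ∑ l ∈ Finset.Icc (-(r : ℤ)) (p : ℤ), c l * iterInt g k (z + (R + l) * dx) =
      (iterInt g k (z + (R - lam * a) * dx) - P ((R - lam * a) * dx)) -
      ∑ l ∈ Finset.Icc (-(r : ℤ)) (p : ℤ),
        c l * (iterInt g k (z + (R + l) * dx) - P ((R + l) * dx)) := by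
    simp only [mul_sub, Finset.sum_sub_distrib]
    rw [hpoly]; ring
  rw [e]
  have b1 := hrem ((R - lam * a) * dx) (mul_nonneg (by linarith) hdx.le) (by gcongr; linarith)
  have b2 : |∑ l ∈ Finset.Icc (-(r : ℤ)) (p : ℤ),
      c l * (iterInt g k (z + (R + l) * dx) - P ((R + l) * dx))| ≤
      A * (((R + p) * dx) ^ k * I) := by
    refine abs_sum_mul_le_of_abs_le fun l hl => ?_
    rw [Finset.mem_Icc] at hl
    have h1 : -(r : ℝ) ≤ l := by exact_mod_cast hl.1
    have h2 : (l : ℝ) ≤ p := by exact_mod_cast hl.2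
    exact hrem _ (mul_nonneg (by linarith) hdx.le) (by gcongr)
  refine (abs_sub _ _).trans ((add_le_add b1 b2).trans (le_of_eq ?_))
  rw [mul_pow]; ring

end Consistency

/-! ### Cell averages and their differences -/

section CellAverages

/-- Cauchy–Schwarz, read off from the integral of `(|g| - m) ^ 2` with `m` the mean of `|g|`. -/
lemma sq_integral_abs_le {g : ℝ → ℝ} {x y : ℝ} (hxy : x ≤ y) (hg : IntervalIntegrable g volume x y)
    (hg2 : IntervalIntegrable (fun t => g t ^ 2) volume x y) :
    (∫ t in x..y, |g t|) ^ 2 ≤ (y - x) * ∫ t in x..y, g t ^ 2 := by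
  rcases hxy.eq_or_lt with rfl | hlt
  · simp
  set S := ∫ t in x..y, |g t| with hS
  set m := S / (y - x) with hm
  have hd : 0 < y - x := sub_pos.2 hlt
  have h0 : 0 ≤ ∫ t in x..y, (|g t| - m) ^ 2 :=
    intervalIntegral.integral_nonneg hxy fun _ _ => sq_nonneg _
  have e : ∀ t, (|g t| - m) ^ 2 = g t ^ 2 - 2 * m * |g t| + m ^ 2 := by
    intro t; rw [sub_sq, sq_abs]; ring
  simp only [e] at h0
  rw [intervalIntegral.integral_add (hg2.sub (hg.abs.const_mul _)) intervalIntegrable_const,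
    intervalIntegral.integral_sub hg2 (hg.abs.const_mul _), intervalIntegral.integral_const_mul,
    intervalIntegral.integral_const, smul_eq_mul, ← hS] at h0
  have hmS : S = m * (y - x) := by rw [hm]; field_simp
  rw [hmS] at h0 ⊢
  nlinarith

lemma abs_cellAverage_le {dx B : ℝ} (hdx : 0 < dx) {f : ℝ → ℝ} {j : ℤ}
    (h : ∀ y, ((j : ℝ) - 1) * dx ≤ y → y ≤ j * dx → |f y| ≤ B) : |cellAverage dx f j| ≤ B := by
  have hle : ((j : ℝ) - 1) * dx ≤ j * dx := by nlinarith
  have := intervalIntegral.norm_integral_le_of_norm_le_const (a := ((j : ℝ) - 1) * dx)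
    (b := j * dx) (f := f) (C := B) fun y hy => by
      rw [uIoc_of_le hle] at hy
      exact h y hy.1.le hy.2
  rw [Real.norm_eq_abs, show (j : ℝ) * dx - ((j : ℝ) - 1) * dx = dx by ring, abs_of_pos hdx] at this
  rw [cellAverage, abs_mul, abs_of_pos (by positivity : 0 < 1 / dx), one_div, inv_mul_le_iff₀ hdx]
  linarith

lemma cellAverage_add_int (dx : ℝ) (f : ℝ → ℝ) (j l : ℤ) :
    cellAverage dx f (j + l) = cellAverage dx (fun y => f (y + l * dx)) j := by
  rw [cellAverage, cellAverage, intervalIntegral.integral_comp_add_right]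
  congr 2 <;> push_cast <;> ring

lemma backDiff_cellAverage {dx : ℝ} {f : ℝ → ℝ} (hf : Continuous f) :
    backDiff (cellAverage dx f) = cellAverage dx (fun y => f y - f (y - dx)) := by
  funext j
  have h1 := cellAverage_add_int dx f j (-1)
  rw [backDiff, sub_eq_add_neg j 1, h1, cellAverage, cellAverage, cellAverage, ← mul_sub,
    ← intervalIntegral.integral_sub (hf.intervalIntegrable _ _)
      (Continuous.intervalIntegrable (by fun_prop) _ _)]
  congr 1
  refine intervalIntegral.integral_congr fun y _ => ?_
  congr 2; push_cast; ring

/-- Each `D₋` turns a primitive into an integral over a length `dx` and so gains a factor `dx`. The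
induction runs over all chains of primitives, because it passes to the chain of differences. As `D₋`
looks to the left, a bound on a left half-line suffices. -/
lemma abs_backDiff_iterate_cellAverage_le {dx : ℝ} (hdx : 0 < dx) (q : ℕ) (F : ℕ → ℝ → ℝ) {B X : ℝ}
    (hF : ∀ i, Continuous (F i)) (hFi : ∀ i x y, F (i + 1) y - F (i + 1) x = ∫ t in x..y, F i t)
    (hB : ∀ y ≤ X, |F 0 y| ≤ B) (j : ℤ) (hj : j * dx ≤ X) :
    |backDiff^[q] (cellAverage dx (F q)) j| ≤ dx ^ q * B := by
  induction q generalizing F B with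
  | zero =>
    rw [pow_zero, one_mul]
    exact abs_cellAverage_le hdx fun y _ hy => hB y (hy.trans hj)
  | succ q ih =>
    rw [Function.iterate_succ_apply, backDiff_cellAverage (hF _)]
    have hsh : ∀ i, Continuous fun y => F i (y - dx) := fun i => (hF i).comp (by fun_prop)
    have := ih (fun i y => F (i + 1) y - F (i + 1) (y - dx)) (B := dx * B)
      (fun i => (hF _).sub (hsh _)) (fun i x y => by
        rw [intervalIntegral.integral_sub ((hF _).intervalIntegrable _ _)
          ((hsh _).intervalIntegrable _ _), intervalIntegral.integral_comp_sub_right, ← hFi, ← hFi]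
        ring) (fun y hy => by
        rw [hFi, ← Real.norm_eq_abs]
        refine (intervalIntegral.norm_integral_le_of_norm_le_const (C := B) fun t ht => ?_).trans
          (le_of_eq ?_)
        · rw [uIoc_of_le (by linarith)] at ht
          exact hB t (ht.2.trans hy)
        · rw [sub_sub_cancel, abs_of_pos hdx]; ring)
    refine this.trans (le_of_eq ?_)
    ring

lemma abs_backDiff_iterate_le {v : ℤ → ℝ} {B : ℝ} (m : ℕ) {j : ℤ} (h : ∀ i ≤ j, |v i| ≤ B) :
    |backDiff^[m] v j| ≤ 2 ^ m * B := by
  induction m generalizing v B with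
  | zero => simpa using h j le_rfl
  | succ m ih =>
    rw [Function.iterate_succ_apply, pow_succ, mul_assoc]
    refine ih fun i hi => (abs_sub _ _).trans ?_
    linarith [h i hi, h (i - 1) (by omega)]

/-- For `G` a primitive of a density sampled on the grid, this counts overlaps: windows of `N` cells
cover each cell at most `N` times. The proof telescopes once per unit of shift. -/
lemma sum_sub_shift_le {G : ℤ → ℝ} {M : ℝ} (h : ∀ i j, G i - G j ≤ M) (J N : ℕ) :
    ∑ j ∈ Finset.Icc (1 : ℤ) J, (G (j + N) - G j) ≤ N * M := by
  induction N with
  | zero => simp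
  | succ N ih =>
    have e : ∀ j ∈ Finset.Icc (1 : ℤ) J, G (j + (N + 1 : ℕ)) - G j =
        (G (j + (N + 1 : ℕ)) - G (j + N)) + (G (j + N) - G j) := fun j _ => by ring
    rw [Finset.sum_congr rfl e, Finset.sum_add_distrib]
    have h1 : ∑ j ∈ Finset.Icc (1 : ℤ) J, (G (j + (N + 1 : ℕ)) - G (j + N)) ≤ M := by
      rw [sum_Icc_one]
      have e2 : ∀ i ∈ Finset.range J, G ((i : ℤ) + 1 + (N + 1 : ℕ)) - G ((i : ℤ) + 1 + N) =
          (fun i : ℕ => G ((i : ℤ) + 1 + N)) (i + 1) - (fun i : ℕ => G ((i : ℤ) + 1 + N)) i := by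
        intro i _
        simp only
        congr 2; push_cast; ring
      rw [Finset.sum_congr rfl e2, Finset.sum_range_sub (fun i : ℕ => G ((i : ℤ) + 1 + N))]
      exact h _ _
    push_cast at *
    linarith

end CellAverages

/-! ### Consistency in `ℓ²` -/

section ConsistencyL2

variable {a lam : ℝ} {r p k : ℕ} {c : ℤ → ℝ}

/-- Consistency error of the scheme in `ℓ²`. -/
lemma exists_consistency (hc : SchemeAssumption a lam r p k c) (ha : 0 < a) (hlam : 0 < lam) :
    ∃ K : ℝ, 0 ≤ K ∧ ∀ g : ℝ → ℝ, Integrable g → Integrable (fun y => g y ^ 2) →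
      ∀ dx : ℝ, 0 < dx → ∀ (J : ℕ) (s : ℝ),
      ∑ j ∈ Finset.Icc (1 : ℤ) J,
        (cellAverage dx (fun y => iterInt g k (y - (s + lam * a * dx))) j -
          stencil r p c (cellAverage dx fun y => iterInt g k (y - s)) j) ^ 2 ≤
      K ^ 2 * dx ^ (2 * k) * dx * ∫ y, g y ^ 2 := by
  obtain ⟨R, K, hK, hpt⟩ := exists_pointwise_consistency hc ha hlam
  -- The window of the pointwise estimate, as `x` runs over a cell, spans `R + p + 1` cells. In the
  -- square, one such factor comes from Cauchy–Schwarz and one from the overlaps.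
  refine ⟨K * (R + p + 1 : ℕ), by positivity, fun g hg hg2 dx hdx J s => ?_⟩
  set N : ℕ := R + p + 1 with hN
  have hgi : ∀ x y, IntervalIntegrable g volume x y := fun x y => hg.intervalIntegrable
  have hg2i : ∀ x y, IntervalIntegrable (fun y => g y ^ 2) volume x y :=
    fun x y => hg2.intervalIntegrable
  set G : ℤ → ℝ := fun i => ∫ y in (0 : ℝ)..(((i : ℝ) - 1 - R) * dx - s), g y ^ 2 with hG
  have hGsub : ∀ i j, G i - G j =
      ∫ y in (((j : ℝ) - 1 - R) * dx - s)..(((i : ℝ) - 1 - R) * dx - s), g y ^ 2 := fun i j =>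
    intervalIntegral.integral_interval_sub_left (hg2i _ _) (hg2i _ _)
  have hGM : ∀ i j, G i - G j ≤ ∫ y, g y ^ 2 := by
    intro i j
    rw [hGsub]
    refine (Real.le_norm_self _).trans
      ((intervalIntegral.norm_integral_le_integral_norm_uIoc).trans ?_)
    simp only [Real.norm_eq_abs, abs_sq]
    exact setIntegral_le_integral hg2 (ae_of_all _ fun _ => sq_nonneg _)
  have hterm : ∀ j ∈ Finset.Icc (1 : ℤ) J,
      (cellAverage dx (fun y => iterInt g k (y - (s + lam * a * dx))) j -
          stencil r p c (cellAverage dx fun y => iterInt g k (y - s)) j) ^ 2 ≤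
      (K * dx ^ k) ^ 2 * (N * dx) * (G (j + N) - G j) := by
    intro j _
    set x0 := ((j : ℝ) - 1 - R) * dx - s with hx0
    set x1 := (((j + N : ℤ) : ℝ) - 1 - R) * dx - s with hx1
    have hx01 : x1 - x0 = N * dx := by rw [hx0, hx1]; push_cast; ring
    have hx01' : x0 ≤ x1 := by
      have : 0 ≤ (N : ℝ) * dx := by positivity
      linarith
    have hcont := continuous_iterInt hg k
    have e : cellAverage dx (fun y => iterInt g k (y - (s + lam * a * dx))) j -
          stencil r p c (cellAverage dx fun y => iterInt g k (y - s)) j =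
        cellAverage dx (fun y => iterInt g k ((y - s) - lam * a * dx) -
          ∑ l ∈ Finset.Icc (-(r : ℤ)) (p : ℤ), c l * iterInt g k ((y - s) + l * dx)) j := by
      have h1 : ∀ l ∈ Finset.Icc (-(r : ℤ)) (p : ℤ),
          c l * cellAverage dx (fun y => iterInt g k (y - s)) (j + l) =
          (1 / dx) * ∫ y in (((j : ℝ) - 1) * dx)..((j : ℝ) * dx),
            c l * iterInt g k ((y - s) + l * dx) := by
        intro l _
        rw [cellAverage_add_int, cellAverage, intervalIntegral.integral_const_mul]
        simp only [sub_add_eq_add_sub]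
        ring
      rw [stencil, Finset.sum_congr rfl h1, ← Finset.mul_sum, cellAverage, cellAverage, ← mul_sub,
        ← intervalIntegral.integral_finsetSum
          (fun l _ => Continuous.intervalIntegrable (by fun_prop) _ _),
        ← intervalIntegral.integral_sub (Continuous.intervalIntegrable (by fun_prop) _ _)
          (Continuous.intervalIntegrable (by fun_prop) _ _)]
      simp only [sub_sub]
    have hb : |cellAverage dx (fun y => iterInt g k (y - (s + lam * a * dx))) j -
          stencil r p c (cellAverage dx fun y => iterInt g k (y - s)) j| ≤
        K * dx ^ k * ∫ y in x0..x1, |g y| := by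
      rw [e]
      refine abs_cellAverage_le hdx fun y h1 h2 => (hpt g hg dx hdx (y - s)).trans ?_
      refine mul_le_mul_of_nonneg_left ?_ (by positivity)
      have hp0 : (0 : ℝ) ≤ p := Nat.cast_nonneg _
      have hR0 : (0 : ℝ) ≤ R := Nat.cast_nonneg _
      refine intervalIntegral.integral_mono_interval ?_ ?_ ?_
        (ae_of_all _ fun _ => abs_nonneg _) (hgi _ _).abs
      · rw [hx0]; linarith
      · have : 0 ≤ (R : ℝ) * dx := by positivity
        have : 0 ≤ (p : ℝ) * dx := by positivity
        linarith
      · rw [hx1, hN]; push_cast; linarith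
    have hint0 : 0 ≤ ∫ y in x0..x1, |g y| :=
      intervalIntegral.integral_nonneg hx01' fun _ _ => abs_nonneg _
    have hcs := sq_integral_abs_le hx01' (hgi _ _) (hg2i _ _)
    rw [hx01] at hcs
    rw [hGsub, ← sq_abs]
    calc _ ≤ (K * dx ^ k * ∫ y in x0..x1, |g y|) ^ 2 := pow_le_pow_left₀ (abs_nonneg _) hb 2
      _ = (K * dx ^ k) ^ 2 * (∫ y in x0..x1, |g y|) ^ 2 := by ring
      _ ≤ (K * dx ^ k) ^ 2 * (N * dx * ∫ y in x0..x1, g y ^ 2) := by gcongr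
      _ = _ := by ring
  refine (Finset.sum_le_sum hterm).trans ?_
  rw [← Finset.mul_sum]
  refine (mul_le_mul_of_nonneg_left (sum_sub_shift_le hGM J N) (by positivity)).trans
    (le_of_eq ?_)
  rw [mul_pow, mul_pow, ← pow_mul, mul_comm k 2]; ring

end ConsistencyL2

/-! ### Weak derivatives as iterated primitives -/

section WeakDerivatives

variable {L : ℝ}

lemma integral_primitive_mul_deriv {h φ : ℝ → ℝ}
    (hh : IntervalIntegrable h volume 0 L) (hφ : ContDiff ℝ ∞ φ) (hφL : φ L = 0) :
    ∫ x in (0 : ℝ)..L, (∫ y in (0 : ℝ)..x, h y) * deriv φ x = -∫ x in (0 : ℝ)..L, h x * φ x := by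
  have h1 : AbsolutelyContinuousOnInterval (fun x => ∫ y in (0 : ℝ)..x, h y) 0 L :=
    hh.absolutelyContinuousOnInterval_intervalIntegral (by simp)
  have h2 : AbsolutelyContinuousOnInterval φ 0 L :=
    ((hφ.of_le (by exact_mod_cast le_top)).contDiffOn).absolutelyContinuousOnInterval
  rw [h1.integral_mul_deriv_eq_deriv_mul h2, hφL, intervalIntegral.integral_same, mul_zero,
    zero_mul, sub_zero, zero_sub]
  congr 1
  refine intervalIntegral.integral_congr_ae ?_
  filter_upwards [hh.ae_hasDerivAt_integral] with x hx hxI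
  rw [(hx (uIoc_subset_uIcc hxI) 0 (by simp)).deriv]

lemma IsCompact.exists_Icc_subset_Ioo {K : Set ℝ} {a b : ℝ} (hK : IsCompact K) (hab : a < b)
    (hKab : K ⊆ Ioo a b) : ∃ α β, a < α ∧ β < b ∧ K ⊆ Icc α β := by
  rcases K.eq_empty_or_nonempty with rfl | hne
  -- An empty `K` is given the reversed interval `Icc b a`.
  · exact ⟨b, a, hab, hab, empty_subset _⟩
  · obtain ⟨α, hα, hα'⟩ := hK.exists_isLeast hne
    obtain ⟨β, hβ, hβ'⟩ := hK.exists_isGreatest hne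
    exact ⟨α, β, (hKab hα).1, (hKab hβ).2, fun x hx => ⟨hα' hx, hβ' hx⟩⟩

/-- A test function on `(0, L)` of zero mean is the derivative of a test function. -/
lemma exists_primitive_testFunction {χ : ℝ → ℝ} (hL : 0 < L) (hχ : ContDiff ℝ ∞ χ)
    (hχc : HasCompactSupport χ) (hχL : tsupport χ ⊆ Ioo 0 L) (hχ0 : ∫ x, χ x = 0) :
    ∃ φ : ℝ → ℝ, ContDiff ℝ ∞ φ ∧ HasCompactSupport φ ∧ tsupport φ ⊆ Ioo 0 L ∧ deriv φ = χ := by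
  obtain ⟨α, β, hα, hβ, hαβ⟩ := IsCompact.exists_Icc_subset_Ioo hχc hL hχL
  have hzero : ∀ x, x ∉ Icc α β → χ x = 0 := fun x hx =>
    image_eq_zero_of_notMem_tsupport fun h => hx (hαβ h)
  set φ : ℝ → ℝ := fun x => ∫ y in (0 : ℝ)..x, χ y with hφ
  have hderiv : ∀ x, HasDerivAt φ (χ x) x := fun x =>
    intervalIntegral.integral_hasDerivAt_right (hχ.continuous.intervalIntegrable _ _)
      (hχ.continuous.stronglyMeasurableAtFilter _ _) hχ.continuous.continuousAt
  have hd : deriv φ = χ := funext fun x => (hderiv x).deriv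
  have hφs : ContDiff ℝ ∞ φ := by
    rw [contDiff_infty_iff_deriv]
    exact ⟨fun x => (hderiv x).differentiableAt, by rwa [hd]⟩
  have hsupp : Function.support φ ⊆ Icc α β := by
    intro x hx
    by_contra hxn
    apply hx
    rw [mem_Icc, not_and_or, not_le, not_le] at hxn
    rcases hxn with hxα | hxβ
    · refine (intervalIntegral.integral_congr (g := fun _ => 0) fun y hy => ?_).trans (by simp)
      refine hzero y fun hy' => ?_
      have : y ≤ max 0 x := hy.2
      have : max 0 x < α := max_lt hα hxα
      linarith [hy'.1]
    · rw [← hχ0]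
      refine intervalIntegral.integral_eq_integral_of_support_subset fun y hy => ?_
      have := hαβ (subset_tsupport _ hy)
      exact ⟨hα.trans_le this.1, this.2.trans hxβ.le⟩
  have hts : tsupport φ ⊆ Icc α β := closure_minimal hsupp isClosed_Icc
  exact ⟨φ, hφs, HasCompactSupport.intro isCompact_Icc fun x hx => by
    by_contra h; exact hx (hsupp h), hts.trans fun x hx => ⟨hα.trans_le hx.1, hx.2.trans_lt hβ⟩, hd⟩

lemma setIntegral_mul_testFunction {f ψ : ℝ → ℝ} (hψ : tsupport ψ ⊆ Ioo 0 L) :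
    ∫ x in Ioo 0 L, f x * ψ x = ∫ x, f x * ψ x :=
  setIntegral_eq_integral_of_forall_compl_eq_zero fun x hx => by
    rw [image_eq_zero_of_notMem_tsupport fun h => hx (hψ h), mul_zero]

/-- The lemma of du Bois-Reymond. -/
lemma eqOn_const_of_integral_mul_deriv_eq_zero {D : ℝ → ℝ} (hL : 0 < L)
    (hD : ContinuousOn D (Icc 0 L))
    (h : ∀ φ : ℝ → ℝ, ContDiff ℝ ∞ φ → HasCompactSupport φ → tsupport φ ⊆ Ioo 0 L →
      ∫ x in Ioo 0 L, D x * deriv φ x = 0) :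
    ∃ κ, EqOn D (fun _ => κ) (Icc 0 L) := by
  have hmid : Ioo 0 L ∈ nhds (L / 2) := Ioo_mem_nhds (by linarith) (by linarith)
  -- Subtracting a multiple of the bump `θ` from a test function gives it zero mean, hence makes it
  -- a derivative; `κ` is the `θ`-mean of `D`.
  obtain ⟨θ, hθs, hθc, hθ, hθr, hθ1⟩ := exists_contDiff_tsupport_subset (n := ⊤) hmid
  have hθ' : ContDiff ℝ ∞ θ := hθ
  have hθpos : 0 < ∫ x, θ x :=
    hθ'.continuous.integral_pos_of_hasCompactSupport_nonneg_nonzero hθc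
      (fun x => (hθr (mem_range_self x)).1) (x := L / 2) (by rw [hθ1]; exact one_ne_zero)
  have hDint : ∀ ψ : ℝ → ℝ, Continuous ψ → IntegrableOn (fun x => D x * ψ x) (Ioo 0 L) :=
    fun ψ hψ => ((hD.mul hψ.continuousOn).integrableOn_Icc).mono_set Ioo_subset_Icc_self
  set κ := (∫ x in Ioo 0 L, D x * θ x) / ∫ x, θ x with hκ
  refine ⟨κ, ?_⟩
  have hae : ∀ᵐ x, x ∈ Ioo 0 L → D x - κ = 0 := by
    refine isOpen_Ioo.ae_eq_zero_of_integral_contDiff_smul_eq_zero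
      (((hD.mono Ioo_subset_Icc_self).sub continuousOn_const).locallyIntegrableOn
        measurableSet_Ioo) fun ψ hψ hψc hψs => ?_
    set s := (∫ x, ψ x) / ∫ x, θ x with hs
    have hψi : Integrable ψ := hψ.continuous.integrable_of_hasCompactSupport hψc
    have hθi : Integrable θ := hθ'.continuous.integrable_of_hasCompactSupport hθc
    have hθsc : HasCompactSupport fun x => s * θ x := hθc.mul_left
    have hts : tsupport (fun x => ψ x - s * θ x) ⊆ Ioo 0 L := by
      refine (tsupport_sub ψ (fun x => s * θ x)).trans (union_subset hψs ?_)
      exact (tsupport_mul_subset_right (f := fun _ => s) (g := θ)).trans hθs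
    obtain ⟨φ, hφ, hφc, hφs, hφd⟩ := exists_primitive_testFunction hL
      (χ := fun x => ψ x - s * θ x) (hψ.sub (contDiff_const.mul hθ')) (hψc.sub hθsc) hts (by
        rw [integral_sub hψi (hθi.const_mul _), integral_const_mul, hs]
        field_simp; simp)
    have h0 := h φ hφ hφc hφs
    rw [hφd] at h0
    simp only [mul_sub, mul_left_comm _ s] at h0
    rw [integral_sub (hDint ψ hψ.continuous) ((hDint θ hθ'.continuous).const_mul _),
      integral_const_mul] at h0
    have e1 : ∫ x, ψ x • (D x - κ) = ∫ x in Ioo 0 L, (D x - κ) * ψ x := by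
      rw [setIntegral_mul_testFunction hψs]
      simp only [smul_eq_mul, mul_comm]
    have e2 : ∫ x in Ioo 0 L, κ * ψ x = κ * ∫ x, ψ x := by
      rw [setIntegral_mul_testFunction hψs (f := fun _ => κ), integral_const_mul]
    rw [e1]
    simp only [sub_mul]
    rw [integral_sub (hDint ψ hψ.continuous) (hψi.integrableOn.const_mul _), e2]
    have e3 : κ * ∫ x, ψ x = s * ∫ x in Ioo 0 L, D x * θ x := by rw [hκ, hs]; ring
    rw [e3]; exact h0
  refine Measure.eqOn_Icc_of_ae_eq volume hL.ne ?_ hD continuousOn_const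
  rw [← restrict_Ioo_eq_restrict_Icc]
  exact (ae_restrict_iff' measurableSet_Ioo).2 (hae.mono fun x hx hxm => sub_eq_zero.1 (hx hxm))

/-- A continuous representative of a weak derivative is the primitive of the next one. -/
lemma IsWeakDeriv.eq_integral {u w w' v : ℝ → ℝ} {m : ℕ} (hL : 0 < L) (hw : IsWeakDeriv L m u w)
    (hw' : IsWeakDeriv L (m + 1) u w') (hwi : IntegrableOn w' (Ioo 0 L))
    (hv : ContinuousOn v (Icc 0 L)) (hvw : v =ᵐ[volume.restrict (Ioo 0 L)] w) (hv0 : v 0 = 0) :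
    ∀ x ∈ Icc 0 L, v x = ∫ y in (0 : ℝ)..x, w' y := by
  have hwii : IntervalIntegrable w' volume 0 L := by
    rw [intervalIntegrable_iff_integrableOn_Ioo_of_le hL.le]; exact hwi
  set F : ℝ → ℝ := fun x => ∫ y in (0 : ℝ)..x, w' y with hF
  have hFc : ContinuousOn F (Icc 0 L) := by
    have := (hwii.absolutelyContinuousOnInterval_intervalIntegral (c := 0) (by simp)).continuousOn
    rwa [uIcc_of_le hL.le] at this
  have hint : ∀ f ψ : ℝ → ℝ, ContinuousOn f (Icc 0 L) → Continuous ψ →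
      IntegrableOn (fun x => f x * ψ x) (Ioo 0 L) := fun f ψ hf hψ =>
    ((hf.mul hψ.continuousOn).integrableOn_Icc).mono_set Ioo_subset_Icc_self
  -- `v` and `F` have the same weak derivative `w'`, so they differ by a constant, and both vanish
  -- at `0`.
  obtain ⟨κ, hκ⟩ := eqOn_const_of_integral_mul_deriv_eq_zero hL (hv.sub hFc)
    fun φ hφ hφc hφs => by
      have hφd : ContDiff ℝ ∞ (deriv φ) := (contDiff_infty_iff_deriv.1 hφ).2
      have h1 := hw (deriv φ) hφd hφc.deriv (tsupport_deriv_subset.trans hφs)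
      have h2 := hw' φ hφ hφc hφs
      rw [← iteratedDeriv_succ', h2, pow_succ] at h1
      have h3 : ∫ x in Ioo 0 L, w x * deriv φ x = -∫ x in Ioo 0 L, w' x * φ x := by
        have hne : ((-1 : ℝ)) ^ m ≠ 0 := pow_ne_zero _ (by norm_num)
        apply mul_left_cancel₀ hne
        rw [← h1]; ring
      have hφL : φ L = 0 := image_eq_zero_of_notMem_tsupport fun h => (lt_irrefl _ (hφs h).2)
      have h4 := integral_primitive_mul_deriv hwii hφ hφL
      rw [intervalIntegral.integral_of_le hL.le, intervalIntegral.integral_of_le hL.le,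
        integral_Ioc_eq_integral_Ioo, integral_Ioc_eq_integral_Ioo] at h4
      have h5 : ∫ x in Ioo 0 L, v x * deriv φ x = ∫ x in Ioo 0 L, w x * deriv φ x :=
        integral_congr_ae (hvw.mono fun x hx => by simp only [hx])
      simp only [Pi.sub_apply, sub_mul]
      rw [integral_sub (hint v _ hv hφd.continuous) (hint F _ hFc hφd.continuous), h5, h3, h4]
      ring
  intro x hx
  have h0 := hκ (left_mem_Icc.2 hL.le)
  have h1 := hκ hx
  simp only [Pi.sub_apply, hv0, hF, intervalIntegral.integral_same] at h0 h1
  linarith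

/-- Needed because `weakDeriv L 0 u` is a chosen witness and not `u` itself. -/
lemma IsWeakDeriv.ae_eq {u w : ℝ → ℝ} (hu : IntegrableOn u (Ioo 0 L))
    (hwi : IntegrableOn w (Ioo 0 L)) (hw : IsWeakDeriv L 0 u w) :
    u =ᵐ[volume.restrict (Ioo 0 L)] w := by
  have hae : ∀ᵐ x, x ∈ Ioo 0 L → u x - w x = 0 := by
    refine isOpen_Ioo.ae_eq_zero_of_integral_contDiff_smul_eq_zero
      (hu.sub hwi).locallyIntegrableOn fun ψ hψ hψc hψs => ?_
    have h1 := hw ψ hψ hψc hψs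
    simp only [iteratedDeriv_zero, pow_zero, one_mul] at h1
    have e1 : ∫ x, ψ x • (u x - w x) = ∫ x in Ioo 0 L, (u x - w x) * ψ x := by
      rw [setIntegral_mul_testFunction hψs]
      simp only [smul_eq_mul, mul_comm]
    obtain ⟨B, hB⟩ := hψc.exists_bound_of_continuous hψ.continuous
    have hint : ∀ f : ℝ → ℝ, IntegrableOn f (Ioo 0 L) →
        IntegrableOn (fun x => f x * ψ x) (Ioo 0 L) := fun f hf =>
      hf.mul_bdd hψ.continuous.aestronglyMeasurable (ae_of_all _ hB)
    rw [e1]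
    simp only [sub_mul]
    rw [integral_sub (hint u hu) (hint w hwi), h1, sub_self]
  exact (ae_restrict_iff' measurableSet_Ioo).2 (hae.mono fun x hx hxm => sub_eq_zero.1 (hx hxm))

lemma MemH.weakDeriv_spec {s m : ℕ} {u : ℝ → ℝ} (hu : MemH s L u) (hm : m ≤ s) :
    MemLp (weakDeriv L m u) 2 (volume.restrict (Ioo 0 L)) ∧
      IsWeakDeriv L m u (weakDeriv L m u) := by
  have h := hu.2 m hm
  rw [weakDeriv, dif_pos h]
  exact h.choose_spec

lemma integrableOn_of_memLp_two {f : ℝ → ℝ} (hf : MemLp f 2 (volume.restrict (Ioo 0 L))) :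
    IntegrableOn f (Ioo 0 L) :=
  hf.integrable (by norm_num)

lemma intervalIntegral_congr_of_ae_Ioo {f h : ℝ → ℝ} {x : ℝ} (hx : x ∈ Icc 0 L)
    (hfh : f =ᵐ[volume.restrict (Ioo 0 L)] h) :
    ∫ y in (0 : ℝ)..x, f y = ∫ y in (0 : ℝ)..x, h y := by
  rw [intervalIntegral.integral_of_le hx.1, intervalIntegral.integral_of_le hx.1,
    integral_Ioc_eq_integral_Ioo, integral_Ioc_eq_integral_Ioo]
  exact integral_congr_ae (ae_restrict_of_ae_restrict_of_subset (Ioo_subset_Ioo_right hx.2) hfh)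

lemma setIntegral_weakDeriv_sq_le_normH_sq {s m : ℕ} (u : ℝ → ℝ) (hm : m ≤ s) :
    ∫ x in Ioo 0 L, weakDeriv L m u x ^ 2 ≤ normH s L u ^ 2 := by
  have h0 : ∀ i ∈ Finset.range (s + 1), 0 ≤ ∫ x in Ioo 0 L, weakDeriv L i u x ^ 2 :=
    fun i _ => integral_nonneg fun _ => sq_nonneg _
  rw [normH, Real.sq_sqrt (Finset.sum_nonneg h0)]
  exact Finset.single_le_sum (f := fun i => ∫ x in Ioo 0 L, weakDeriv L i u x ^ 2) h0
    (Finset.mem_range.2 (by omega))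

/-- A Sobolev function whose derivatives vanish at `0` is an iterated primitive. -/
lemma exists_iterInt_representation {k : ℕ} {u : ℝ → ℝ} (hL : 0 < L) (hu : MemH (k + 1) L u)
    (hu0 : ∀ m ≤ k, DerivVanishesAtZero L m u) :
    ∃ g : ℝ → ℝ, Integrable g ∧ Integrable (fun x => g x ^ 2) ∧ (∀ x ≤ 0, g x = 0) ∧
      (∀ x, L ≤ x → g x = 0) ∧ ∫ x, g x ^ 2 ≤ normH (k + 1) L u ^ 2 ∧
      (∀ j ≤ k, ∫ x in (0 : ℝ)..L, iterInt g j x ^ 2 ≤ normH (k + 1) L u ^ 2) ∧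
      u =ᵐ[volume.restrict (Ioo 0 L)] iterInt g k := by
  set w := fun m => weakDeriv L m u with hw
  have hspec : ∀ m ≤ k + 1, MemLp (w m) 2 (volume.restrict (Ioo 0 L)) ∧ IsWeakDeriv L m u (w m) :=
    fun m hm => hu.weakDeriv_spec hm
  have hint : ∀ m ≤ k + 1, IntegrableOn (w m) (Ioo 0 L) := fun m hm =>
    integrableOn_of_memLp_two (hspec m hm).1
  -- Being zero beyond `L` too, `g` has primitives that continue those of `u` past the right end and
  -- provide exact values on the ghost cells.
  set g := (Ioo 0 L).indicator (w (k + 1)) with hg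
  have hg2 : (fun x => g x ^ 2) = (Ioo 0 L).indicator (fun x => w (k + 1) x ^ 2) := by
    funext x
    by_cases hx : x ∈ Ioo 0 L
    · simp only [hg, indicator_of_mem hx]
    · simp only [hg, indicator_of_notMem hx]; norm_num
  have hgw : g =ᵐ[volume.restrict (Ioo 0 L)] w (k + 1) :=
    (ae_restrict_iff' measurableSet_Ioo).2 (ae_of_all _ fun x hx => indicator_of_mem hx _)
  -- The order of the derivative descends from `k`: each continuous representative is the primitive
  -- of the previous one.
  have hrep : ∀ d ≤ k, w (k - d) =ᵐ[volume.restrict (Ioo 0 L)] iterInt g d := by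
    intro d
    induction d with
    | zero =>
      intro _
      obtain ⟨v, hv, hvw, hv0⟩ := hu0 k le_rfl
      have h1 := (hspec k (by omega)).2.eq_integral hL (hspec (k + 1) le_rfl).2
        (hint _ le_rfl) hv hvw hv0
      refine hvw.symm.trans ((ae_restrict_iff' measurableSet_Ioo).2 (ae_of_all _ fun x hx => ?_))
      rw [h1 x (Ioo_subset_Icc_self hx)]
      exact intervalIntegral_congr_of_ae_Ioo (Ioo_subset_Icc_self hx) hgw.symm
    | succ d ih =>
      intro hd
      have ih := ih (by omega)
      obtain ⟨v, hv, hvw, hv0⟩ := hu0 (k - (d + 1)) (by omega)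
      have hkd : k - d = k - (d + 1) + 1 := by omega
      rw [hkd] at ih
      have h1 := (hspec (k - (d + 1)) (by omega)).2.eq_integral hL
        (hspec (k - (d + 1) + 1) (by omega)).2 (hint _ (by omega)) hv hvw hv0
      refine hvw.symm.trans ((ae_restrict_iff' measurableSet_Ioo).2 (ae_of_all _ fun x hx => ?_))
      rw [h1 x (Ioo_subset_Icc_self hx)]
      exact intervalIntegral_congr_of_ae_Ioo (Ioo_subset_Icc_self hx) ih
  refine ⟨g, (integrable_indicator_iff measurableSet_Ioo).2 (hint _ le_rfl), ?_,
    fun x hx => indicator_of_notMem (fun h => by linarith [h.1]) _,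
    fun x hx => indicator_of_notMem (fun h => by linarith [h.2]) _, ?_, fun j hj => ?_, ?_⟩
  · rw [hg2]
    exact (integrable_indicator_iff measurableSet_Ioo).2 (hspec _ le_rfl).1.integrable_sq
  · rw [hg2, integral_indicator measurableSet_Ioo]
    exact setIntegral_weakDeriv_sq_le_normH_sq u le_rfl
  · rw [intervalIntegral.integral_of_le hL.le, integral_Ioc_eq_integral_Ioo]
    refine le_trans (le_of_eq ?_) (setIntegral_weakDeriv_sq_le_normH_sq u
      (by omega : k - j ≤ k + 1))
    exact integral_congr_ae ((hrep j hj).mono fun x hx => by simp only [← hx, hw])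
  · have h1 := hrep k le_rfl
    rw [Nat.sub_self] at h1
    exact ((hspec 0 (by omega)).2.ae_eq (integrableOn_of_memLp_two hu.1) (hint 0 (by omega))).trans
      h1

end WeakDerivatives

/-! ### Uniform bounds independent of the length -/

section Sobolev

/-- Since `1 ≤ L`, some unit interval inside `[0, L]` contains `x`. There the minimum of `f ^ 2` is
at most its mean, so at most `H ^ 2`, and by Cauchy–Schwarz `f` varies by at most `H`. -/
lemma abs_le_two_mul_of_integral_sq_le {L H x : ℝ} {f h : ℝ → ℝ} (hL : 1 ≤ L) (hH : 0 ≤ H)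
    (hf : Continuous f) (hh : Integrable h) (hh2 : Integrable fun x => h x ^ 2)
    (hfh : ∀ x y, 0 ≤ x → x ≤ y → y ≤ L → f y - f x = ∫ t in x..y, h t)
    (hf2 : ∫ t in (0 : ℝ)..L, f t ^ 2 ≤ H ^ 2) (hhH : ∫ t, h t ^ 2 ≤ H ^ 2)
    (hx : x ∈ Icc 0 L) : |f x| ≤ 2 * H := by
  obtain ⟨x0, h0, h1, hxx⟩ : ∃ x0, 0 ≤ x0 ∧ x0 + 1 ≤ L ∧ x ∈ Icc x0 (x0 + 1) := by
    rcases le_total x (L - 1) with h | h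
    · exact ⟨x, hx.1, by linarith, by simp⟩
    · exact ⟨L - 1, by linarith, by linarith, h, by linarith [hx.2]⟩
  have hf2c : Continuous fun t => f t ^ 2 := hf.pow 2
  obtain ⟨y, hy, hmin⟩ := (isCompact_Icc (a := x0) (b := x0 + 1)).exists_isMinOn
    (nonempty_Icc.2 (by linarith)) hf2c.continuousOn
  have hyH : f y ^ 2 ≤ H ^ 2 := by
    calc f y ^ 2 = ∫ t in x0..(x0 + 1), f y ^ 2 := by simp
      _ ≤ ∫ t in x0..(x0 + 1), f t ^ 2 :=
        intervalIntegral.integral_mono_on (by linarith) intervalIntegrable_const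
          (hf2c.intervalIntegrable _ _) fun t ht => hmin ht
      _ ≤ ∫ t in (0 : ℝ)..L, f t ^ 2 :=
        intervalIntegral.integral_mono_interval h0 (by linarith) h1
          (ae_of_all _ fun _ => sq_nonneg _) (hf2c.intervalIntegrable _ _)
      _ ≤ H ^ 2 := hf2
  have hyH' : |f y| ≤ H := abs_le_of_sq_le_sq hyH hH
  have hdiff : ∀ s t, s ∈ Icc x0 (x0 + 1) → t ∈ Icc x0 (x0 + 1) → s ≤ t → |f t - f s| ≤ H := by
    intro s t hs ht hst
    rw [hfh s t (by linarith [hs.1]) hst (by linarith [ht.2])]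
    refine (intervalIntegral.abs_integral_le_integral_abs hst).trans ?_
    refine le_of_sq_le_sq ?_ hH
    refine (sq_integral_abs_le hst hh.intervalIntegrable hh2.intervalIntegrable).trans ?_
    have h2 : 0 ≤ ∫ t in s..t, h t ^ 2 := intervalIntegral.integral_nonneg hst fun _ _ => sq_nonneg _
    refine (mul_le_of_le_one_left h2 (by linarith [hs.1, ht.2])).trans (le_trans ?_ hhH)
    rw [intervalIntegral.integral_of_le hst]
    exact setIntegral_le_integral hh2 (ae_of_all _ fun _ => sq_nonneg _)
  have hxy : |f x - f y| ≤ H := by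
    rcases le_total x y with h | h
    · rw [abs_sub_comm]; exact hdiff x y hxx hy h
    · exact hdiff y x hy hxx h
  have := abs_sub_abs_le_abs_sub (f x) (f y)
  linarith

/-- Uniform bound of the iterated primitives, also slightly beyond `L`. -/
lemma abs_iterInt_le {L H : ℝ} {g : ℝ → ℝ} {k p : ℕ} (hL : 1 ≤ L) (hH : 0 ≤ H) (hg : Integrable g)
    (hg2 : Integrable fun x => g x ^ 2) (hg0 : ∀ x ≤ 0, g x = 0) (hgL : ∀ x, L ≤ x → g x = 0)
    (hgH : ∫ x, g x ^ 2 ≤ H ^ 2) (hI : ∀ j ≤ k, ∫ x in (0 : ℝ)..L, iterInt g j x ^ 2 ≤ H ^ 2)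
    (j : ℕ) (hj : j ≤ k) : ∀ y ≤ L + p, |iterInt g j y| ≤ 2 * H * (1 + p) ^ j := by
  have hL0 : 0 ≤ L := by linarith
  have hin : ∀ i ≤ k, ∀ x ∈ Icc 0 L, |iterInt g i x| ≤ 2 * H := by
    intro i hi x hx
    rcases i with _ | i
    · exact abs_le_two_mul_of_integral_sq_le hL hH (continuous_iterInt hg 0) hg hg2
        (fun x y _ _ _ => iterInt_zero_sub hg x y) (hI 0 hi) hgH hx
    · have hc := continuous_iterInt hg i
      set h := (Ioc 0 L).indicator (iterInt g i) with hh
      have hsq : (fun x => h x ^ 2) = (Ioc 0 L).indicator fun x => iterInt g i x ^ 2 := by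
        funext x
        by_cases hx : x ∈ Ioc 0 L
        · simp only [hh, indicator_of_mem hx]
        · simp only [hh, indicator_of_notMem hx]; norm_num
      refine abs_le_two_mul_of_integral_sq_le (h := h) hL hH (continuous_iterInt hg (i + 1)) ?_ ?_
        ?_ (hI _ hi) ?_ hx
      · exact (integrable_indicator_iff measurableSet_Ioc).2 hc.integrableOn_Ioc
      · rw [hsq]
        exact (integrable_indicator_iff measurableSet_Ioc).2 (hc.pow 2).integrableOn_Ioc
      · intro x y hx hxy hy
        rw [iterInt_succ_sub hg, intervalIntegral.integral_of_le hxy,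
          intervalIntegral.integral_of_le hxy]
        refine setIntegral_congr_fun measurableSet_Ioc fun t ht => ?_
        have htm : t ∈ Ioc 0 L := ⟨by linarith [ht.1], by linarith [ht.2]⟩
        rw [hh, indicator_of_mem htm]
      · rw [hsq, integral_indicator measurableSet_Ioc, ← intervalIntegral.integral_of_le hL0]
        exact hI i (by omega)
  have hp : (0 : ℝ) ≤ p := Nat.cast_nonneg _
  have h1p : ∀ i : ℕ, 2 * H ≤ 2 * H * (1 + p) ^ i := fun i =>
    le_mul_of_one_le_right (by positivity) (one_le_pow₀ (by linarith))
  -- Past `L` the first primitive is constant, since `g` vanishes there; each further integration,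
  -- over a length at most `p`, costs at most a factor `1 + p`.
  induction j with
  | zero =>
    intro y hy
    rcases le_total y 0 with h0 | h0
    · rw [iterInt_eq_zero hg0 _ _ h0, abs_zero]; positivity
    rcases le_total y L with h | h
    · exact (hin 0 hj y ⟨h0, h⟩).trans (h1p 0)
    · have : iterInt g 0 y - iterInt g 0 L = 0 := by
        rw [iterInt_zero_sub hg]
        refine (intervalIntegral.integral_congr (g := fun _ => 0) fun t ht => ?_).trans (by simp)
        rw [uIcc_of_le h] at ht
        exact hgL t ht.1
      rw [sub_eq_zero.1 this]
      exact (hin 0 hj L ⟨hL0, le_rfl⟩).trans (h1p 0)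
  | succ j ih =>
    intro y hy
    rcases le_total y 0 with h0 | h0
    · rw [iterInt_eq_zero hg0 _ _ h0, abs_zero]; positivity
    rcases le_total y L with h | h
    · exact (hin _ hj y ⟨h0, h⟩).trans (h1p _)
    · have ih := ih (by omega)
      have h2 : |iterInt g (j + 1) y - iterInt g (j + 1) L| ≤ 2 * H * (1 + p) ^ j * p := by
        rw [iterInt_succ_sub hg, ← Real.norm_eq_abs]
        refine (intervalIntegral.norm_integral_le_of_norm_le_const
          (C := 2 * H * (1 + p) ^ j) fun t ht => ?_).trans ?_
        · rw [uIoc_of_le h] at ht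
          exact ih t (ht.2.trans hy)
        · rw [abs_of_nonneg (by linarith)]
          gcongr; linarith
      have h3 := hin (j + 1) hj L ⟨hL0, le_rfl⟩
      have h4 := abs_sub_abs_le_abs_sub (iterInt g (j + 1) y) (iterInt g (j + 1) L)
      have h5 : 2 * H * (1 + p) ^ (j + 1) = 2 * H * (1 + p) ^ j + 2 * H * (1 + p) ^ j * p := by ring
      linarith [h1p j]

end Sobolev

/-! ### Error estimates on coarse and fine grids -/

section Convergence

variable {a lam : ℝ} {r p k kb : ℕ} {c : ℤ → ℝ}

lemma rpow_sub_half {x : ℝ} (hx : 0 < x) (q : ℕ) :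
    x ^ ((q : ℝ) - 1 / 2) = x ^ q / Real.sqrt x := by
  rw [Real.rpow_sub hx, Real.rpow_natCast, Real.sqrt_eq_rpow]

lemma sq_cellAverage_le {dx : ℝ} (hdx : 0 < dx) {f : ℝ → ℝ} (hf : Continuous f) (j : ℤ) :
    cellAverage dx f j ^ 2 ≤
      (1 / dx) * ∫ y in (((j : ℝ) - 1) * dx)..((j : ℝ) * dx), f y ^ 2 := by
  have hle : ((j : ℝ) - 1) * dx ≤ j * dx := by nlinarith
  have h1 := sq_integral_abs_le hle (hf.intervalIntegrable _ _) ((hf.pow 2).intervalIntegrable _ _)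
  rw [show (j : ℝ) * dx - ((j : ℝ) - 1) * dx = dx by ring] at h1
  have h2 := pow_le_pow_left₀ (abs_nonneg _)
    (intervalIntegral.abs_integral_le_integral_abs (f := f) (μ := volume) hle) 2
  rw [sq_abs] at h2
  rw [cellAverage, mul_pow]
  calc (1 / dx) ^ 2 * (∫ y in (((j : ℝ) - 1) * dx)..((j : ℝ) * dx), f y) ^ 2
      ≤ (1 / dx) ^ 2 * (dx * ∫ y in (((j : ℝ) - 1) * dx)..((j : ℝ) * dx), f y ^ 2) := by
        gcongr; exact h2.trans h1
    _ = _ := by field_simp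

lemma cellAverage_congr_ae {dx : ℝ} {f h : ℝ → ℝ} {j : ℤ} (hdx : 0 < dx)
    (H : ∀ᵐ y, ((j : ℝ) - 1) * dx < y → y ≤ j * dx → f y = h y) :
    cellAverage dx f j = cellAverage dx h j := by
  have hle : ((j : ℝ) - 1) * dx ≤ j * dx := by nlinarith
  rw [cellAverage, cellAverage]
  congr 1
  refine intervalIntegral.integral_congr_ae ?_
  filter_upwards [H] with y hy hyI
  rw [uIoc_of_le hle] at hyI
  exact hy hyI.1 hyI.2

lemma sq_le_energy {J : ℕ} (v : ℤ → ℝ) {j : ℤ} (h1 : 1 ≤ j) (h2 : j ≤ J) :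
    v j ^ 2 ≤ energy J v :=
  Finset.single_le_sum (f := fun j => v j ^ 2) (fun _ _ => sq_nonneg _)
    (Finset.mem_Icc.2 ⟨h1, h2⟩)

lemma IsSchemeSolution.isPerturbedSolution {J : ℕ} {dx : ℝ} {u₀ : ℝ → ℝ} {u : ℕ → ℤ → ℝ}
    (hu : IsSchemeSolution r p kb c J dx u₀ u) : IsPerturbedSolution r p kb c J 0 0 u where
  dirichlet n j hj := hu.dirichlet n j hj
  outflow n l h1 h2 := by rw [hu.neumann n l h1 h2, abs_zero]
  interior n := by
    rw [zero_pow two_ne_zero]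
    refine (Finset.sum_eq_zero fun j hj => ?_).le
    rw [Finset.mem_Icc] at hj
    rw [hu.interior n j hj.1 hj.2, stencil, sub_self]; norm_num

/-- On a coarse grid both the solution and the exact averages obey the bound. -/
lemma exists_coarse_bound (ha : 0 < a) (hlam : 0 < lam) (hk : 1 ≤ k)
    (hc : SchemeAssumption a lam r p k c) (kb : ℕ) :
    ∃ C : ℝ, 0 < C ∧ ∀ (J : ℕ) (L dx H : ℝ) (f u₀ : ℝ → ℝ) (u : ℕ → ℤ → ℝ), 1 ≤ J → 0 < dx →
      0 ≤ H → J * dx = L → Continuous f → (∀ x ≤ 0, f x = 0) →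
      ∫ x in (0 : ℝ)..L, f x ^ 2 ≤ H ^ 2 → IsSchemeSolution r p kb c J dx u₀ u →
      (∀ j : ℤ, 1 ≤ j → j ≤ J → u 0 j = cellAverage dx f j) →
      ∀ n : ℕ, 1 ≤ n → ∀ s : ℝ, 0 ≤ s → ∀ j : ℤ, 1 ≤ j → j ≤ J →
      |u n j - cellAverage dx (fun y => f (y - s)) j| ≤
        C * Real.exp (C * (n / J)) * (H / Real.sqrt dx) := by
  obtain ⟨C, hC, hstab⟩ := exists_stability ha hlam hk hc kb
  refine ⟨C + 2, by positivity, fun J L dx H f u₀ u hJ hdx hH hL hf hf0 hfH hu hu0 n hn s hs j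
    hj1 hj2 => ?_⟩
  have hf2 : Continuous fun y => f y ^ 2 := hf.pow 2
  set E := Real.exp (C * (n / J)) with hE
  have hE1 : 1 ≤ E := Real.one_le_exp (by positivity)
  set q := H / Real.sqrt dx with hq
  have hq0 : 0 ≤ q := by positivity
  have hq2 : q ^ 2 = 1 / dx * H ^ 2 := by
    rw [hq, div_pow, Real.sq_sqrt hdx.le]; ring
  have hstab := hstab J 0 0 u hJ le_rfl hu.isPerturbedSolution n hn
  have h0 : energy J (u 0) ≤ q ^ 2 := by
    have h1 : ∀ j ∈ Finset.Icc (1 : ℤ) J, u 0 j ^ 2 ≤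
        (1 / dx) * ∫ y in (((j : ℝ) - 1) * dx)..((j : ℝ) * dx), f y ^ 2 := by
      intro j hj
      rw [Finset.mem_Icc] at hj
      rw [hu0 j hj.1 hj.2]
      exact sq_cellAverage_le hdx hf j
    refine (Finset.sum_le_sum h1).trans ?_
    rw [← Finset.mul_sum, sum_Icc_one, hq2]
    refine mul_le_mul_of_nonneg_left (le_trans (le_of_eq ?_) hfH) (by positivity)
    have h2 := intervalIntegral.sum_integral_adjacent_intervals (μ := volume)
      (f := fun y => f y ^ 2) (a := fun i : ℕ => (i : ℝ) * dx) (n := J)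
      fun i _ => hf2.intervalIntegrable _ _
    rw [Nat.cast_zero, zero_mul, hL] at h2
    rw [← h2]
    refine Finset.sum_congr rfl fun i _ => ?_
    push_cast
    rw [add_sub_cancel_right]
  have hu1 : |u n j| ≤ (C + 1) * E * q := by
    refine abs_le_of_sq_le_sq ?_ (by positivity)
    have h1 := sq_le_energy (u n) hj1 hj2
    calc u n j ^ 2 ≤ C * E * q ^ 2 := by
          refine h1.trans (hstab.trans ?_)
          gcongr
          simpa using h0
      _ ≤ (C + 1) ^ 2 * E ^ 2 * q ^ 2 := by
          gcongr
          · nlinarith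
          · exact le_self_pow₀ hE1 two_ne_zero
      _ = ((C + 1) * E * q) ^ 2 := by ring
  have hv : |cellAverage dx (fun y => f (y - s)) j| ≤ q := by
    refine abs_le_of_sq_le_sq ?_ hq0
    refine (sq_cellAverage_le hdx (by fun_prop : Continuous fun y => f (y - s)) j).trans ?_
    rw [hq2]
    refine mul_le_mul_of_nonneg_left (le_trans ?_ hfH) (by positivity)
    rw [intervalIntegral.integral_comp_sub_right (fun y => f y ^ 2)]
    set x0 := ((j : ℝ) - 1) * dx - s
    set x1 := (j : ℝ) * dx - s
    have hx01 : x0 ≤ x1 := by simp only [x0, x1]; nlinarith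
    have hx1 : x1 ≤ L := by
      have : (j : ℝ) ≤ J := by exact_mod_cast hj2
      have : (j : ℝ) * dx ≤ J * dx := by gcongr
      simp only [x1]; linarith
    have h1 : ∫ y in x0..x1, f y ^ 2 ≤ ∫ y in (min x0 0)..L, f y ^ 2 :=
      intervalIntegral.integral_mono_interval (min_le_left _ _) hx01 hx1
        (ae_of_all _ fun _ => sq_nonneg _) (hf2.intervalIntegrable _ _)
    have h2 : ∫ y in (min x0 0)..(0 : ℝ), f y ^ 2 = 0 := by
      refine (intervalIntegral.integral_congr (g := fun _ => 0) fun y hy => ?_).trans (by simp)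
      rw [uIcc_of_le (min_le_right _ _)] at hy
      simp only [hf0 y hy.2]; norm_num
    have h3 := intervalIntegral.integral_add_adjacent_intervals (μ := volume)
      (hf2.intervalIntegrable (min x0 0) 0) (hf2.intervalIntegrable 0 L)
    linarith
  have hEE : E ≤ Real.exp ((C + 2) * (n / J)) := by
    apply Real.exp_le_exp.2; gcongr; linarith
  calc |u n j - cellAverage dx (fun y => f (y - s)) j|
      ≤ |u n j| + |cellAverage dx (fun y => f (y - s)) j| := abs_sub _ _
    _ ≤ (C + 1) * E * q + 1 * q := by linarith
    _ ≤ (C + 1) * E * q + E * q := by gcongr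
    _ = (C + 2) * E * q := by ring
    _ ≤ _ := by gcongr

/-- Error estimate on a fine grid. -/
lemma exists_fine_bound (ha : 0 < a) (hlam : 0 < lam) (hk : 1 ≤ k)
    (hc : SchemeAssumption a lam r p k c) (kb : ℕ) :
    ∃ C : ℝ, 0 < C ∧ ∀ (J : ℕ) (L dx dt H : ℝ) (g u₀ : ℝ → ℝ) (u : ℕ → ℤ → ℝ), 1 ≤ J → 0 < dx →
      dx ≤ 1 → 1 ≤ L → 0 ≤ H → J * dx = L → dt = lam * dx → Integrable g →
      Integrable (fun x => g x ^ 2) → (∀ x ≤ 0, g x = 0) → (∀ x, L ≤ x → g x = 0) →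
      ∫ x, g x ^ 2 ≤ H ^ 2 → (∀ j ≤ k, ∫ x in (0 : ℝ)..L, iterInt g j x ^ 2 ≤ H ^ 2) →
      IsSchemeSolution r p kb c J dx u₀ u →
      (∀ j : ℤ, 1 ≤ j → j ≤ J → u 0 j = cellAverage dx (iterInt g k) j) →
      ∀ n : ℕ, 1 ≤ n → ∀ j : ℤ, 1 ≤ j → j ≤ J →
      |u n j - cellAverage dx (fun y => iterInt g k (y - a * (n * dt))) j| ≤
        C * Real.exp (C * (n / J)) *
          ((n * Real.sqrt dx + Real.sqrt n) * dx ^ min k kb * H) := by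
  obtain ⟨C, hC, hstab⟩ := exists_stability ha hlam hk hc kb
  obtain ⟨K, hK, hcons⟩ := exists_consistency hc ha hlam
  set q := min k kb with hq
  have hqk : q ≤ k := min_le_left _ _
  have hqb : q ≤ kb := min_le_right _ _
  -- Only `q` of the `kb` differences gain a factor `dx`, starting the chain of primitives at
  -- `iterInt g (k - q)`; each of the others costs a factor `2`.
  set M : ℝ := 2 ^ (kb - q) * (2 * (1 + p) ^ (k - q)) with hM
  refine ⟨(C + 1) * (K + M + 1), by positivity, fun J L dx dt H g u₀ u hJ hdx hdx1 hL hH hJL hdt hg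
    hg2 hg0 hgL hgH hI hu hu0 n hn j hj1 hj2 => ?_⟩
  set W : ℕ → ℤ → ℝ := fun n => cellAverage dx fun y => iterInt g k (y - a * (n * dt)) with hW
  have hs : ∀ n : ℕ, 0 ≤ a * (n * dt) := fun n => by rw [hdt]; positivity
  set γ : ℝ := M * dx ^ q * H with hγ
  set ε : ℝ := K * dx ^ k * Real.sqrt dx * H with hε
  have hpert : IsPerturbedSolution r p kb c J ε γ (fun n j => u n j - W n j) := by
    refine ⟨fun n j hj => ?_, fun n l h1 h2 => ?_, fun n => ?_⟩
    · have h1 : |W n j| ≤ 0 := abs_cellAverage_le hdx fun y _ hy => by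
        have hj' : (j : ℝ) ≤ 0 := by exact_mod_cast hj
        rw [iterInt_eq_zero hg0 k _ (by nlinarith [hs n]), abs_zero]
      rw [hu.dirichlet n j hj, abs_nonpos_iff.1 h1, sub_zero]
    · have hsub := congrFun (backDiff_iterate_sub (u n) (W n) kb) (J + l)
      rw [hsub, hu.neumann n l h1 h2, zero_sub, abs_neg]
      have hkq : kb = (kb - q) + q := by omega
      rw [hkq, Function.iterate_add_apply]
      have h3 : ∀ i ≤ (J : ℤ) + l, |backDiff^[q] (W n) i| ≤
          dx ^ q * (2 * H * (1 + p) ^ (k - q)) := by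
        intro i hi
        have hF := abs_backDiff_iterate_cellAverage_le hdx q
          (fun i y => iterInt g (k - q + i) (y - a * (n * dt)))
          (B := 2 * H * (1 + p) ^ (k - q)) (X := L + p)
          (fun i => (continuous_iterInt hg _).comp (by fun_prop)) (fun i x y => by
            rw [intervalIntegral.integral_comp_sub_right (fun y => iterInt g (k - q + i) y),
              ← iterInt_succ_sub hg]
            rfl) (fun y hy => abs_iterInt_le hL hH hg hg2 hg0 hgL hgH hI (k - q) (by omega) _
            (by linarith [hs n])) i (by
            have : (i : ℝ) ≤ J + p := by exact_mod_cast (by omega : i ≤ (J : ℤ) + p)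
            have h5 : (i : ℝ) * dx ≤ (J + p) * dx := by gcongr
            have h6 : (p : ℝ) * dx ≤ p := mul_le_of_le_one_right (Nat.cast_nonneg _) hdx1
            linarith)
        simp only [Nat.sub_add_cancel hqk] at hF
        exact hF
      refine (abs_backDiff_iterate_le (kb - q) h3).trans (le_of_eq ?_)
      rw [hγ, hM]; ring
    · have h1 := hcons g hg hg2 dx hdx J (a * (n * dt))
      have h2 : ∑ j ∈ Finset.Icc (1 : ℤ) J, (u (n + 1) j - W (n + 1) j -
          stencil r p c (fun j => u n j - W n j) j) ^ 2 =
          ∑ j ∈ Finset.Icc (1 : ℤ) J,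
        (cellAverage dx (fun y => iterInt g k (y - (a * (n * dt) + lam * a * dx))) j -
          stencil r p c (cellAverage dx fun y => iterInt g k (y - a * (n * dt))) j) ^ 2 := by
        refine Finset.sum_congr rfl fun j hj => ?_
        rw [Finset.mem_Icc] at hj
        have e1 : a * (((n + 1 : ℕ) : ℝ) * dt) = a * (n * dt) + lam * a * dx := by
          rw [hdt]; push_cast; ring
        have e2 : stencil r p c (fun j => u n j - W n j) j =
            stencil r p c (u n) j - stencil r p c (W n) j := by
          simp only [stencil, mul_sub, Finset.sum_sub_distrib]
        rw [e2, hu.interior n j hj.1 hj.2]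
        simp only [hW, e1]
        rw [← neg_sq, stencil]
        congr 1; ring
      refine (le_of_eq h2).trans (h1.trans ?_)
      calc K ^ 2 * dx ^ (2 * k) * dx * ∫ y, g y ^ 2 ≤ K ^ 2 * dx ^ (2 * k) * dx * H ^ 2 := by gcongr
        _ = ε ^ 2 := by
          rw [hε, mul_pow, mul_pow, mul_pow, Real.sq_sqrt hdx.le, ← pow_mul, mul_comm k 2]
  have hγ0 : 0 ≤ γ := by positivity
  have hε0 : 0 ≤ ε := by positivity
  have h1 := hstab J ε γ _ hJ hγ0 hpert n hn
  have h2 : energy J (fun j => u 0 j - W 0 j) = 0 := by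
    refine Finset.sum_eq_zero fun j hj => ?_
    rw [Finset.mem_Icc] at hj
    simp only [hu0 j hj.1 hj.2, hW]
    simp
  rw [h2, zero_add] at h1
  set E := Real.exp (C * (n / J)) with hE
  have hE1 : 1 ≤ E := Real.one_le_exp (by positivity)
  have hn0 : (0 : ℝ) ≤ n := Nat.cast_nonneg _
  have h3 : |u n j - W n j| ≤ (C + 1) * E * (n * ε + Real.sqrt n * γ) := by
    refine abs_le_of_sq_le_sq ?_ (by positivity)
    have h4 := sq_le_energy (fun j => u n j - W n j) hj1 hj2
    calc (u n j - W n j) ^ 2 ≤ C * E * ((n * ε) ^ 2 + n * γ ^ 2) := h4.trans h1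
      -- The bound is enlarged to a perfect square, which avoids roots of `C` and `E`.
      _ ≤ (C + 1) ^ 2 * E ^ 2 * (n * ε + Real.sqrt n * γ) ^ 2 := by
          gcongr
          · nlinarith
          · exact le_self_pow₀ hE1 two_ne_zero
          · have e : (n : ℝ) * γ ^ 2 = (Real.sqrt n * γ) ^ 2 := by
              rw [mul_pow (Real.sqrt n), Real.sq_sqrt hn0]
            rw [e]
            have : 0 ≤ (n * ε) * (Real.sqrt n * γ) := by positivity
            nlinarith
      _ = ((C + 1) * E * (n * ε + Real.sqrt n * γ)) ^ 2 := by ring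
  have hεle : n * ε + Real.sqrt n * γ ≤
      (K + M + 1) * ((n * Real.sqrt dx + Real.sqrt n) * dx ^ q * H) := by
    have hdk : dx ^ k ≤ dx ^ q := pow_le_pow_of_le_one hdx.le hdx1 hqk
    have hM0 : 0 ≤ M := by positivity
    calc n * ε + Real.sqrt n * γ = K * (n * Real.sqrt dx * dx ^ k * H) +
          M * (Real.sqrt n * dx ^ q * H) := by rw [hε, hγ]; ring
      _ ≤ (K + M + 1) * (n * Real.sqrt dx * dx ^ q * H) +
          (K + M + 1) * (Real.sqrt n * dx ^ q * H) := by
          gcongr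
          · linarith
          · linarith
      _ = _ := by ring
  have hEE : E ≤ Real.exp ((C + 1) * (K + M + 1) * (n / J)) := by
    apply Real.exp_le_exp.2
    have hM0 : 0 ≤ M := by positivity
    gcongr
    nlinarith [mul_nonneg hC.le hK, mul_nonneg hC.le hM0]
  calc |u n j - W n j| ≤ (C + 1) * E * (n * ε + Real.sqrt n * γ) := h3
    _ ≤ (C + 1) * E * ((K + M + 1) * ((n * Real.sqrt dx + Real.sqrt n) * dx ^ q * H)) := by
        gcongr
    _ = (C + 1) * (K + M + 1) * E * ((n * Real.sqrt dx + Real.sqrt n) * dx ^ q * H) := by ring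
    _ ≤ _ := by gcongr

end Convergence

end

theorem theorem1 (a : ℝ) (ha : 0 < a) (k : ℕ) (hk : 1 ≤ k) (kb : ℕ) (lam : ℝ) (hlam : 0 < lam)
    (r p : ℕ) (hp : 1 ≤ p) (c : ℤ → ℝ) (hc : SchemeAssumption a lam r p k c) :
    ∃ C : ℝ, 0 < C ∧
      ∀ (T : ℝ), 0 < T → ∀ (J : ℕ), 1 ≤ J → ∀ (L : ℝ), 1 ≤ L →
      ∀ (u₀ : ℝ → ℝ), MemH (k + 1) L u₀ → (∀ m ≤ k, DerivVanishesAtZero L m u₀) →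
      ∀ (dx dt : ℝ), dx = L / J → dt = lam * dx →
      ∀ (u : ℕ → ℤ → ℝ), IsSchemeSolution r p kb c J dx u₀ u →
      ∀ (n : ℕ), (n : ℝ) ≤ T / dt → ∀ (j : ℤ), 1 ≤ j → j ≤ J →
        |u n j - cellAverage dx (fun y => extendZero u₀ (y - a * (n * dt))) j| ≤
          C * (Real.sqrt T + T) * Real.exp (C * T / L) *
            dx ^ (((min k kb : ℕ) : ℝ) - 1 / 2) * normH (k + 1) L u₀ := by
  obtain ⟨C1, hC1, hcoarse⟩ := exists_coarse_bound ha hlam hk hc kb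
  obtain ⟨C2, hC2, hfine⟩ := exists_fine_bound ha hlam hk hc kb
  set sl := Real.sqrt lam with hsl
  have hsl0 : 0 < sl := Real.sqrt_pos.2 hlam
  -- The quotients by `lam` come from `n ≤ T / (lam * dx)`, those by `sl` from its square root.
  set C := C1 / lam + C2 / lam + C1 / sl + C2 / sl with hC
  have hCpos : 0 < C := by positivity
  refine ⟨C, hCpos, ?_⟩
  intro T hT J hJ L hL u₀ hu₀ hvan dx dt hdx hdt u hu n hn j hj1 hj2
  have hJ' : (0 : ℝ) < J := by exact_mod_cast hJ
  have hL0 : 0 < L := by linarith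
  have hdx0 : 0 < dx := by rw [hdx]; positivity
  have hdt0 : 0 < dt := by rw [hdt]; positivity
  have hJL : J * dx = L := by rw [hdx]; field_simp
  set H := normH (k + 1) L u₀ with hH
  have hH0 : 0 ≤ H := Real.sqrt_nonneg _
  set q := min k kb with hq
  obtain ⟨g, hg, hg2, hg0, hgL, hgH, hI, hrep⟩ := exists_iterInt_representation hL0 hu₀ hvan
  -- Agreement almost everywhere up to `L` is enough: the averages over cells `j ≤ J` involve only
  -- points `y - s ≤ L`.
  have hext : ∀ᵐ z : ℝ, z ≤ L → extendZero u₀ z = iterInt g k z := by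
    have h1 := (ae_restrict_iff' measurableSet_Ioo).1 hrep
    have h2 : ∀ᵐ z : ℝ, z ≠ L := by simp [ae_iff]
    filter_upwards [h1, h2] with z hz hzL hzl
    rw [extendZero]
    split_ifs with h0
    · exact (iterInt_eq_zero hg0 k z h0).symm
    · exact hz ⟨not_le.1 h0, lt_of_le_of_ne hzl hzL⟩
  have havg : ∀ s : ℝ, 0 ≤ s → ∀ j : ℤ, j ≤ J →
      cellAverage dx (fun y => extendZero u₀ (y - s)) j =
        cellAverage dx (fun y => iterInt g k (y - s)) j := by
    intro s hs j hj
    refine cellAverage_congr_ae hdx0 ?_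
    have h1 := (measurePreserving_sub_right volume s).quasiMeasurePreserving.ae hext
    filter_upwards [h1] with y hy _ hyj
    refine hy ?_
    have h2 : (j : ℝ) ≤ J := by exact_mod_cast hj
    have h3 : (j : ℝ) * dx ≤ J * dx := by gcongr
    linarith
  have hinit : ∀ j : ℤ, 1 ≤ j → j ≤ J → cellAverage dx u₀ j =
      cellAverage dx (fun y => extendZero u₀ (y - 0)) j := by
    intro j hj _
    refine cellAverage_congr_ae hdx0 (ae_of_all _ fun y hy _ => ?_)
    have h1 : (1 : ℝ) ≤ j := by exact_mod_cast hj
    have h2 : 0 ≤ ((j : ℝ) - 1) * dx := mul_nonneg (by linarith) hdx0.le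
    rw [extendZero, if_neg (by linarith), sub_zero]
  have hu0 : ∀ j : ℤ, 1 ≤ j → j ≤ J → u 0 j = cellAverage dx (iterInt g k) j := by
    intro j h1 h2
    rw [hu.initial j h1 h2, hinit j h1 h2, havg 0 le_rfl j h2]
    simp only [sub_zero]
  have hs : 0 ≤ a * (n * dt) := by positivity
  rw [havg _ hs j hj2, rpow_sub_half hdx0]
  rcases Nat.eq_zero_or_pos n with rfl | hn1
  · rw [hu0 j hj1 hj2]
    simp only [Nat.cast_zero, zero_mul, mul_zero, sub_zero, sub_self, abs_zero]
    positivity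
  have hnT : (n : ℝ) * dt ≤ T := (le_div_iff₀ hdt0).1 hn
  have hnJ : (n : ℝ) / J ≤ T / L / lam := by
    rw [div_div, div_le_div_iff₀ hJ' (by positivity), ← hJL]
    rw [hdt] at hnT
    nlinarith
  have hexp : ∀ C', 0 ≤ C' → C' / lam ≤ C →
      Real.exp (C' * (n / J)) ≤ Real.exp (C * T / L) := by
    intro C' hC' h
    apply Real.exp_le_exp.2
    calc C' * (n / J) ≤ C' * (T / L / lam) := by gcongr
      _ = C' / lam * (T / L) := by ring
      _ ≤ C * (T / L) := by gcongr
      _ = C * T / L := by ring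
  have p1 : 0 < C1 / lam := by positivity
  have p2 : 0 < C2 / lam := by positivity
  have p3 : 0 < C1 / sl := by positivity
  have p4 : 0 < C2 / sl := by positivity
  have hsd : 0 < Real.sqrt dx := Real.sqrt_pos.2 hdx0
  set E := Real.exp (C * T / L) with hE
  rcases le_total 1 dx with hdx1 | hdx1
  · refine (hcoarse J L dx H (iterInt g k) u₀ u hJ hdx0 hH0 hJL (continuous_iterInt hg k)
      (iterInt_eq_zero hg0 k) (hI k le_rfl) hu hu0 n hn1 _ hs j hj1 hj2).trans ?_
    -- As `n ≥ 1`, a whole time step fits into `[0, T]`, so `lam ≤ T`; this keeps `√T + T` away from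
    -- zero.
    have h1 : sl ≤ Real.sqrt T + T := by
      have h2 : (1 : ℝ) ≤ n := by exact_mod_cast hn1
      have h3 : lam ≤ T := by
        have : dt ≤ n * dt := le_mul_of_one_le_left hdt0.le h2
        have : lam ≤ lam * dx := le_mul_of_one_le_right hlam.le hdx1
        linarith
      have := Real.sqrt_le_sqrt h3
      linarith
    have h4 : C1 ≤ C * (Real.sqrt T + T) := by
      calc C1 = C1 / sl * sl := by field_simp
        _ ≤ C * (Real.sqrt T + T) := by gcongr; linarith
    have h5 : H / Real.sqrt dx ≤ dx ^ q / Real.sqrt dx * H := by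
      rw [div_mul_eq_mul_div]
      gcongr
      exact le_mul_of_one_le_left hH0 (one_le_pow₀ hdx1)
    calc C1 * Real.exp (C1 * (n / J)) * (H / Real.sqrt dx)
        ≤ C * (Real.sqrt T + T) * E * (dx ^ q / Real.sqrt dx * H) := by
          gcongr
          exact hexp C1 hC1.le (by linarith)
      _ = _ := by ring
  · refine (hfine J L dx dt H g u₀ u hJ hdx0 hdx1 hL hH0 hJL hdt hg hg2 hg0 hgL hgH hI hu hu0 n hn1
      j hj1 hj2).trans ?_
    rw [hdt] at hnT
    -- The quotient by `√dx`, here and in the next bound, is the half power lost in the theorem.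
    have h1 : (n : ℝ) * Real.sqrt dx ≤ T / lam / Real.sqrt dx := by
      rw [le_div_iff₀ hsd, le_div_iff₀ hlam, mul_assoc (n : ℝ), Real.mul_self_sqrt hdx0.le]
      linarith
    have h2 : Real.sqrt n ≤ Real.sqrt T / sl / Real.sqrt dx := by
      rw [le_div_iff₀ hsd, le_div_iff₀ hsl0, hsl, ← Real.sqrt_mul (Nat.cast_nonneg n),
        ← Real.sqrt_mul (by positivity)]
      apply Real.sqrt_le_sqrt
      linarith
    have h3 : C2 * (n * Real.sqrt dx + Real.sqrt n) ≤ C * (Real.sqrt T + T) / Real.sqrt dx := by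
      calc C2 * (n * Real.sqrt dx + Real.sqrt n)
          ≤ C2 * (T / lam / Real.sqrt dx + Real.sqrt T / sl / Real.sqrt dx) := by gcongr
        _ = (C2 / sl * Real.sqrt T + C2 / lam * T) / Real.sqrt dx := by ring
        _ ≤ (C * Real.sqrt T + C * T) / Real.sqrt dx := by
          gcongr
          · linarith
          · linarith
        _ = _ := by ring
    calc C2 * Real.exp (C2 * (n / J)) * ((n * Real.sqrt dx + Real.sqrt n) * dx ^ q * H)
        = (C2 * (n * Real.sqrt dx + Real.sqrt n)) * Real.exp (C2 * (n / J)) * dx ^ q * H := by ring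
      _ ≤ (C * (Real.sqrt T + T) / Real.sqrt dx) * E * dx ^ q * H := by
          gcongr
          exact hexp C2 hC2.le (by linarith)
      _ = _ := by ring
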